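/- Let $d,n\ge 1$ be integers, $0\le s<1$, $\Omega=(0,1)^d$. For $f:\Omega\to\mathbb R$ write $\|f\|_{n,\infty}=\max_{|\alpha|\le n}\|D^\alpha f\|_{L^\infty(\Omega)}$ (weak derivatives), let $W^{n,\infty}(\Omega)$ be the corresponding Sobolev space, and put $\|f\|_{s,\infty}=\max\{\|f\|_{L^\infty(\Omega)},\ \operatorname{ess\,sup}_{x,x'\in\Omega}|f(x)-f(x')|/|x-x'|^s\}$ if $0<s<1$ and $\|f\|_{0,\infty}=\|f\|_{L^\infty(\Omega)}$. For a symmetric positive definite matrix $\Gamma\in\mathbb R^{D\times D}$ and a forward map $\mathcal G:\Omega\to\mathbb R^D$ let $$\Phi(y;\theta)=\tfrac12\,(y-\mathcal G(\theta))^{\top}\Gamma^{-1}(y-\mathcal G(\theta)),\qquad y\in\mathbb R^D,\ \theta\in\Omega,$$ and let $\pi(\cdot;\theta)\propto\exp(-\Phi(\cdot;\theta))$ be the corresponding likelihood, a probability density in $y\in\mathbb R^D$. For an emulator $\mathcal G^e:\mathbb R^d\to\mathbb R^D$ define $\Phi^e$ and $\pi^e$ in the same way, with $\mathcal G^e$ in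 place of $\mathcal G$ (and the same $\Gamma$). The Hellinger distance of densities is $d_H(p,q)=\big(\tfrac12\int(\sqrt p-\sqrt q)^2\,dy\big)^{1/2}$. A standard ReLU network is a feed-forward network without skip connections, $F_{K-1}\circ\dots\circ F_0$, whose layers are affine maps followed by the componentwise ReLU, except that the last layer is affine; $K$ is its depth. We say that it has size constant $c$ at accuracy $\varepsilon$ if $$K\le c\,\log\big(\varepsilon^{-n/(n-s)}\big),\qquad N\le c\,\varepsilon^{-d/(n-s)}\log^2\big(\varepsilon^{-n/(n-s)}\big),$$ where $N$ is the number of its nonzero weights and biases plus the number of its ReLU units. **Theorem.** There is a constant $c=c(d,n,s)>0$ such that for all $D$, all symmetric positive definite $\Gamma\in\mathbb R^{D\times D}$ and all $M,B$ there are constants $C,c'>0$ (depending only on $d,n,s,D,\Gamma,M,B$) with the following property. Let $\mathcal G=(\mathcal G_1,\dots,\mathcal G_D)$ with $\mathcal G_j\in W^{n,\infty}(\Omega)$ and $\|\mathcal G_j\|_{n,\infty}\le B$ for $j=1,\dots,D$, and let $\varepsilon\in(0,1/2)$. 1. There is a standard ReLU network $\mathcal G^e$ with size constant $c$ at accuracy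 $\varepsilon$ such that $\|\Phi(y;\cdot)-\Phi^e(y;\cdot)\|_{s,\infty}\le C\varepsilon$ for all $y$ with $\max_i|y_i|\le M$, and $$d_H\big(\pi(\cdot;\theta),\pi^e(\cdot;\theta)\big)\le C\varepsilon\quad\text{for almost every }\theta\in\Omega .$$ 2. There is a standard ReLU network $\mathcal G^e$ with size constant $c'$ at accuracy $\varepsilon$ such that $\|\Phi(y;\cdot)-\Phi^e(y;\cdot)\|_{s,\infty}\le\varepsilon$ for all $y$ with $\max_i|y_i|\le M$, and again $d_H(\pi(\cdot;\theta),\pi^e(\cdot;\theta))\le C\varepsilon$ for almost every $\theta\in\Omega$. -/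

import Mathlib

open MeasureTheory Set
open scoped ENNReal ContDiff Matrix

noncomputable section

namespace FBNN

/-- The parameter domain `Ω = (0,1)^d`, inside `ℝ^d` with its Euclidean norm. -/
def cube (d : ℕ) : Set (EuclideanSpace ℝ (Fin d)) :=
  {θ | ∀ i, θ i ∈ Ioo (0 : ℝ) 1}

/-- Lebesgue measure on `Ω`. -/
def cubeMeasure (d : ℕ) : Measure (EuclideanSpace ℝ (Fin d)) :=
  volume.restrict (cube d)

/-! ### Sobolev spaces on the cube -/

/-- The classical `i`-th partial derivative. -/
def partialDeriv {d : ℕ} (i : Fin d) (φ : EuclideanSpace ℝ (Fin d) → ℝ) :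
    EuclideanSpace ℝ (Fin d) → ℝ :=
  fun x => fderiv ℝ φ x (EuclideanSpace.single i 1)

/-- The classical derivative `D^α φ` for a multi-index `α` (used for smooth `φ` only, so that the
order of the partial derivatives is irrelevant). -/
def multiDeriv {d : ℕ} (α : Fin d → ℕ) (φ : EuclideanSpace ℝ (Fin d) → ℝ) :
    EuclideanSpace ℝ (Fin d) → ℝ :=
  (List.finRange d).foldr (fun i ψ => (partialDeriv i)^[α i] ψ) φ

/-- `g` is a weak derivative `D^α f` of `f` on `Ω`. -/
def IsWeakDeriv {d : ℕ} (α : Fin d → ℕ) (f g : EuclideanSpace ℝ (Fin d) → ℝ) : Prop :=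
  LocallyIntegrableOn f (cube d) ∧ LocallyIntegrableOn g (cube d) ∧
    ∀ φ : EuclideanSpace ℝ (Fin d) → ℝ,
      ContDiff ℝ ∞ φ → HasCompactSupport φ → tsupport φ ⊆ cube d →
        ∫ x in cube d, f x * multiDeriv α φ x
          = (-1) ^ (∑ i, α i) * ∫ x in cube d, g x * φ x

/-- `f ∈ W^{n,p}(Ω)`. -/
def MemSobolev {d : ℕ} (n : ℕ) (p : ℝ≥0∞) (f : EuclideanSpace ℝ (Fin d) → ℝ) : Prop :=
  MemLp f p (cubeMeasure d) ∧
    ∀ α : Fin d → ℕ, ∑ i, α i ≤ n → ∃ g, IsWeakDeriv α f g ∧ MemLp g p (cubeMeasure d)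

/-- `‖f‖_{n,∞} = max_{|α| ≤ n} ‖D^α f‖_∞`. Weak derivatives are unique up to null sets, so the
infimum over `g` is the common value of `‖g‖_∞` (and `∞` if there is no weak derivative). -/
def sobolevNormTop {d : ℕ} (n : ℕ) (f : EuclideanSpace ℝ (Fin d) → ℝ) : ℝ≥0∞ :=
  ⨆ (α : Fin d → ℕ) (_ : ∑ i, α i ≤ n),
    ⨅ (g : EuclideanSpace ℝ (Fin d) → ℝ) (_ : IsWeakDeriv α f g), eLpNorm g ∞ (cubeMeasure d)

/-- The Sobolev–Slobodeckij norm `‖f‖_{s,∞}` on `Ω`, `0 ≤ s < 1`; for `s = 0` it is `‖f‖_∞`. -/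
def slobodeckijNormTop {d : ℕ} (s : ℝ) (f : EuclideanSpace ℝ (Fin d) → ℝ) : ℝ≥0∞ :=
  if s = 0 then eLpNorm f ∞ (cubeMeasure d)
  else max (eLpNorm f ∞ (cubeMeasure d))
    (eLpNorm (fun z : EuclideanSpace ℝ (Fin d) × EuclideanSpace ℝ (Fin d) =>
      (f z.1 - f z.2) / ‖z.1 - z.2‖ ^ s) ∞ ((cubeMeasure d).prod (cubeMeasure d)))

/-! ### Standard ReLU networks -/

/-- Standard (feed-forward, without skip connections) networks with `k` outputs; the index is the
number of inputs. The last layer is affine, every other layer is affine followed by the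
componentwise ReLU. -/
inductive ReLUNet (k : ℕ) : ℕ → Type
  | output {m : ℕ} (W : Matrix (Fin k) (Fin m) ℝ) (b : Fin k → ℝ) : ReLUNet k m
  | hidden {m h : ℕ} (W : Matrix (Fin h) (Fin m) ℝ) (b : Fin h → ℝ) (rest : ReLUNet k h) :
      ReLUNet k m

namespace ReLUNet

/-- The function computed by the network. -/
def eval {k : ℕ} : {m : ℕ} → ReLUNet k m → (Fin m → ℝ) → (Fin k → ℝ)
  | _, output W b, x => W *ᵥ x + b
  | _, hidden W b rest, x => rest.eval (fun i => max 0 ((W *ᵥ x + b) i))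

/-- The depth: the number `K` of layers. -/
def depth {k : ℕ} : {m : ℕ} → ReLUNet k m → ℕ
  | _, output _ _ => 1
  | _, hidden _ _ rest => rest.depth + 1

/-- The number of nonzero entries of a weight matrix and a bias vector. -/
def layerWeights {k m : ℕ} (W : Matrix (Fin k) (Fin m) ℝ) (b : Fin k → ℝ) : ℕ :=
  {q : Fin k × Fin m | W q.1 q.2 ≠ 0}.ncard + {i : Fin k | b i ≠ 0}.ncard

/-- The number of (nonzero) weights, biases included. -/
def numWeights {k : ℕ} : {m : ℕ} → ReLUNet k m → ℕ
  | _, output W b => layerWeights W b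
  | _, hidden W b rest => layerWeights W b + rest.numWeights

/-- The number of ReLU units. -/
def numUnits {k : ℕ} : {m : ℕ} → ReLUNet k m → ℕ
  | _, output _ _ => 0
  | _, hidden (h := h) _ _ rest => h + rest.numUnits

/-- Depth at most `c log(ε^{-n/(n-s)})`, and number of weights and units at most
`c ε^{-d/(n-s)} log²(ε^{-n/(n-s)})`. -/
def SizeBound {k d : ℕ} (net : ReLUNet k d) (n : ℕ) (s c ε : ℝ) : Prop :=
  (net.depth : ℝ) ≤ c * Real.log (ε ^ (-((n : ℝ) / (n - s)))) ∧
  ((net.numWeights + net.numUnits : ℕ) : ℝ)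
    ≤ c * ε ^ (-((d : ℝ) / (n - s))) * Real.log (ε ^ (-((n : ℝ) / (n - s)))) ^ 2

/-- The network as a map on the parameter space `ℝ^d`. -/
def toMap {k d : ℕ} (net : ReLUNet k d) : EuclideanSpace ℝ (Fin d) → Fin k → ℝ :=
  fun θ => net.eval (fun i => θ i)

end ReLUNet

/-! ### Potentials, likelihoods and the Hellinger distance -/

/-- The potential `Φ(y; θ) = ½ ‖y - 𝒢(θ)‖_Γ²`, where `‖v‖_Γ² = vᵀ Γ⁻¹ v`. -/
def potential {d D : ℕ} (Γ : Matrix (Fin D) (Fin D) ℝ)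
    (G : EuclideanSpace ℝ (Fin d) → Fin D → ℝ) (y : Fin D → ℝ)
    (θ : EuclideanSpace ℝ (Fin d)) : ℝ :=
  (1 / 2) * ((y - G θ) ⬝ᵥ (Γ⁻¹ *ᵥ (y - G θ)))

/-- The likelihood `π(· ; θ) ∝ exp(-Φ(· ; θ))`, a probability density in `y ∈ ℝ^D` with respect
to Lebesgue measure. -/
def likelihood {d D : ℕ} (Γ : Matrix (Fin D) (Fin D) ℝ)
    (G : EuclideanSpace ℝ (Fin d) → Fin D → ℝ) (θ : EuclideanSpace ℝ (Fin d))
    (y : Fin D → ℝ) : ℝ :=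
  Real.exp (-potential Γ G y θ) / ∫ z : Fin D → ℝ, Real.exp (-potential Γ G z θ)

/-- The Hellinger distance of two densities: `d_H(p, q)² = ½ ∫ (√p - √q)² dμ`. -/
def hellingerDist {Y : Type*} [MeasurableSpace Y] (μ : Measure Y) (p q : Y → ℝ) : ℝ≥0∞ :=
  (2⁻¹ * ∫⁻ y, ENNReal.ofReal ((√(p y) - √(q y)) ^ 2) ∂μ) ^ (1 / 2 : ℝ)

end FBNN

end

/-! Everything reduces to emulating each component of the forward map with error of order ε in a
Hölder sense on a set of full measure.

Approximation. Put a partition of unity of tensor hat functions on a grid of width 1/N, and multiply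
each hat by a Taylor polynomial of degree less than n. The error is of order N^(-n) in the sup norm
and N^(-(n-1)) in the Lipschitz seminorm, so interpolation gives N^(s-n), and N ≈ ε^(-1/(n-s))
suffices. Classical Taylor expansion is enough: f is mollified, the estimates are proved for the
mollifications on slightly smaller cubes, and they pass to the limit almost everywhere. The
coefficients stay in a fixed bounded box, so a subsequence of them converges
(`exists_ae_local_approx`).

Networks. On the cube, x_i = hat (x_i - 1) and 1 = hat 0, so every localized monomial is a product
of d + n hats. Products are formed by polarization from the sawtooth approximation of t - t²: about
2k layers give accuracy 4^(-k), with a Lipschitz constant independent of k. No approximation of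
derivatives is needed: interpolating a tiny sup error N^(-q) against a Lipschitz constant of order N
makes the Hölder error as small as desired once q(1 - s) is large, and k stays of order log N. The
product programs for different monomials run in parallel in block-diagonal layers, so the size is
linear in the number of monomials (`exists_net_holderOn`, `exists_net_accuracy`).

Uniformity in D. The output layer alone may have D times as many weights as there are monomials, yet
c must not depend on D. With ℓ the logarithm in the size bound, the construction has size at most a
constant times (D + ℓ) ε^(-d/(n-s)), while ℓ² is allowed. If D ≤ ℓ this fits. If ℓ < D then ε > exp
(-D), and the zero network is already accurate with a constant C that depends on D. The second claim
applies the construction at accuracy ε / C, since c' may depend on everything.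

Potentials and likelihoods. The difference of potentials is a sum of products of components of the
forward error with bounded Hölder functions (`potential_sub_eq`). The likelihoods are Gaussians with
common covariance, so with Q the Γ⁻¹-quadratic form of the forward error, the squared Hellinger
distance is exactly 1 - exp (-Q / 8) (`hellingerDist_likelihood_le`). -/

namespace FBNN

/-! ### Networks over arbitrary finite index types -/

/-- A single layer: an affine map followed by the componentwise ReLU. -/
def reluLayer {ι κ : Type*} [Fintype ι] (W : Matrix κ ι ℝ) (b : κ → ℝ) (x : ι → ℝ) : κ → ℝ :=
  fun i => max 0 ((W *ᵥ x + b) i)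

/-- `F` is computed by a network of depth `K` with at most `w` weights and units, for every
enumeration of the input coordinates. -/
def Realizable {ι : Type*} [Fintype ι] {k : ℕ} (F : (ι → ℝ) → Fin k → ℝ) (K w : ℕ) : Prop :=
  ∀ (m : ℕ) (e : ι ≃ Fin m), ∃ net : ReLUNet k m,
    (∀ x, net.eval (x ∘ e.symm) = F x) ∧ net.depth = K ∧ net.numWeights + net.numUnits ≤ w

theorem layerWeights_le {k m : ℕ} (W : Matrix (Fin k) (Fin m) ℝ) (b : Fin k → ℝ) {r : ℕ}
    (hr : ∀ i, {j | W i j ≠ 0}.ncard ≤ r) : ReLUNet.layerWeights W b ≤ k * r + k := by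
  classical
  unfold ReLUNet.layerWeights
  refine add_le_add ?_ ?_
  · have : {q : Fin k × Fin m | W q.1 q.2 ≠ 0}
        = ⋃ i ∈ (Finset.univ : Finset (Fin k)), (Prod.mk i) '' {j | W i j ≠ 0} := by
      ext ⟨i, j⟩
      simp
    rw [this]
    refine (Finset.set_ncard_biUnion_le _ _).trans ?_
    refine (Finset.sum_le_card_nsmul _ _ r fun i _ => ?_).trans (by simp)
    exact (Set.ncard_image_le (Set.toFinite _)).trans (hr i)
  · exact (Set.ncard_le_card _).trans (by simp)

theorem ncard_row_submatrix {ι κ ι' κ' : Type*} (W : Matrix κ ι ℝ) (e : κ' ≃ κ) (f : ι' ≃ ι)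
    (i : κ') : {j | W.submatrix e f i j ≠ 0}.ncard = {j | W (e i) j ≠ 0}.ncard := by
  have : {j | W.submatrix e f i j ≠ 0} = f ⁻¹' {j | W (e i) j ≠ 0} := rfl
  rw [this, ← Equiv.image_symm_eq_preimage]
  exact Set.ncard_image_of_injective _ f.symm.injective

theorem ncard_row_le {ι κ : Type*} [Fintype ι] (W : Matrix κ ι ℝ) (i : κ) :
    {j | W i j ≠ 0}.ncard ≤ Fintype.card ι :=
  (Set.ncard_le_card _).trans (by simp)

theorem realizable_affine {ι : Type*} [Fintype ι] {k : ℕ} (W : Matrix (Fin k) ι ℝ)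
    (b : Fin k → ℝ) :
    Realizable (fun x => W *ᵥ x + b) 1 (k * Fintype.card ι + k) := by
  intro m e
  refine ⟨.output (W.submatrix (Equiv.refl _) e.symm) b, fun x => ?_, rfl, ?_⟩
  · simp only [ReLUNet.eval, Matrix.submatrix_mulVec_equiv]
    congr 1
    ext i
    simp [Function.comp_def]
  · simp only [ReLUNet.numWeights, ReLUNet.numUnits, add_zero]
    refine layerWeights_le _ _ fun i => ?_
    rw [ncard_row_submatrix]
    exact ncard_row_le _ _

/-- Each new unit costs at most r weights, one bias and itself, hence r + 2. Layers are added on the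
input side, following the recursion of `ReLUNet`; since `Realizable` allows every enumeration of the
inputs, hidden units may be indexed by any finite type. -/
theorem Realizable.comp_layer {ι κ : Type*} [Fintype ι] [Fintype κ] {k : ℕ}
    {F : (κ → ℝ) → Fin k → ℝ} {K w : ℕ} (hF : Realizable F K w) (W : Matrix κ ι ℝ) (b : κ → ℝ)
    {r : ℕ} (hr : ∀ i, {j | W i j ≠ 0}.ncard ≤ r) :
    Realizable (fun x => F (reluLayer W b x)) (K + 1) (w + Fintype.card κ * (r + 2)) := by
  intro m e
  obtain ⟨net, h1, h2, h3⟩ := hF _ (Fintype.equivFin κ)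
  set f := Fintype.equivFin κ
  refine ⟨.hidden (W.submatrix f.symm e.symm) (b ∘ f.symm) net, fun x => ?_, ?_, ?_⟩
  · simp only [ReLUNet.eval, Matrix.submatrix_mulVec_equiv, ← h1]
    congr 1
    ext i
    simp [Function.comp_def, reluLayer]
  · simp [ReLUNet.depth, h2]
  · simp only [ReLUNet.numWeights, ReLUNet.numUnits]
    have := layerWeights_le (W.submatrix f.symm e.symm) (b ∘ f.symm) (r := r) fun i => by
      rw [ncard_row_submatrix]; exact hr _
    nlinarith

/-! ### Compositions of ReLU layers on a fixed set of registers -/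

/-- `P` is a composition of `K` ReLU layers on the registers `J`. -/
inductive Prog (J : Type) [Fintype J] : ℕ → ((J → ℝ) → J → ℝ) → Prop
  | nil : Prog J 0 id
  | cons {K : ℕ} {P : (J → ℝ) → J → ℝ} (W : Matrix J J ℝ) (b : J → ℝ) (h : Prog J K P) :
      Prog J (K + 1) (fun x => P (reluLayer W b x))

theorem Prog.comp {J : Type} [Fintype J] {K K' : ℕ} {P Q : (J → ℝ) → J → ℝ}
    (hP : Prog J K P) (hQ : Prog J K' Q) : Prog J (K + K') (fun x => Q (P x)) := by
  induction hP with
  | nil => simpa using hQ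
  | cons W b h ih => rw [Nat.add_right_comm]; exact .cons W b ih

theorem Prog.iterate {J : Type} [Fintype J] {K : ℕ} {P : (J → ℝ) → J → ℝ}
    (hP : Prog J K P) (k : ℕ) : Prog J (k * K) (P^[k]) := by
  induction k with
  | zero => simpa using Prog.nil
  | succ k ih =>
    rw [add_mul, one_mul, Function.iterate_succ', Function.comp_def]
    exact ih.comp hP

/-- Real-valued affine functions of the registers. -/
def IsAff {J : Type} [Fintype J] (f : (J → ℝ) → ℝ) : Prop :=
  ∃ (a : J → ℝ) (b : ℝ), ∀ x, f x = a ⬝ᵥ x + b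

namespace IsAff

variable {J : Type} [Fintype J] {f g : (J → ℝ) → ℝ}

theorem const (c : ℝ) : IsAff (fun _ : J → ℝ => c) := ⟨0, c, by simp⟩

theorem reg (j : J) : IsAff (fun x : J → ℝ => x j) := by
  classical
  exact ⟨Pi.single j 1, 0, by simp⟩

theorem add (hf : IsAff f) (hg : IsAff g) : IsAff (fun x => f x + g x) := by
  obtain ⟨a, b, h⟩ := hf
  obtain ⟨a', b', h'⟩ := hg
  exact ⟨a + a', b + b', fun x => by simp only [h, h', add_dotProduct]; ring⟩

theorem mul (c : ℝ) (hf : IsAff f) : IsAff (fun x => c * f x) := by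
  obtain ⟨a, b, h⟩ := hf
  exact ⟨c • a, c * b, fun x => by simp only [h, smul_dotProduct, smul_eq_mul]; ring⟩

theorem sub (hf : IsAff f) (hg : IsAff g) : IsAff (fun x => f x - g x) := by
  have := hf.add (hg.mul (-1))
  simpa [sub_eq_add_neg] using this

end IsAff

/-- Allows a layer to be specified by one affine formula per register, without writing its matrix.
-/
theorem Prog.of_isAff {J : Type} [Fintype J] {P : (J → ℝ) → J → ℝ} (f : J → (J → ℝ) → ℝ)
    (hf : ∀ j, IsAff (f j)) (hP : ∀ x j, P x j = max 0 (f j x)) : Prog J 1 P := by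
  choose a b h using hf
  have : P = fun x => id (reluLayer (Matrix.of a) b x) := by
    funext x j
    rw [hP, h]
    rfl
  rw [this]
  exact .cons _ _ .nil

/-- `P` applied to every block of registers. -/
def blockwise {A J : Type} (P : (J → ℝ) → J → ℝ) (X : A × J → ℝ) : A × J → ℝ :=
  fun q => P (fun j => X (q.1, j)) q.2

theorem blockwise_reluLayer {A J : Type} [Fintype A] [DecidableEq A] [Fintype J]
    (W : Matrix J J ℝ) (b : J → ℝ) (X : A × J → ℝ) :
    blockwise (reluLayer W b) X
      = reluLayer (Matrix.of fun p q : A × J => if p.1 = q.1 then W p.2 q.2 else 0)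
          (fun p => b p.2) X := by
  funext ⟨a, j⟩
  simp [blockwise, reluLayer, Matrix.mulVec, dotProduct, Fintype.sum_prod_type, ite_mul]

/-- The matrices are block diagonal, with at most `card J` nonzero entries per row, so the cost is
linear rather than quadratic in the number of blocks. Blocks will be localized monomials. -/
theorem Realizable.comp_blockwise {A J : Type} [Fintype A] [Fintype J] {k K K' w : ℕ}
    {P : (J → ℝ) → J → ℝ} (hP : Prog J K P) {F : (A × J → ℝ) → Fin k → ℝ}
    (hF : Realizable F K' w) :
    Realizable (fun X => F (blockwise P X)) (K' + K)
      (w + K * (Fintype.card A * Fintype.card J * (Fintype.card J + 2))) := by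
  classical
  induction hP with
  | nil => rw [zero_mul]; exact hF
  | @cons K P W b h ih =>
    have hr : ∀ p : A × J, {q | (Matrix.of fun p q : A × J =>
        if p.1 = q.1 then W p.2 q.2 else 0) p q ≠ 0}.ncard ≤ Fintype.card J := by
      intro p
      have hsub : {q | (Matrix.of fun p q : A × J =>
          if p.1 = q.1 then W p.2 q.2 else 0) p q ≠ 0} ⊆ (Prod.mk p.1) '' univ := by
        rintro ⟨a, j⟩ hq
        simp only [Matrix.of_apply, ne_eq, ite_eq_right_iff, not_forall, mem_ofPred_eq] at hq
        exact ⟨j, trivial, by rw [hq.1]⟩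
      refine (Set.ncard_le_ncard hsub (Set.toFinite _)).trans ?_
      refine (Set.ncard_image_le (Set.toFinite _)).trans ?_
      simp [Set.ncard_univ]
    have := ih.comp_layer _ (fun p : A × J => b p.2) hr
    simp only [← blockwise_reluLayer, Fintype.card_prod] at this
    rw [add_mul, one_mul, ← add_assoc, ← add_assoc]
    exact this

end FBNN

namespace FBNN

/-! ### Approximate squaring and multiplication -/

theorem abs_max_zero_sub_le (a b : ℝ) : |max 0 a - max 0 b| ≤ |a - b| := by
  simpa using abs_max_sub_max_le_max 0 a 0 b

/-- The tent map on `[0,1]`. -/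
noncomputable def tent (t : ℝ) : ℝ := 2 * t - 4 * max 0 (t - 1 / 2)

/-- One step of the sawtooth recursion: the first component iterates the tent map, the second
one accumulates its values in base `4`. -/
noncomputable def sqStep (p : ℝ × ℝ) : ℝ × ℝ :=
  (max 0 (tent p.1), max 0 (4 * p.2 + tent p.1))

/-- `sqAcc k x / 4 ^ k` approximates `x - x²` on `[0,1]`. -/
noncomputable def sqAcc (k : ℕ) (x : ℝ) : ℝ := (sqStep^[k] (x, 0)).2

theorem tent_eq (t : ℝ) : tent t = 1 - |2 * t - 1| := by
  unfold tent
  rcases le_total t (1 / 2) with h | h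
  · rw [max_eq_left (by linarith), abs_of_nonpos (by linarith)]; ring
  · rw [max_eq_right (by linarith), abs_of_nonneg (by linarith)]; ring

theorem tent_mem {t : ℝ} (ht : t ∈ Icc (0 : ℝ) 1) : tent t ∈ Icc (0 : ℝ) 1 := by
  rw [tent_eq]
  have : |2 * t - 1| ≤ 1 := abs_le.2 ⟨by linarith [ht.1], by linarith [ht.2]⟩
  exact ⟨by linarith, by linarith [abs_nonneg (2 * t - 1)]⟩

/-- The self-similarity of t - t² under the tent map T. Iterated, it expands t - t² on [0,1] as the
sum of 4^(-j) T^j(t) over j ≥ 1. -/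
theorem tent_sub_sq (t : ℝ) : tent t + (tent t - tent t ^ 2) = 4 * (t - t ^ 2) := by
  have := sq_abs (2 * t - 1)
  rw [tent_eq]
  linear_combination -this

theorem abs_tent_sub_le (t u : ℝ) : |tent t - tent u| ≤ 2 * |t - u| := by
  rw [tent_eq, tent_eq, show 1 - |2 * t - 1| - (1 - |2 * u - 1|)
    = |2 * u - 1| - |2 * t - 1| by ring]
  refine (abs_abs_sub_abs_le_abs_sub _ _).trans ?_
  rw [show 2 * u - 1 - (2 * t - 1) = 2 * (u - t) by ring, abs_mul, abs_sub_comm u t]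
  norm_num

/-- On [0,1] the clamps in `sqStep` are inactive, so `tent_sub_sq` makes the last identity an
invariant; its final term is the truncation error. -/
theorem sqStep_iterate {x : ℝ} (hx : x ∈ Icc (0 : ℝ) 1) (k : ℕ) :
    (sqStep^[k] (x, 0)).1 ∈ Icc (0 : ℝ) 1 ∧ 0 ≤ (sqStep^[k] (x, 0)).2 ∧
      4 ^ k * (x - x ^ 2) = (sqStep^[k] (x, 0)).2
        + ((sqStep^[k] (x, 0)).1 - (sqStep^[k] (x, 0)).1 ^ 2) := by
  induction k with
  | zero => simpa using hx
  | succ k ih =>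
    rw [Function.iterate_succ_apply']
    obtain ⟨h1, h2, h3⟩ := ih
    have ht := tent_mem h1
    simp only [sqStep]
    rw [max_eq_right ht.1, max_eq_right (by linarith [ht.1])]
    refine ⟨ht, by linarith [ht.1], ?_⟩
    rw [pow_succ]
    linear_combination 4 * h3 - tent_sub_sq (sqStep^[k] (x, 0)).1

theorem abs_sqAcc_sub_le {x : ℝ} (hx : x ∈ Icc (0 : ℝ) 1) (k : ℕ) :
    0 ≤ x - x ^ 2 - sqAcc k x / 4 ^ k ∧ x - x ^ 2 - sqAcc k x / 4 ^ k ≤ 1 / 4 / 4 ^ k := by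
  obtain ⟨h1, -, h3⟩ := sqStep_iterate hx k
  have h4 : (0 : ℝ) < 4 ^ k := by positivity
  have : x - x ^ 2 - sqAcc k x / 4 ^ k
      = ((sqStep^[k] (x, 0)).1 - (sqStep^[k] (x, 0)).1 ^ 2) / 4 ^ k := by
    rw [eq_div_iff h4.ne', sub_mul, div_mul_cancel₀ _ h4.ne', sqAcc]
    linarith
  rw [this]
  refine ⟨div_nonneg ?_ h4.le, ?_⟩
  · nlinarith [h1.1, h1.2]
  · gcongr
    nlinarith [sq_nonneg ((sqStep^[k] (x, 0)).1 - 1 / 2)]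

/-- The tent map at most doubles distances, and 4^k - 2^k solves the resulting recursion a ↦ 4a +
2·2^k. After division by 4^k the Lipschitz constant is at most 1 for every k. -/
theorem abs_sqStep_iterate_sub_le {x y : ℝ} (k : ℕ) :
    |(sqStep^[k] (x, 0)).1 - (sqStep^[k] (y, 0)).1| ≤ 2 ^ k * |x - y| ∧
    |(sqStep^[k] (x, 0)).2 - (sqStep^[k] (y, 0)).2| ≤ (4 ^ k - 2 ^ k) * |x - y| := by
  induction k with
  | zero => simp
  | succ k ih =>
    rw [Function.iterate_succ_apply', Function.iterate_succ_apply']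
    set p := sqStep^[k] (x, 0)
    set q := sqStep^[k] (y, 0)
    have ht := abs_tent_sub_le p.1 q.1
    simp only [sqStep]
    refine ⟨(abs_max_zero_sub_le _ _).trans ?_, (abs_max_zero_sub_le _ _).trans ?_⟩
    · rw [pow_succ]; linarith [ih.1]
    · rw [show 4 * p.2 + tent p.1 - (4 * q.2 + tent q.1)
        = 4 * (p.2 - q.2) + (tent p.1 - tent q.1) by ring]
      refine (abs_add_le _ _).trans ?_
      rw [abs_mul, pow_succ, pow_succ]
      norm_num
      nlinarith [ih.1, ih.2]

theorem abs_sqAcc_sub_sqAcc_le (x y : ℝ) (k : ℕ) :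
    |sqAcc k x / 4 ^ k - sqAcc k y / 4 ^ k| ≤ |x - y| := by
  have h4 : (0 : ℝ) < 4 ^ k := by positivity
  rw [← sub_div, abs_div, abs_of_pos h4, div_le_iff₀ h4]
  refine (abs_sqStep_iterate_sub_le k).2.trans ?_
  have : (0 : ℝ) < 2 ^ k := by positivity
  nlinarith [abs_nonneg (x - y)]

/-- The affine combination of squares from which the product is read off. -/
noncomputable def mulRaw (k : ℕ) (a b : ℝ) : ℝ :=
  (a + b) / 2 + (sqAcc k a / 4 ^ k / 2 + sqAcc k b / 4 ^ k / 2
    - 2 * (sqAcc k ((a + b) / 2) / 4 ^ k))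

/-- Approximate multiplication on `[0,1]`, clamped to `[0,1]`. -/
noncomputable def mulApprox (k : ℕ) (a b : ℝ) : ℝ :=
  max 0 (1 - max 0 (1 - mulRaw k a b))

theorem mulApprox_mem (k : ℕ) (a b : ℝ) : mulApprox k a b ∈ Icc (0 : ℝ) 1 :=
  ⟨le_max_left _ _, max_le zero_le_one (by linarith [le_max_left 0 (1 - mulRaw k a b)])⟩

theorem abs_clamp_sub_le (a b : ℝ) :
    |max 0 (1 - max 0 (1 - a)) - max 0 (1 - max 0 (1 - b))| ≤ |a - b| := by
  refine (abs_max_zero_sub_le _ _).trans ?_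
  rw [sub_sub_sub_cancel_left]
  refine (abs_max_zero_sub_le _ _).trans ?_
  rw [sub_sub_sub_cancel_left]

/-- Polarization: ab = 2((a+b)/2)² - a²/2 - b²/2, with each x² replaced by x minus the sawtooth
approximation of x - x². Clamping fixes ab and does not expand distances. -/
theorem abs_mulApprox_sub_mul_le {a b : ℝ} (ha : a ∈ Icc (0 : ℝ) 1) (hb : b ∈ Icc (0 : ℝ) 1)
    (k : ℕ) : |mulApprox k a b - a * b| ≤ 1 / 4 ^ k := by
  have hab : a * b = max 0 (1 - max 0 (1 - a * b)) := by
    have h0 : 0 ≤ a * b := mul_nonneg ha.1 hb.1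
    have h1 : a * b ≤ 1 := mul_le_one₀ ha.2 hb.1 hb.2
    rw [max_eq_right (by linarith : 0 ≤ 1 - a * b), max_eq_right (by linarith)]
    ring
  rw [hab]
  refine (abs_clamp_sub_le _ _).trans ?_
  have h1 := abs_sqAcc_sub_le ha k
  have h2 := abs_sqAcc_sub_le hb k
  have h3 := abs_sqAcc_sub_le (x := (a + b) / 2)
    ⟨by linarith [ha.1, hb.1], by linarith [ha.2, hb.2]⟩ k
  have h4 : (0 : ℝ) < 1 / 4 ^ k := by positivity
  have h5 : (1 : ℝ) / 4 / 4 ^ k = 1 / 4 * (1 / 4 ^ k) := by ring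
  rw [h5] at h1 h2 h3
  unfold mulRaw
  rw [abs_le]
  constructor <;> nlinarith

theorem abs_mulApprox_sub_mulApprox_le (a b a' b' : ℝ) (k : ℕ) :
    |mulApprox k a b - mulApprox k a' b'| ≤ 2 * |a - a'| + 2 * |b - b'| := by
  refine (abs_clamp_sub_le _ _).trans ?_
  have h1 := abs_le.1 (abs_sqAcc_sub_sqAcc_le a a' k)
  have h2 := abs_le.1 (abs_sqAcc_sub_sqAcc_le b b' k)
  have h3 := abs_sqAcc_sub_sqAcc_le ((a + b) / 2) ((a' + b') / 2) k
  have h4 : |(a + b) / 2 - (a' + b') / 2| ≤ (|a - a'| + |b - b'|) / 2 := by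
    rw [show (a + b) / 2 - (a' + b') / 2 = ((a - a') + (b - b')) / 2 by ring, abs_div]
    norm_num
    gcongr
    exact abs_add_le _ _
  have h5 := abs_le.1 (h3.trans h4)
  have h6 := abs_le.1 (le_refl |a - a'|)
  have h7 := abs_le.1 (le_refl |b - b'|)
  unfold mulRaw
  rw [abs_le]
  constructor <;> linarith [h1.1, h1.2, h2.1, h2.2, h5.1, h5.2, h6.1, h6.2, h7.1, h7.2]

/-- The approximate product of the factors `u l`, `l ∈ ls`, times `p`. -/
noncomputable def prodApprox {L : Type*} (k : ℕ) (u : L → ℝ) (ls : List L) (p : ℝ) : ℝ :=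
  ls.foldl (fun p l => mulApprox k p (u l)) p

/-- Factors in [0,1] do not amplify earlier errors, so the errors of the single multiplications add
up. -/
theorem abs_prodApprox_sub_le {L : Type*} (k : ℕ) (u : L → ℝ) (hu : ∀ l, u l ∈ Icc (0 : ℝ) 1)
    (ls : List L) {p q : ℝ} (hp : p ∈ Icc (0 : ℝ) 1) :
    |prodApprox k u ls p - q * (ls.map u).prod| ≤ |p - q| + ls.length * (1 / 4 ^ k) := by
  induction ls generalizing p q with
  | nil => simp [prodApprox]
  | cons l ls ih =>
    have h := ih (mulApprox_mem k p (u l)) (q := q * u l)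
    simp only [prodApprox, List.foldl_cons, List.map_cons, List.prod_cons, List.length_cons]
      at h ⊢
    rw [← mul_assoc]
    refine h.trans ?_
    have h1 := abs_mulApprox_sub_mul_le hp (hu l) k
    have h2 : |mulApprox k p (u l) - q * u l| ≤ 1 / 4 ^ k + |p - q| := by
      rw [show mulApprox k p (u l) - q * u l
        = (mulApprox k p (u l) - p * u l) + (p - q) * u l by ring]
      refine (abs_add_le _ _).trans (add_le_add h1 ?_)
      rw [abs_mul, abs_of_nonneg (hu l).1]
      exact mul_le_of_le_one_right (abs_nonneg _) (hu l).2
    push_cast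
    linarith

/-- One multiplication turns |p - q| into at most 2|p - q| + 2δ, hence the factor 4 per step. The
point is independence of k. -/
theorem abs_prodApprox_sub_prodApprox_le {L : Type*} (k : ℕ) (u v : L → ℝ) {δ : ℝ} (hδ : 0 ≤ δ)
    (huv : ∀ l, |u l - v l| ≤ δ) (ls : List L) (p q : ℝ) :
    |prodApprox k u ls p - prodApprox k v ls q| ≤ 4 ^ ls.length * (|p - q| + δ) := by
  induction ls generalizing p q with
  | nil =>
    simp [prodApprox, hδ]
  | cons l ls ih =>
    have h := ih (mulApprox k p (u l)) (mulApprox k q (v l))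
    simp only [prodApprox, List.foldl_cons, List.length_cons] at h ⊢
    refine h.trans ?_
    have h1 := abs_mulApprox_sub_mulApprox_le p (u l) q (v l) k
    have h2 := huv l
    rw [pow_succ, mul_assoc]
    gcongr
    linarith [abs_nonneg (p - q), abs_nonneg (u l - v l)]

/-! ### A register program for products -/

/-- The registers of the program that multiplies `m` numbers. -/
inductive Reg (m : ℕ) : Type
  | fac (l : Fin m)
  | aux (l : Fin m)
  | prod
  | arg (c : Fin 3)
  | half (c : Fin 3)
  | acc (c : Fin 3)

namespace Reg

variable {m : ℕ}

/-- An injection of the registers into a finite type. -/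
def encode : Reg m → ((Fin m ⊕ Fin m) ⊕ Unit) ⊕ (Fin 3 × Fin 3)
  | fac l => .inl (.inl (.inl l))
  | aux l => .inl (.inl (.inr l))
  | prod => .inl (.inr ())
  | arg c => .inr (0, c)
  | half c => .inr (1, c)
  | acc c => .inr (2, c)

theorem encode_injective : Function.Injective (encode (m := m)) := by
  rintro (_ | _ | _ | _ | _ | _) (_ | _ | _ | _ | _ | _) h <;> simp_all [encode]

noncomputable instance : Fintype (Reg m) := Fintype.ofInjective encode encode_injective

/-- Loads the factors of the next multiplication and their mean. -/
noncomputable def load (l : Fin m) (x : Reg m → ℝ) : Reg m → ℝ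
  | fac i => max 0 (x (fac i))
  | prod => max 0 (x prod)
  | arg 0 => max 0 (x prod)
  | arg 1 => max 0 (x (fac l))
  | arg 2 => max 0 (1 / 2 * (x prod + x (fac l)))
  | _ => max 0 0

/-- The first half of the sawtooth step. -/
noncomputable def fold (x : Reg m → ℝ) : Reg m → ℝ
  | half c => max 0 (x (arg c) - 1 / 2)
  | j => max 0 (x j)

/-- The second half of the sawtooth step. -/
noncomputable def accumulate (x : Reg m → ℝ) : Reg m → ℝ
  | arg c => max 0 (2 * x (arg c) - 4 * x (half c))
  | acc c => max 0 (4 * x (acc c) + (2 * x (arg c) - 4 * x (half c)))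
  | j => max 0 (x j)

/-- Reads off the product (first half of the clamping). -/
noncomputable def readOff (k : ℕ) (l : Fin m) (x : Reg m → ℝ) : Reg m → ℝ
  | prod => max 0 (1 - (1 / 2 * (x prod + x (fac l)) + ((1 / 4 ^ k / 2) * x (acc 0)
      + (1 / 4 ^ k / 2) * x (acc 1) - (2 / 4 ^ k) * x (acc 2))))
  | j => max 0 (x j)

/-- The second half of the clamping. -/
noncomputable def clamp (x : Reg m → ℝ) : Reg m → ℝ
  | prod => max 0 (1 - x prod)
  | j => max 0 (x j)

theorem prog_load (l : Fin m) : Prog (Reg m) 1 (load l) := by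
  refine Prog.of_isAff (fun
    | fac i => fun x => x (fac i)
    | prod => fun x => x prod
    | arg 0 => fun x => x prod
    | arg 1 => fun x => x (fac l)
    | arg 2 => fun x => 1 / 2 * (x prod + x (fac l))
    | _ => fun _ => 0) ?_ ?_
  · intro j
    rcases j with i | i | _ | c | c | c <;> try fin_cases c
    all_goals first
      | exact .reg _
      | exact .const _
      | exact .mul _ (.add (.reg _) (.reg _))
  · intro x j
    rcases j with i | i | _ | c | c | c <;> try fin_cases c
    all_goals rfl

theorem prog_fold : Prog (Reg m) 1 fold := by
  refine Prog.of_isAff (fun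
    | half c => fun x => x (arg c) - 1 / 2
    | j => fun x => x j) ?_ ?_
  · intro j
    rcases j with i | i | _ | c | c | c
    all_goals first
      | exact .reg _
      | exact .sub (.reg _) (.const _)
  · intro x j
    rcases j with i | i | _ | c | c | c <;> rfl

theorem prog_accumulate : Prog (Reg m) 1 accumulate := by
  have h : ∀ c : Fin 3, IsAff fun x : Reg m → ℝ => 2 * x (arg c) - 4 * x (half c) :=
    fun c => .sub (.mul _ (.reg _)) (.mul _ (.reg _))
  refine Prog.of_isAff (fun
    | arg c => fun x => 2 * x (arg c) - 4 * x (half c)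
    | acc c => fun x => 4 * x (acc c) + (2 * x (arg c) - 4 * x (half c))
    | j => fun x => x j) ?_ ?_
  · intro j
    rcases j with i | i | _ | c | c | c
    all_goals first
      | exact .reg _
      | exact h _
      | exact .add (.mul _ (.reg _)) (h _)
  · intro x j
    rcases j with i | i | _ | c | c | c <;> rfl

theorem prog_readOff (k : ℕ) (l : Fin m) : Prog (Reg m) 1 (readOff k l) := by
  refine Prog.of_isAff (fun
    | prod => fun x => 1 - (1 / 2 * (x prod + x (fac l)) + ((1 / 4 ^ k / 2) * x (acc 0)
      + (1 / 4 ^ k / 2) * x (acc 1) - (2 / 4 ^ k) * x (acc 2)))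
    | j => fun x => x j) ?_ ?_
  · intro j
    rcases j with i | i | _ | c | c | c
    all_goals first
      | exact .reg _
      | exact .sub (.const _) (.add (.mul _ (.add (.reg _) (.reg _)))
          (.sub (.add (.mul _ (.reg _)) (.mul _ (.reg _))) (.mul _ (.reg _))))
  · intro x j
    rcases j with i | i | _ | c | c | c <;> rfl

theorem prog_clamp : Prog (Reg m) 1 clamp := by
  refine Prog.of_isAff (fun
    | prod => fun x => 1 - x prod
    | j => fun x => x j) ?_ ?_
  · intro j
    rcases j with i | i | _ | c | c | c
    all_goals first
      | exact .reg _
      | exact .sub (.const _) (.reg _)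
  · intro x j
    rcases j with i | i | _ | c | c | c <;> rfl

/-- ReLU is the identity on nonnegative registers, so idle values survive every layer while the
three sawtooth recursions run in parallel. A step takes two layers because the tent map contains a
ReLU of its own. -/
theorem sawtooth_iterate (x : Reg m → ℝ) (hf : ∀ l, 0 ≤ x (fac l)) (hp : 0 ≤ x prod)
    (ha : ∀ c, 0 ≤ x (arg c)) (hc : ∀ c, x (acc c) = 0) (k : ℕ) :
    (∀ l, (fun x => accumulate (fold x))^[k] x (fac l) = x (fac l)) ∧
    (fun x => accumulate (fold x))^[k] x prod = x prod ∧
    ∀ c, ((fun x => accumulate (fold x))^[k] x (arg c),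
      (fun x => accumulate (fold x))^[k] x (acc c)) = sqStep^[k] (x (arg c), 0) ∧
      0 ≤ (fun x => accumulate (fold x))^[k] x (arg c) ∧
      0 ≤ (fun x => accumulate (fold x))^[k] x (acc c) := by
  induction k with
  | zero => simp [hc, ha]
  | succ k ih =>
    simp only [Function.iterate_succ_apply']
    set y := (fun x => accumulate (fold x))^[k] x
    obtain ⟨h1, h2, h3⟩ := ih
    refine ⟨fun l => ?_, ?_, fun c => ⟨?_, le_max_left _ _, le_max_left _ _⟩⟩
    · simp [accumulate, fold, h1, hf]
    · simp [accumulate, fold, h2, hp]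
    · obtain ⟨h4, h5, h6⟩ := h3 c
      rw [← h4]
      simp [accumulate, fold, sqStep, tent, h5, h6]

/-- One layer for loading, two per sawtooth step, two for the clamped read-off. Loading resets the
scratch registers and the factors are preserved, so multiplications can be chained. -/
theorem exists_prog_mul (k : ℕ) (l : Fin m) : ∃ P, Prog (Reg m) (2 * k + 3) P ∧
    ∀ x : Reg m → ℝ, (∀ i, 0 ≤ x (fac i)) → 0 ≤ x prod →
      (∀ i, P x (fac i) = x (fac i)) ∧ P x prod = mulApprox k (x prod) (x (fac l)) := by
  refine ⟨fun x => clamp (readOff k l ((fun x => accumulate (fold x))^[k] (load l x))), ?_,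
    fun x hf hp => ?_⟩
  · have h := (((prog_load l).comp ((prog_fold.comp prog_accumulate).iterate k)).comp
      (prog_readOff k l)).comp prog_clamp
    convert h using 1
    ring
  · beta_reduce
    have hf' : ∀ i, load l x (fac i) = x (fac i) := fun i => by simp [load, hf]
    have hp' : load l x prod = x prod := by simp [load, hp]
    have hm : 0 ≤ 1 / 2 * (x prod + x (fac l)) := by have := hf l; positivity
    obtain ⟨h1, h2, h3⟩ := sawtooth_iterate (load l x) (fun i => by rw [hf']; exact hf i)
      (by rw [hp']; exact hp) (fun c => by fin_cases c <;> simp [load]) (fun c => by simp [load]) k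
    set y := (fun x => accumulate (fold x))^[k] (load l x)
    have hacc : ∀ c, y (acc c) = sqAcc k (load l x (arg c)) := fun c => by
      rw [sqAcc, ← (h3 c).1]
    refine ⟨fun i => by simp [clamp, readOff, h1, hf', hf], ?_⟩
    simp only [clamp, readOff, mulApprox, mulRaw, h1, h2, hf', hp', hacc]
    simp only [load, max_eq_right hp, max_eq_right (hf l), max_eq_right hm]
    rw [show 1 / 2 * (x prod + x (fac l)) = (x prod + x (fac l)) / 2 by ring]
    congr 4
    ring

theorem exists_prog_prod (k : ℕ) (ls : List (Fin m)) : ∃ P,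
    Prog (Reg m) (ls.length * (2 * k + 3)) P ∧
    ∀ x : Reg m → ℝ, (∀ i, 0 ≤ x (fac i)) → 0 ≤ x prod →
      P x prod = prodApprox k (fun l => x (fac l)) ls (x prod) := by
  induction ls with
  | nil => exact ⟨id, by simpa using Prog.nil, fun x _ _ => rfl⟩
  | cons l ls ih =>
    obtain ⟨P, hP, h⟩ := ih
    obtain ⟨Q, hQ, h'⟩ := exists_prog_mul k l
    refine ⟨fun x => P (Q x), ?_, fun x hf hp => ?_⟩
    · convert hQ.comp hP using 1
      simp only [List.length_cons]; ring
    · obtain ⟨h1, h2⟩ := h' x hf hp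
      beta_reduce
      rw [h (Q x) (fun i => by rw [h1]; exact hf i) (by rw [h2]; exact (mulApprox_mem _ _ _).1)]
      simp [prodApprox, h1, h2]

/-- Turns the registers `(p x - q)₊`, `(q - p x)₊` into `(1 - |p x - q|)₊`. -/
noncomputable def hats (x : Reg m → ℝ) : Reg m → ℝ
  | fac l => max 0 (1 - (x (fac l) + x (aux l)))
  | j => max 0 (x j)

theorem prog_hats : Prog (Reg m) 1 hats := by
  refine Prog.of_isAff (fun
    | fac l => fun x => 1 - (x (fac l) + x (aux l))
    | j => fun x => x j) ?_ ?_
  · intro j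
    rcases j with i | i | _ | c | c | c
    all_goals first
      | exact .reg _
      | exact .sub (.const _) (.add (.reg _) (.reg _))
  · intro x j
    rcases j with i | i | _ | c | c | c <;> rfl

end Reg

end FBNN

/-! ### Sums of products of hat functions as a single network -/

namespace FBNN

/-- Linear combinations of approximate products of hat functions are networks. -/
theorem realizable_sum_prodApprox {A : Type} [Fintype A] {d D m : ℕ} (k : ℕ)
    (i : A → Fin m → Fin d) (p q : A → Fin m → ℝ) (c : Fin D → A → ℝ) :
    Realizable (fun (x : Fin d → ℝ) (j : Fin D) => ∑ a, c j a *
      prodApprox k (fun l => max 0 (1 - |p a l * x (i a l) - q a l|)) (List.finRange m) 1)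
      (m * (2 * k + 3) + 3)
      ((D * (Fintype.card A * Fintype.card (Reg m)) + D)
        + (m * (2 * k + 3) + 1)
          * (Fintype.card A * Fintype.card (Reg m) * (Fintype.card (Reg m) + 2))
        + Fintype.card A * Fintype.card (Reg m) * (d + 2)) := by
  classical
  obtain ⟨P, hP, hPprod⟩ := Reg.exists_prog_prod (m := m) k (List.finRange m)
  have hP' := Reg.prog_hats.comp hP
  let Wout : Matrix (Fin D) (A × Reg m) ℝ :=
    Matrix.of fun j b => if b.2 = Reg.prod then c j b.1 else 0
  -- With the biases `bin`, the first layer stores the positive and negative parts of p x - q in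
  -- `fac` and `aux`, and the starting value 1 in `prod`. The two parts sum to |p x - q|, from which
  -- `Reg.hats` forms the hat.
  let Win : Matrix (A × Reg m) (Fin d) ℝ := Matrix.of fun b t => match b.2 with
    | .fac l => if t = i b.1 l then p b.1 l else 0
    | .aux l => if t = i b.1 l then -p b.1 l else 0
    | _ => 0
  let bin : A × Reg m → ℝ := fun b => match b.2 with
    | .fac l => -q b.1 l
    | .aux l => q b.1 l
    | .prod => 1
    | _ => 0
  have h := ((realizable_affine Wout 0).comp_blockwise hP').comp_layer Win bin
    (r := d) (fun b => (ncard_row_le _ _).trans (by simp))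
  rw [List.length_finRange, Fintype.card_prod] at h
  convert h using 1
  · funext x j
    simp only [Wout, Matrix.mulVec, dotProduct, Matrix.of_apply, Pi.add_apply, Pi.zero_apply,
      add_zero, Fintype.sum_prod_type, ite_mul, zero_mul, Finset.sum_ite_eq', Finset.mem_univ,
      if_true, blockwise]
    refine Finset.sum_congr rfl fun a _ => ?_
    congr 1
    have hfac : ∀ l, reluLayer Win bin x (a, .fac l) = max 0 (p a l * x (i a l) - q a l) := by
      intro l
      simp [reluLayer, Win, bin, Matrix.mulVec, dotProduct, sub_eq_add_neg]
    have haux : ∀ l, reluLayer Win bin x (a, .aux l) = max 0 (-(p a l * x (i a l) - q a l)) := by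
      intro l
      simp [reluLayer, Win, bin, Matrix.mulVec, dotProduct, sub_eq_add_neg, add_comm]
    have hprod : reluLayer Win bin x (a, .prod) = 1 := by
      simp [reluLayer, Win, bin, Matrix.mulVec, dotProduct]
    have habs : ∀ u : ℝ, max 0 u + max 0 (-u) = |u| := fun u => by
      rcases le_total 0 u with hu | hu
      · rw [max_eq_right hu, max_eq_left (by linarith), abs_of_nonneg hu, add_zero]
      · rw [max_eq_left hu, max_eq_right (by linarith), abs_of_nonpos hu, zero_add]
    rw [hPprod _ (fun l => le_max_left _ _) (le_max_left _ _)]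
    simp only [Reg.hats, hfac, haux, hprod, habs]
    norm_num
  all_goals ring

/-! ### Taylor expansion in terms of iterated partial derivatives -/

variable {d : ℕ}

theorem contDiff_partialDeriv {g : EuclideanSpace ℝ (Fin d) → ℝ} (hg : ContDiff ℝ ∞ g)
    (i : Fin d) : ContDiff ℝ ∞ (partialDeriv i g) :=
  (hg.fderiv_right (m := ∞) (by simp)).clm_apply contDiff_const

theorem two_le_infty : (2 : WithTop ℕ∞) ≤ ((⊤ : ℕ∞) : WithTop ℕ∞) :=
  WithTop.coe_le_coe.2 (le_top : (2 : ℕ∞) ≤ ⊤)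

theorem partialDeriv_comm {g : EuclideanSpace ℝ (Fin d) → ℝ} (hg : ContDiff ℝ ∞ g)
    (i j : Fin d) : partialDeriv i (partialDeriv j g) = partialDeriv j (partialDeriv i g) := by
  have hd : Differentiable ℝ (fderiv ℝ g) :=
    (hg.fderiv_right (m := ∞) (by simp)).differentiable (by simp)
  funext x
  have key : ∀ a b : Fin d, partialDeriv a (partialDeriv b g) x
      = fderiv ℝ (fderiv ℝ g) x (EuclideanSpace.single a 1) (EuclideanSpace.single b 1) := by
    intro a b
    unfold partialDeriv
    rw [fderiv_clm_apply (hd x) (differentiableAt_const _)]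
    simp
  rw [key, key]
  have hsym : IsSymmSndFDerivAt ℝ g x :=
    (hg.contDiffAt).isSymmSndFDerivAt (by simpa using two_le_infty)
  exact hsym _ _

theorem hasDerivAt_line {g : EuclideanSpace ℝ (Fin d) → ℝ} (hg : ContDiff ℝ ∞ g)
    (x v : EuclideanSpace ℝ (Fin d)) (τ : ℝ) :
    HasDerivAt (fun τ : ℝ => g (x + τ • v)) (∑ i, v i * partialDeriv i g (x + τ • v)) τ := by
  have h1 : HasDerivAt (fun τ : ℝ => x + τ • v) v τ := by
    simpa using ((hasDerivAt_id τ).smul_const v).const_add x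
  have h2 := ((hg.differentiable (by simp) (x + τ • v)).hasFDerivAt).comp_hasDerivAt τ h1
  have h3 : v = ∑ i, v i • EuclideanSpace.single i (1 : ℝ) := by
    ext j
    simp [Finset.sum_apply, Pi.single_apply]
  have h4 : fderiv ℝ g (x + τ • v) v = ∑ i, v i * partialDeriv i g (x + τ • v) := by
    conv_lhs => rw [h3]
    simp only [map_sum, map_smul, smul_eq_mul]
    rw [← h3]
    rfl
  rw [← h4]
  exact h2

/-- The iterated derivative along a word, outermost letter last. -/
noncomputable def wordDeriv : List (Fin d) → (EuclideanSpace ℝ (Fin d) → ℝ) →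
    EuclideanSpace ℝ (Fin d) → ℝ
  | [], g => g
  | i :: w, g => wordDeriv w (partialDeriv i g)

/-- All iterated derivatives of `g` up to order `n` are bounded by `B` on `Q`. -/
def DerivBound (n : ℕ) (B : ℝ) (Q : Set (EuclideanSpace ℝ (Fin d)))
    (g : EuclideanSpace ℝ (Fin d) → ℝ) : Prop :=
  ∀ w : List (Fin d), w.length ≤ n → ∀ x ∈ Q, |wordDeriv w g x| ≤ B

theorem DerivBound.partialDeriv {n : ℕ} {B : ℝ} {Q : Set (EuclideanSpace ℝ (Fin d))}
    {g : EuclideanSpace ℝ (Fin d) → ℝ} (h : DerivBound (n + 1) B Q g) (i : Fin d) :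
    DerivBound n B Q (partialDeriv i g) :=
  fun w hw x hx => h (i :: w) (by simpa using hw) x hx

theorem DerivBound.abs_le {n : ℕ} {B : ℝ} {Q : Set (EuclideanSpace ℝ (Fin d))}
    {g : EuclideanSpace ℝ (Fin d) → ℝ} (h : DerivBound n B Q g)
    {x : EuclideanSpace ℝ (Fin d)} (hx : x ∈ Q) : |g x| ≤ B :=
  h [] (by simp) x hx

/-- The `k`-th iterated derivative of `g` at `z` in the direction `h`. -/
noncomputable def taylorTerm : ℕ → (EuclideanSpace ℝ (Fin d) → ℝ) → EuclideanSpace ℝ (Fin d) →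
    EuclideanSpace ℝ (Fin d) → ℝ
  | 0, g, z, _ => g z
  | k + 1, g, z, h => ∑ i, h i * taylorTerm k (partialDeriv i g) z h

/-- Product rule and induction: differentiating the explicit factor gives one copy of the sum,
differentiating the inner term gives the others, and commuting partial derivatives identifies them.
-/
theorem hasDerivAt_taylorTerm (k : ℕ) {g : EuclideanSpace ℝ (Fin d) → ℝ}
    (hg : ContDiff ℝ ∞ g) (z h v : EuclideanSpace ℝ (Fin d)) (τ : ℝ) :
    HasDerivAt (fun τ : ℝ => taylorTerm (k + 1) g z (h + τ • v))
      ((k + 1) * ∑ i, v i * taylorTerm k (partialDeriv i g) z (h + τ • v)) τ := by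
  have hlin : ∀ i, HasDerivAt (fun τ : ℝ => (h + τ • v) i) (v i) τ := fun i => by
    simpa using ((hasDerivAt_id τ).mul_const (v i)).const_add (h i)
  induction k generalizing g with
  | zero =>
    have := HasDerivAt.fun_sum fun i (_ : i ∈ Finset.univ) =>
      (hlin i).mul_const (partialDeriv i g z)
    simpa [taylorTerm] using this
  | succ k ih =>
    have := HasDerivAt.fun_sum fun i (_ : i ∈ Finset.univ) =>
      (hlin i).fun_mul (ih (contDiff_partialDeriv hg i))
    refine HasDerivAt.congr_deriv (f := fun τ : ℝ => taylorTerm (k + 1 + 1) g z (h + τ • v))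
      this ?_
    rw [Finset.sum_add_distrib]
    have hswap : ∑ i, (h + τ • v) i * ((k + 1) * ∑ j, v j *
        taylorTerm k (partialDeriv j (partialDeriv i g)) z (h + τ • v))
        = (k + 1) * ∑ i, v i * taylorTerm (k + 1) (partialDeriv i g) z (h + τ • v) := by
      simp only [taylorTerm, Finset.mul_sum]
      rw [Finset.sum_comm]
      refine Finset.sum_congr rfl fun i _ => Finset.sum_congr rfl fun j _ => ?_
      rw [partialDeriv_comm hg i j]
      ring
    rw [hswap]
    push_cast
    ring

/-- The Taylor polynomial of degree less than `n` of `g` at `z`. -/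
noncomputable def taylorPoly (n : ℕ) (g : EuclideanSpace ℝ (Fin d) → ℝ)
    (z x : EuclideanSpace ℝ (Fin d)) : ℝ :=
  ∑ k ∈ Finset.range n, (1 / (k.factorial : ℝ)) * taylorTerm k g z (x - z)

theorem taylorPoly_self (n : ℕ) (g : EuclideanSpace ℝ (Fin d) → ℝ)
    (z : EuclideanSpace ℝ (Fin d)) : taylorPoly (n + 1) g z z = g z := by
  rw [taylorPoly, Finset.sum_range_succ']
  simp [taylorTerm]

/-- Differentiation commutes with taking Taylor polynomials, lowering the order by one. Hence the
derivative of a remainder is a combination of remainders of the partial derivatives. -/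
theorem hasDerivAt_taylorPoly (n : ℕ) {g : EuclideanSpace ℝ (Fin d) → ℝ}
    (hg : ContDiff ℝ ∞ g) (z x v : EuclideanSpace ℝ (Fin d)) (τ : ℝ) :
    HasDerivAt (fun τ : ℝ => taylorPoly (n + 1) g z (x + τ • v))
      (∑ i, v i * taylorPoly n (partialDeriv i g) z (x + τ • v)) τ := by
  have h1 : (fun τ : ℝ => taylorPoly (n + 1) g z (x + τ • v)) = fun τ : ℝ =>
      (∑ k ∈ Finset.range n, (1 / ((k + 1).factorial : ℝ)) *
        taylorTerm (k + 1) g z ((x - z) + τ • v)) + g z := by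
    funext τ
    rw [taylorPoly, Finset.sum_range_succ', add_sub_right_comm]
    simp [taylorTerm]
  rw [h1]
  have h2 := (HasDerivAt.fun_sum fun k (_ : k ∈ Finset.range n) =>
    (hasDerivAt_taylorTerm k hg z (x - z) v τ).const_mul
      (1 / ((k + 1).factorial : ℝ))).add_const (g z)
  refine h2.congr_deriv ?_
  simp only [taylorPoly, Finset.mul_sum, add_sub_right_comm]
  rw [Finset.sum_comm]
  refine Finset.sum_congr rfl fun i _ => Finset.sum_congr rfl fun k _ => ?_
  rw [Nat.factorial_succ]
  have : (k.factorial : ℝ) ≠ 0 := by positivity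
  push_cast
  field_simp

/-- The `ℓ¹` norm of a vector. -/
def normOne (v : EuclideanSpace ℝ (Fin d)) : ℝ := ∑ i, |v i|

theorem normOne_nonneg (v : EuclideanSpace ℝ (Fin d)) : 0 ≤ normOne v :=
  Finset.sum_nonneg fun _ _ => abs_nonneg _

theorem normOne_le (v : EuclideanSpace ℝ (Fin d)) : normOne v ≤ d * ‖v‖ := by
  refine (Finset.sum_le_card_nsmul _ _ ‖v‖ fun i _ => ?_).trans (by simp)
  exact PiLp.norm_apply_le v i

theorem normOne_smul (t : ℝ) (v : EuclideanSpace ℝ (Fin d)) :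
    normOne (t • v) = |t| * normOne v := by
  simp [normOne, abs_mul, Finset.mul_sum]

/-- Mean value inequality for the remainder along the segment from x to y, where ρ bounds the
distance to z. With x = z it drives the induction for the sup bound; for x, y near z it gives the
Lipschitz bound. -/
theorem abs_taylorRemainder_sub_le {n : ℕ} {B ρ : ℝ} (hB : 0 ≤ B)
    {Q : Set (EuclideanSpace ℝ (Fin d))} (hQ : Convex ℝ Q)
    {g : EuclideanSpace ℝ (Fin d) → ℝ} (hg : ContDiff ℝ ∞ g)
    {z x y : EuclideanSpace ℝ (Fin d)} (hx : x ∈ Q) (hy : y ∈ Q)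
    (hrem : ∀ i, ∀ u ∈ Q, |partialDeriv i g u - taylorPoly n (partialDeriv i g) z u|
      ≤ B * normOne (u - z) ^ n)
    (hρ : ∀ τ ∈ Icc (0 : ℝ) 1, normOne (x + τ • (y - x) - z) ≤ ρ) :
    |(g y - taylorPoly (n + 1) g z y) - (g x - taylorPoly (n + 1) g z x)|
      ≤ normOne (y - x) * (B * ρ ^ n) := by
  have hderiv : ∀ τ : ℝ, HasDerivAt
      (fun τ : ℝ => g (x + τ • (y - x)) - taylorPoly (n + 1) g z (x + τ • (y - x)))
      (∑ i, (y - x) i * (partialDeriv i g (x + τ • (y - x))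
        - taylorPoly n (partialDeriv i g) z (x + τ • (y - x)))) τ := by
    intro τ
    refine ((hasDerivAt_line hg x (y - x) τ).sub
      (hasDerivAt_taylorPoly n hg z x (y - x) τ)).congr_deriv ?_
    rw [← Finset.sum_sub_distrib]
    simp only [mul_sub]
  have := norm_image_sub_le_of_norm_deriv_le_segment_01' (C := normOne (y - x) * (B * ρ ^ n))
    (fun τ _ => (hderiv τ).hasDerivWithinAt) ?_
  · simpa using this
  · intro τ hτ
    have hτ' : τ ∈ Icc (0 : ℝ) 1 := ⟨hτ.1, hτ.2.le⟩
    have hmem : x + τ • (y - x) ∈ Q := hQ.add_smul_sub_mem hx hy hτ'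
    rw [normOne, Finset.sum_mul]
    refine (norm_sum_le _ _).trans (Finset.sum_le_sum fun i _ => ?_)
    rw [Real.norm_eq_abs, abs_mul]
    refine mul_le_mul_of_nonneg_left ((hrem i _ hmem).trans ?_) (abs_nonneg _)
    refine mul_le_mul_of_nonneg_left ?_ hB
    exact pow_le_pow_left₀ (normOne_nonneg _) (hρ τ hτ') n

theorem abs_taylorRemainder_le {n : ℕ} {B : ℝ} (hB : 0 ≤ B)
    {Q : Set (EuclideanSpace ℝ (Fin d))} (hQ : Convex ℝ Q)
    {g : EuclideanSpace ℝ (Fin d) → ℝ} (hg : ContDiff ℝ ∞ g) (h : DerivBound n B Q g)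
    {z x : EuclideanSpace ℝ (Fin d)} (hz : z ∈ Q) (hx : x ∈ Q) :
    |g x - taylorPoly n g z x| ≤ B * normOne (x - z) ^ n := by
  induction n generalizing g x with
  | zero => simpa [taylorPoly] using h.abs_le hx
  | succ n ih =>
    have := abs_taylorRemainder_sub_le (n := n) (ρ := normOne (x - z)) hB hQ hg hz hx
      (fun i u hu => ih (contDiff_partialDeriv hg i) (h.partialDeriv i) hu) ?_
    · rw [taylorPoly_self, sub_self, sub_zero] at this
      rw [pow_succ]
      linarith
    · intro τ hτ
      rw [add_sub_cancel_left, normOne_smul, abs_of_nonneg hτ.1]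
      exact mul_le_of_le_one_left (normOne_nonneg _) hτ.2

/-! ### Polynomials with bounded coefficients -/

/-- The coordinates of `x`, together with the constant `1`. -/
def coordOrOne (x : EuclideanSpace ℝ (Fin d)) : Option (Fin d) → ℝ
  | none => 1
  | some i => x i

/-- `p` is a polynomial of degree at most `k` with coefficients bounded by `A`, written as a
combination of `k`-fold products of the coordinates and `1`. -/
def IsBddPoly (k : ℕ) (A : ℝ) (p : EuclideanSpace ℝ (Fin d) → ℝ) : Prop :=
  ∃ c : (Fin k → Option (Fin d)) → ℝ, (∀ r, |c r| ≤ A) ∧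
    ∀ x, p x = ∑ r, c r * ∏ j, coordOrOne x (r j)

/-- Splits off the first letter of a monomial: `none` raises the formal degree without changing the
function, `some i` multiplies by x_i. -/
theorem sum_option_cons (k : ℕ) (x : EuclideanSpace ℝ (Fin d))
    (c : Option (Fin d) → (Fin k → Option (Fin d)) → ℝ) :
    ∑ r : Fin (k + 1) → Option (Fin d), c (r 0) (Fin.tail r) * ∏ j, coordOrOne x (r j)
      = ∑ r, c none r * ∏ j, coordOrOne x (r j)
        + ∑ i, x i * ∑ r, c (some i) r * ∏ j, coordOrOne x (r j) := by
  rw [← (Fin.consEquiv fun _ : Fin (k + 1) => Option (Fin d)).sum_comp, Fintype.sum_prod_type,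
    Fintype.sum_option]
  have hcons : ∀ (o : Option (Fin d)) (r : Fin k → Option (Fin d)),
      (Fin.consEquiv fun _ : Fin (k + 1) => Option (Fin d)) (o, r) = Fin.cons o r :=
    fun _ _ => rfl
  simp only [hcons, Fin.cons_zero, Fin.tail_cons, Fin.prod_univ_succ, Fin.cons_succ,
    Finset.mul_sum]
  congr 1
  · simp [coordOrOne]
  · simp [coordOrOne, mul_left_comm]

theorem IsBddPoly.mono {k : ℕ} {A A' : ℝ} {p : EuclideanSpace ℝ (Fin d) → ℝ}
    (h : IsBddPoly k A p) (hA : A ≤ A') : IsBddPoly k A' p := by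
  obtain ⟨c, hc, hp⟩ := h
  exact ⟨c, fun r => (hc r).trans hA, hp⟩

theorem IsBddPoly.succ {k : ℕ} {A : ℝ} (hA : 0 ≤ A) {p : EuclideanSpace ℝ (Fin d) → ℝ}
    (h : IsBddPoly k A p) : IsBddPoly (k + 1) A p := by
  obtain ⟨c, hc, hp⟩ := h
  let c' : Option (Fin d) → (Fin k → Option (Fin d)) → ℝ := fun
    | none => c
    | some _ => 0
  refine ⟨fun r => c' (r 0) (Fin.tail r), fun r => ?_, fun x => ?_⟩
  · change |c' (r 0) (Fin.tail r)| ≤ A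
    rcases r 0 with _ | i
    · exact hc _
    · simpa [c'] using hA
  · rw [sum_option_cons, hp]
    simp [c']

theorem IsBddPoly.add {k : ℕ} {A A' : ℝ} {p p' : EuclideanSpace ℝ (Fin d) → ℝ}
    (h : IsBddPoly k A p) (h' : IsBddPoly k A' p') :
    IsBddPoly k (A + A') (fun x => p x + p' x) := by
  obtain ⟨c, hc, hp⟩ := h
  obtain ⟨c', hc', hp'⟩ := h'
  refine ⟨c + c', fun r => (abs_add_le _ _).trans (add_le_add (hc r) (hc' r)), fun x => ?_⟩
  simp [hp, hp', add_mul, Finset.sum_add_distrib]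

theorem IsBddPoly.const_mul {k : ℕ} {A : ℝ} {p : EuclideanSpace ℝ (Fin d) → ℝ}
    (h : IsBddPoly k A p) (t : ℝ) : IsBddPoly k (|t| * A) (fun x => t * p x) := by
  obtain ⟨c, hc, hp⟩ := h
  refine ⟨fun r => t * c r, fun r => ?_, fun x => ?_⟩
  · rw [abs_mul]
    exact mul_le_mul_of_nonneg_left (hc r) (abs_nonneg _)
  · simp [hp, Finset.mul_sum, mul_assoc]

/-- The shifts -z_i are collected into the coefficients of the letter `none`; there are d of them,
each at most 1 in absolute value, hence d * A. -/
theorem IsBddPoly.sum_sub_mul {k : ℕ} {A : ℝ} (hA : 0 ≤ A) (hd : 1 ≤ d)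
    {z : EuclideanSpace ℝ (Fin d)} (hz : ∀ i, z i ∈ Icc (0 : ℝ) 1)
    {p : Fin d → EuclideanSpace ℝ (Fin d) → ℝ} (h : ∀ i, IsBddPoly k A (p i)) :
    IsBddPoly (k + 1) (d * A) (fun x => ∑ i, (x - z) i * p i x) := by
  choose c hc hp using h
  let c' : Option (Fin d) → (Fin k → Option (Fin d)) → ℝ := fun
    | none => fun r => -∑ i, z i * c i r
    | some i => c i
  refine ⟨fun r => c' (r 0) (Fin.tail r), fun r => ?_, fun x => ?_⟩
  · change |c' (r 0) (Fin.tail r)| ≤ d * A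
    rcases r 0 with _ | i
    · simp only [c', abs_neg]
      refine (Finset.abs_sum_le_sum_abs _ _).trans ?_
      refine (Finset.sum_le_card_nsmul _ _ A fun i _ => ?_).trans (by simp)
      rw [abs_mul, abs_of_nonneg (hz i).1]
      exact (mul_le_of_le_one_left (abs_nonneg _) (hz i).2).trans (hc i _)
    · have h1 : (1 : ℝ) ≤ d := by exact_mod_cast hd
      exact (hc i _).trans (le_mul_of_one_le_left hA h1)
  · rw [sum_option_cons]
    simp only [c', neg_mul, Finset.sum_mul, Finset.sum_neg_distrib, ← hp]
    rw [Finset.sum_comm]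
    simp only [mul_assoc, ← Finset.mul_sum, ← hp]
    simp only [PiLp.sub_apply, sub_mul, Finset.sum_sub_distrib]
    ring

theorem isBddPoly_taylorTerm (k : ℕ) {B : ℝ} (hB : 0 ≤ B) (hd : 1 ≤ d)
    {Q : Set (EuclideanSpace ℝ (Fin d))} {g : EuclideanSpace ℝ (Fin d) → ℝ}
    (h : DerivBound k B Q g) {z : EuclideanSpace ℝ (Fin d)} (hzQ : z ∈ Q)
    (hz : ∀ i, z i ∈ Icc (0 : ℝ) 1) :
    IsBddPoly k (d ^ k * B) (fun x => taylorTerm k g z (x - z)) := by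
  induction k generalizing g with
  | zero =>
    exact ⟨fun _ => g z, fun _ => by simpa using h.abs_le hzQ, fun x => by simp [taylorTerm]⟩
  | succ k ih =>
    have := IsBddPoly.sum_sub_mul (k := k) (A := d ^ k * B) (by positivity) hd hz
      fun i => ih (h.partialDeriv i)
    rw [pow_succ', mul_assoc]
    exact this

/-- The bound depends on g and z only through B. This uniformity later allows a convergent
subsequence of coefficients to be extracted. -/
theorem isBddPoly_taylorPoly (n : ℕ) {B : ℝ} (hB : 0 ≤ B) (hd : 1 ≤ d)
    {Q : Set (EuclideanSpace ℝ (Fin d))} {g : EuclideanSpace ℝ (Fin d) → ℝ}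
    (h : DerivBound n B Q g) {z : EuclideanSpace ℝ (Fin d)} (hzQ : z ∈ Q)
    (hz : ∀ i, z i ∈ Icc (0 : ℝ) 1) :
    IsBddPoly n (n * d ^ n * B) (taylorPoly n g z) := by
  have h1 : (1 : ℝ) ≤ d := by exact_mod_cast hd
  have key : ∀ k ≤ n, IsBddPoly k (k * d ^ k * B) (taylorPoly k g z) := by
    intro k hk
    induction k with
    | zero => exact ⟨0, by simp, fun x => by simp [taylorPoly]⟩
    | succ k ih =>
      have h2 := (ih (by omega)).succ (by positivity)
      have h3 := ((isBddPoly_taylorTerm k hB hd (fun w hw => h w (by omega)) hzQ hz).succ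
        (by positivity)).const_mul (1 / (k.factorial : ℝ))
      have h4 := h2.add h3
      have h5 : taylorPoly (k + 1) g z = fun x => taylorPoly k g z x
          + 1 / (k.factorial : ℝ) * taylorTerm k g z (x - z) := by
        funext x
        rw [taylorPoly, Finset.sum_range_succ, ← taylorPoly]
      rw [h5]
      refine h4.mono ?_
      have h6 : |1 / (k.factorial : ℝ)| ≤ 1 := by
        rw [abs_of_nonneg (by positivity)]
        exact div_le_one_of_le₀ (by exact_mod_cast Nat.factorial_pos k) (by positivity)
      have h7 : (d : ℝ) ^ k * B ≤ d ^ (k + 1) * B := by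
        exact mul_le_mul_of_nonneg_right (pow_le_pow_right₀ h1 (by omega)) hB
      have h8 : 0 ≤ (d : ℝ) ^ k * B := by positivity
      push_cast
      have h9 : |1 / (k.factorial : ℝ)| * (d ^ k * B) ≤ d ^ k * B := mul_le_of_le_one_left h8 h6
      have h10 : (k : ℝ) * (d ^ k * B) ≤ k * (d ^ (k + 1) * B) := by gcongr
      linarith
  exact key n le_rfl

end FBNN

namespace FBNN

/-! ### A partition of unity of hat functions -/

variable {d : ℕ}

/-- The hat function. -/
noncomputable def hat (t : ℝ) : ℝ := max 0 (1 - |t|)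

theorem hat_mem (t : ℝ) : hat t ∈ Icc (0 : ℝ) 1 :=
  ⟨le_max_left _ _, max_le zero_le_one (by linarith [abs_nonneg t])⟩

theorem abs_hat_sub_le (t u : ℝ) : |hat t - hat u| ≤ |t - u| := by
  refine (abs_max_zero_sub_le _ _).trans ?_
  rw [sub_sub_sub_cancel_left, abs_sub_comm t u]
  exact abs_abs_sub_abs_le_abs_sub _ _

theorem abs_lt_one_of_hat_ne_zero {t : ℝ} (h : hat t ≠ 0) : |t| < 1 := by
  by_contra hc
  exact h (max_eq_left (by linarith))

/-- The hat is a second difference of the ReLU, so sums over integer translates telescope. -/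
theorem hat_eq_sub (t : ℝ) :
    hat t = (max 0 (t + 1) - max 0 t) - (max 0 (t - 1 + 1) - max 0 (t - 1)) := by
  unfold hat
  rcases abs_cases t with ⟨h, h'⟩ | ⟨h, h'⟩ <;> rw [h] <;>
    rcases max_cases 0 (t + 1) with h1 | h1 <;> rcases max_cases 0 t with h2 | h2 <;>
    rcases max_cases 0 (t - 1 + 1) with h3 | h3 <;> rcases max_cases 0 (t - 1) with h4 | h4 <;>
    rcases max_cases 0 (1 - t) with h5 | h5 <;> rcases max_cases 0 (1 - -t) with h6 | h6 <;>
    linarith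

theorem sum_hat_eq_one {N : ℕ} {t : ℝ} (ht : t ∈ Icc (0 : ℝ) N) :
    ∑ m : Fin (N + 1), hat (t - m) = 1 := by
  have key : ∀ M : ℕ, ∑ m ∈ Finset.range M, hat (t - m)
      = (max 0 (t + 1) - max 0 t) - (max 0 (t - M + 1) - max 0 (t - M)) := by
    intro M
    induction M with
    | zero => simp
    | succ M ih =>
      rw [Finset.sum_range_succ, ih, hat_eq_sub]
      push_cast
      rw [sub_sub t M 1]
      ring
  rw [Fin.sum_univ_eq_sum_range fun m => hat (t - m), key, max_eq_right (by linarith [ht.1]),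
    max_eq_right ht.1, max_eq_left (by push_cast; linarith [ht.2]),
    max_eq_left (by push_cast; linarith [ht.2])]
  ring

theorem abs_prod_sub_prod_le {ι : Type*} (t : Finset ι) (a b : ι → ℝ)
    (ha : ∀ i, a i ∈ Icc (0 : ℝ) 1) (hb : ∀ i, b i ∈ Icc (0 : ℝ) 1) :
    |∏ i ∈ t, a i - ∏ i ∈ t, b i| ≤ ∑ i ∈ t, |a i - b i| := by
  classical
  induction t using Finset.induction_on with
  | empty => simp
  | insert j t hj ih =>
    rw [Finset.prod_insert hj, Finset.prod_insert hj, Finset.sum_insert hj,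
      show a j * ∏ i ∈ t, a i - b j * ∏ i ∈ t, b i
        = (a j - b j) * ∏ i ∈ t, a i + b j * (∏ i ∈ t, a i - ∏ i ∈ t, b i) by ring]
    have h0 : 0 ≤ ∏ i ∈ t, a i := Finset.prod_nonneg fun i _ => (ha i).1
    have h1 : ∏ i ∈ t, a i ≤ 1 := Finset.prod_le_one (fun i _ => (ha i).1) fun i _ => (ha i).2
    refine (abs_add_le _ _).trans (add_le_add ?_ ?_)
    · rw [abs_mul, abs_of_nonneg h0]
      exact mul_le_of_le_one_right (abs_nonneg _) h1
    · rw [abs_mul, abs_of_nonneg (hb j).1]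
      exact (mul_le_of_le_one_left (abs_nonneg _) (hb j).2).trans ih

/-- The tensor product hat function at the grid point `m / N`. -/
noncomputable def bump (N : ℕ) (m : Fin d → Fin (N + 1)) (x : EuclideanSpace ℝ (Fin d)) : ℝ :=
  ∏ i, hat (N * x i - m i)

theorem bump_nonneg (N : ℕ) (m : Fin d → Fin (N + 1)) (x : EuclideanSpace ℝ (Fin d)) :
    0 ≤ bump N m x :=
  Finset.prod_nonneg fun _ _ => (hat_mem _).1

theorem sum_bump {N : ℕ} {x : EuclideanSpace ℝ (Fin d)} (hx : ∀ i, x i ∈ Icc (0 : ℝ) 1) :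
    ∑ m, bump N m x = 1 := by
  have h := Finset.prod_univ_sum (fun _ : Fin d => (Finset.univ : Finset (Fin (N + 1))))
    (fun i m => hat (N * x i - m))
  rw [Fintype.piFinset_univ] at h
  unfold bump
  rw [← h]
  refine Finset.prod_eq_one fun i _ => sum_hat_eq_one ⟨?_, ?_⟩
  · have := (hx i).1
    positivity
  · exact mul_le_of_le_one_right (by positivity) (hx i).2

theorem abs_bump_sub_le (N : ℕ) (m : Fin d → Fin (N + 1)) (x y : EuclideanSpace ℝ (Fin d)) :
    |bump N m x - bump N m y| ≤ N * normOne (x - y) := by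
  refine (abs_prod_sub_prod_le _ _ _ (fun _ => hat_mem _) fun _ => hat_mem _).trans ?_
  rw [normOne, Finset.mul_sum]
  refine Finset.sum_le_sum fun i _ => (abs_hat_sub_le _ _).trans (le_of_eq ?_)
  rw [sub_sub_sub_cancel_right, ← mul_sub, abs_mul, Nat.abs_cast]
  rfl

theorem abs_lt_one_of_bump_ne_zero {N : ℕ} {m : Fin d → Fin (N + 1)}
    {x : EuclideanSpace ℝ (Fin d)} (h : bump N m x ≠ 0) (i : Fin d) : |N * x i - m i| < 1 :=
  abs_lt_one_of_hat_ne_zero (Finset.prod_ne_zero_iff.1 h i (Finset.mem_univ _))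

/-- Radius 2 instead of 1 makes the set cover the hats that are nonzero at t or at any point within
distance 1 of t. -/
theorem card_near_le (N : ℕ) (t : ℝ) :
    (Finset.univ.filter fun m : Fin (N + 1) => |t - m| < 2).card ≤ 5 := by
  have h : ((Finset.univ.filter fun m : Fin (N + 1) => |t - m| < 2).image
      fun m : Fin (N + 1) => ((m : ℕ) : ℤ)) ⊆ Finset.Icc (⌊t⌋ - 2) (⌊t⌋ + 2) := by
    intro z hz
    simp only [Finset.mem_image, Finset.mem_filter, Finset.mem_univ, true_and] at hz
    obtain ⟨m, hm, rfl⟩ := hz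
    rw [abs_lt] at hm
    have h1 := Int.floor_le t
    have h2 := Int.lt_floor_add_one t
    rw [Finset.mem_Icc]
    constructor
    · have : (⌊t⌋ : ℝ) < ((m : ℕ) : ℤ) + 2 := by push_cast; linarith
      have : ⌊t⌋ < ((m : ℕ) : ℤ) + 2 := by exact_mod_cast this
      omega
    · have : (((m : ℕ) : ℤ) : ℝ) < ⌊t⌋ + 3 := by push_cast; linarith
      have : ((m : ℕ) : ℤ) < ⌊t⌋ + 3 := by exact_mod_cast this
      omega
  have h2 := Finset.card_le_card h
  rw [Finset.card_image_of_injective _ (fun a b hab => by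
    apply Fin.ext; exact_mod_cast hab)] at h2
  refine h2.trans ?_
  simp only [Int.card_Icc]
  omega

theorem card_near_pi_le (N : ℕ) (x : EuclideanSpace ℝ (Fin d)) :
    (Finset.univ.filter fun m : Fin d → Fin (N + 1) => ∀ i, |N * x i - m i| < 2).card
      ≤ 5 ^ d := by
  have h : (Finset.univ.filter fun m : Fin d → Fin (N + 1) => ∀ i, |N * x i - m i| < 2)
      = Fintype.piFinset fun i => Finset.univ.filter fun k : Fin (N + 1) => |N * x i - k| < 2 := by
    ext m
    simp
  rw [h, Fintype.card_piFinset]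
  refine (Finset.prod_le_pow_card _ _ 5 fun i _ => card_near_le N _).trans ?_
  simp

/-! ### Localized Taylor approximation -/

/-- The closed cube `[η, 1 - η]^d`. -/
def innerCube (d : ℕ) (η : ℝ) : Set (EuclideanSpace ℝ (Fin d)) :=
  {x | ∀ i, x i ∈ Icc η (1 - η)}

theorem convex_innerCube (η : ℝ) : Convex ℝ (innerCube d η) := by
  intro x hx y hy a b ha hb hab i
  exact convex_Icc η (1 - η) (hx i) (hy i) ha hb hab

theorem mem_Icc_of_mem_innerCube {η : ℝ} (hη : 0 ≤ η) {x : EuclideanSpace ℝ (Fin d)}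
    (hx : x ∈ innerCube d η) (i : Fin d) : x i ∈ Icc (0 : ℝ) 1 :=
  ⟨hη.trans (hx i).1, (hx i).2.trans (by linarith)⟩

/-- The point of `[η, 1 - η]^d` closest to the grid point `m / N`. -/
noncomputable def node (N : ℕ) (η : ℝ) (m : Fin d → Fin (N + 1)) : EuclideanSpace ℝ (Fin d) :=
  WithLp.toLp 2 fun i => max η (min (1 - η) (m i / N))

theorem node_mem {N : ℕ} {η : ℝ} (hη : η ≤ 1 / 2) (m : Fin d → Fin (N + 1)) :
    node N η m ∈ innerCube d η :=
  fun _ => ⟨le_max_left _ _, max_le (by linarith) (min_le_left _ _)⟩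

theorem abs_sub_clamp_le {a b t u : ℝ} (ht : t ∈ Icc a b) :
    |t - max a (min b u)| ≤ |t - u| := by
  obtain ⟨h1, h2⟩ := ht
  have h3 : t = max a (min b t) := by rw [min_eq_right h2, max_eq_right h1]
  conv_lhs => rw [h3]
  refine (abs_max_sub_max_le_max _ _ _ _).trans ?_
  rw [sub_self, abs_zero, max_eq_right (abs_nonneg _)]
  refine (abs_min_sub_min_le_max _ _ _ _).trans ?_
  rw [sub_self, abs_zero, max_eq_right (abs_nonneg _)]

/-- Derivative bounds will be available only on the inner cube, so grid points are moved into it;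
clamping does not increase the distance to points already inside. -/
theorem normOne_sub_node_le {N : ℕ} (hN : 1 ≤ N) {η ρ : ℝ} {x : EuclideanSpace ℝ (Fin d)}
    (hx : x ∈ innerCube d η) {m : Fin d → Fin (N + 1)} (h : ∀ i, |N * x i - m i| ≤ ρ) :
    normOne (x - node N η m) ≤ d * ρ / N := by
  have hN' : (0 : ℝ) < N := by exact_mod_cast hN
  refine (Finset.sum_le_card_nsmul _ _ (ρ / N) fun i _ => ?_).trans (by simp [mul_div_assoc])
  refine (abs_sub_clamp_le (hx i)).trans ?_
  rw [le_div_iff₀ hN', ← abs_of_pos hN', ← abs_mul, abs_of_pos hN', sub_mul,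
    div_mul_cancel₀ _ hN'.ne', mul_comm]
  exact h i

/-- The localized monomials. -/
noncomputable def localMonomial {n : ℕ} (N : ℕ)
    (a : (Fin d → Fin (N + 1)) × (Fin n → Option (Fin d))) (x : EuclideanSpace ℝ (Fin d)) : ℝ :=
  bump N a.1 x * ∏ j, coordOrOne x (a.2 j)

/-- The error of the localized Taylor approximation. -/
noncomputable def localError (n N : ℕ) (η : ℝ) (g : EuclideanSpace ℝ (Fin d) → ℝ)
    (x : EuclideanSpace ℝ (Fin d)) : ℝ :=
  ∑ m : Fin d → Fin (N + 1), bump N m x * (g x - taylorPoly n g (node N η m) x)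

theorem abs_localError_le {n N : ℕ} (hN : 1 ≤ N) {η B : ℝ} (hη0 : 0 ≤ η) (hη : η ≤ 1 / 2)
    (hB : 0 ≤ B) {g : EuclideanSpace ℝ (Fin d) → ℝ} (hg : ContDiff ℝ ∞ g)
    (h : DerivBound n B (innerCube d η) g) {x : EuclideanSpace ℝ (Fin d)}
    (hx : x ∈ innerCube d η) :
    |localError n N η g x| ≤ B * (d / N) ^ n := by
  have hle : ∀ m : Fin d → Fin (N + 1), |bump N m x * (g x - taylorPoly n g (node N η m) x)|
      ≤ bump N m x * (B * (d / N) ^ n) := by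
    intro m
    rw [abs_mul, abs_of_nonneg (bump_nonneg _ _ _)]
    by_cases hm : bump N m x = 0
    · simp [hm]
    · refine mul_le_mul_of_nonneg_left ?_ (bump_nonneg _ _ _)
      refine (abs_taylorRemainder_le hB (convex_innerCube η) hg h (node_mem hη m) hx).trans ?_
      refine mul_le_mul_of_nonneg_left (pow_le_pow_left₀ (normOne_nonneg _) ?_ n) hB
      simpa using normOne_sub_node_le hN hx fun i => (abs_lt_one_of_bump_ne_zero hm i).le
  refine (Finset.abs_sum_le_sum_abs _ _).trans ((Finset.sum_le_sum fun m _ => hle m).trans ?_)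
  rw [← Finset.sum_mul, sum_bump (mem_Icc_of_mem_innerCube hη0 hx), one_mul]

/-- Discrete product rule. Differences of bumps cost a factor N, but multiply remainders of order
N^(-(n+1)) and are nonzero for at most 5^d nodes; differences of remainders are averaged by the
partition of unity. Since N‖x - y‖ ≤ 1, the nodes involved stay within grid distance 2 of the whole
segment. -/
theorem abs_localError_sub_le {n N : ℕ} (hN : 1 ≤ N) {η B : ℝ} (hη0 : 0 ≤ η) (hη : η ≤ 1 / 2)
    (hB : 0 ≤ B) {g : EuclideanSpace ℝ (Fin d) → ℝ} (hg : ContDiff ℝ ∞ g)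
    (h : DerivBound (n + 1) B (innerCube d η) g) {x y : EuclideanSpace ℝ (Fin d)}
    (hx : x ∈ innerCube d η) (hy : y ∈ innerCube d η) (hxy : N * ‖x - y‖ ≤ 1) :
    |localError (n + 1) N η g x - localError (n + 1) N η g y|
      ≤ (5 ^ d * (2 * d) + 1) * B * (2 * d / N) ^ n * normOne (x - y) := by
  set R : (Fin d → Fin (N + 1)) → EuclideanSpace ℝ (Fin d) → ℝ :=
    fun m x => g x - taylorPoly (n + 1) g (node N η m) x with hR
  have hN' : (0 : ℝ) < N := by exact_mod_cast hN
  have hNxy : ∀ i, |N * x i - N * y i| ≤ 1 := fun i => by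
    rw [← mul_sub, abs_mul, Nat.abs_cast]
    refine le_trans (mul_le_mul_of_nonneg_left ?_ hN'.le) hxy
    exact PiLp.norm_apply_le (x - y) i
  have hsplit : localError (n + 1) N η g x - localError (n + 1) N η g y
      = ∑ m, (bump N m x - bump N m y) * R m x + ∑ m, bump N m y * (R m x - R m y) := by
    rw [localError, localError, ← Finset.sum_sub_distrib, ← Finset.sum_add_distrib]
    refine Finset.sum_congr rfl fun m _ => ?_
    simp only [hR]
    ring
  have hn1 := normOne_nonneg (x - y)
  have h1 : |∑ m, (bump N m x - bump N m y) * R m x|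
      ≤ 5 ^ d * (N * normOne (x - y) * (B * (2 * d / N) ^ (n + 1))) := by
    set S := Finset.univ.filter fun m : Fin d → Fin (N + 1) => ∀ i, |N * x i - m i| < 2
    rw [← Finset.sum_subset (Finset.subset_univ S)]
    · refine (Finset.abs_sum_le_sum_abs _ _).trans ?_
      refine (Finset.sum_le_card_nsmul _ _ (N * normOne (x - y) * (B * (2 * d / N) ^ (n + 1)))
        fun m hm => ?_).trans ?_
      · rw [abs_mul]
        refine mul_le_mul (abs_bump_sub_le _ _ _ _) ?_ (abs_nonneg _) (by positivity)
        refine (abs_taylorRemainder_le hB (convex_innerCube η) hg h (node_mem hη m) hx).trans ?_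
        refine mul_le_mul_of_nonneg_left (pow_le_pow_left₀ (normOne_nonneg _) ?_ _) hB
        have hm' := (Finset.mem_filter.1 hm).2
        rw [mul_comm (2 : ℝ)]
        exact normOne_sub_node_le hN hx fun i => (hm' i).le
      · rw [nsmul_eq_mul]
        refine mul_le_mul_of_nonneg_right ?_ (by positivity)
        exact_mod_cast card_near_pi_le N x
    · intro m _ hm
      have hzero : bump N m x = 0 ∧ bump N m y = 0 := by
        refine ⟨?_, ?_⟩ <;> by_contra hc <;>
          refine hm (Finset.mem_filter.2 ⟨Finset.mem_univ _, fun i => ?_⟩)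
        · linarith [abs_lt_one_of_bump_ne_zero hc i]
        · have h3 := abs_lt_one_of_bump_ne_zero hc i
          have h4 := abs_add_le (N * x i - N * y i) (N * y i - m i)
          rw [sub_add_sub_cancel] at h4
          linarith [hNxy i]
      simp [hzero]
  have h2 : |∑ m, bump N m y * (R m x - R m y)|
      ≤ normOne (x - y) * (B * (2 * d / N) ^ n) := by
    have hle : ∀ m, |bump N m y * (R m x - R m y)|
        ≤ bump N m y * (normOne (x - y) * (B * (2 * d / N) ^ n)) := by
      intro m
      rw [abs_mul, abs_of_nonneg (bump_nonneg _ _ _)]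
      by_cases hm : bump N m y = 0
      · simp [hm]
      · refine mul_le_mul_of_nonneg_left ?_ (bump_nonneg _ _ _)
        refine abs_taylorRemainder_sub_le hB (convex_innerCube η) hg hy hx (fun i u hu =>
          abs_taylorRemainder_le hB (convex_innerCube η) (contDiff_partialDeriv hg i)
            (h.partialDeriv i) (node_mem hη m) hu) fun τ hτ => ?_
        have hmem : y + τ • (x - y) ∈ innerCube d η :=
          (convex_innerCube η).add_smul_sub_mem hy hx hτ
        rw [mul_comm (2 : ℝ)]
        refine normOne_sub_node_le hN hmem fun i => ?_
        have h3 := abs_lt_one_of_bump_ne_zero hm i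
        have h4 : N * (y + τ • (x - y)) i - m i
            = (N * y i - m i) + τ * (N * x i - N * y i) := by
          simp
          ring
        rw [h4]
        refine (abs_add_le _ _).trans ?_
        rw [abs_mul, abs_of_nonneg hτ.1]
        have := mul_le_one₀ hτ.2 (abs_nonneg _) (hNxy i)
        linarith
    refine (Finset.abs_sum_le_sum_abs _ _).trans ((Finset.sum_le_sum fun m _ => hle m).trans ?_)
    rw [← Finset.sum_mul, sum_bump (mem_Icc_of_mem_innerCube hη0 hy), one_mul]
  rw [hsplit]
  refine (abs_add_le _ _).trans ((add_le_add h1 h2).trans (le_of_eq ?_))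
  rw [pow_succ]
  field_simp

/-- Smooth functions with bounded derivatives are approximated by localized polynomials. -/
theorem exists_coeff {n N : ℕ} (hd : 1 ≤ d) {η B : ℝ} (hη0 : 0 ≤ η)
    (hη : η ≤ 1 / 2) (hB : 0 ≤ B) {g : EuclideanSpace ℝ (Fin d) → ℝ}
    (h : DerivBound n B (innerCube d η) g) :
    ∃ c : (Fin d → Fin (N + 1)) × (Fin n → Option (Fin d)) → ℝ,
      (∀ a, |c a| ≤ n * d ^ n * B) ∧ ∀ x ∈ innerCube d η,
        g x - ∑ a, c a * localMonomial N a x = localError n N η g x := by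
  have hpoly := fun m : Fin d → Fin (N + 1) => isBddPoly_taylorPoly n hB hd h (node_mem hη m)
    (mem_Icc_of_mem_innerCube hη0 (node_mem hη m))
  choose c hc hp using hpoly
  refine ⟨fun a => c a.1 a.2, fun a => hc _ _, fun x hx => ?_⟩
  rw [localError]
  simp only [mul_sub, Finset.sum_sub_distrib, ← Finset.sum_mul,
    sum_bump (mem_Icc_of_mem_innerCube hη0 hx), one_mul, hp, Fintype.sum_prod_type, localMonomial,
    Finset.mul_sum]
  congr 1
  refine Finset.sum_congr rfl fun m _ => Finset.sum_congr rfl fun r _ => ?_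
  ring

end FBNN

namespace FBNN

/-! ### Derivatives along words and multi-indices -/

variable {d : ℕ}

theorem contDiff_partialDeriv_iterate {ψ : EuclideanSpace ℝ (Fin d) → ℝ} (hψ : ContDiff ℝ ∞ ψ)
    (i : Fin d) (k : ℕ) : ContDiff ℝ ∞ ((partialDeriv i)^[k] ψ) := by
  induction k with
  | zero => exact hψ
  | succ k ih =>
    rw [Function.iterate_succ_apply']
    exact contDiff_partialDeriv ih i

theorem partialDeriv_iterate_comm {ψ : EuclideanSpace ℝ (Fin d) → ℝ} (hψ : ContDiff ℝ ∞ ψ)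
    (i j : Fin d) (k : ℕ) :
    (partialDeriv i)^[k] (partialDeriv j ψ) = partialDeriv j ((partialDeriv i)^[k] ψ) := by
  induction k with
  | zero => rfl
  | succ k ih =>
    rw [Function.iterate_succ_apply', ih,
      partialDeriv_comm (contDiff_partialDeriv_iterate hψ i k), Function.iterate_succ_apply']

theorem contDiff_foldr_partialDeriv {ψ : EuclideanSpace ℝ (Fin d) → ℝ} (hψ : ContDiff ℝ ∞ ψ)
    (α : Fin d → ℕ) (l : List (Fin d)) :
    ContDiff ℝ ∞ (l.foldr (fun i ψ => (partialDeriv i)^[α i] ψ) ψ) := by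
  induction l with
  | nil => exact hψ
  | cons j l ih => exact contDiff_partialDeriv_iterate ih j _

theorem foldr_partialDeriv_comm {ψ : EuclideanSpace ℝ (Fin d) → ℝ} (hψ : ContDiff ℝ ∞ ψ)
    (α : Fin d → ℕ) (i : Fin d) (l : List (Fin d)) :
    l.foldr (fun i ψ => (partialDeriv i)^[α i] ψ) (partialDeriv i ψ)
      = partialDeriv i (l.foldr (fun i ψ => (partialDeriv i)^[α i] ψ) ψ) := by
  induction l with
  | nil => rfl
  | cons j l ih =>
    simp only [List.foldr_cons]
    rw [ih, partialDeriv_iterate_comm (contDiff_foldr_partialDeriv hψ α l)]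

/-- In a list without repetitions i occurs at most once, and only there does the extra letter raise
an exponent; the additional derivative then commutes past the rest. -/
theorem foldr_partialDeriv_cons {ψ : EuclideanSpace ℝ (Fin d) → ℝ} (hψ : ContDiff ℝ ∞ ψ)
    (i : Fin d) (w : List (Fin d)) (l : List (Fin d)) (hl : l.Nodup) :
    (i ∉ l → l.foldr (fun j ψ => (partialDeriv j)^[(i :: w).count j] ψ) ψ
        = l.foldr (fun j ψ => (partialDeriv j)^[w.count j] ψ) ψ) ∧
    (i ∈ l → l.foldr (fun j ψ => (partialDeriv j)^[(i :: w).count j] ψ) ψ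
        = l.foldr (fun j ψ => (partialDeriv j)^[w.count j] ψ) (partialDeriv i ψ)) := by
  induction l with
  | nil => simp
  | cons j l ih =>
    obtain ⟨hj, hl⟩ := List.nodup_cons.1 hl
    obtain ⟨ih1, ih2⟩ := ih hl
    simp only [List.foldr_cons]
    refine ⟨fun h => ?_, fun h => ?_⟩
    · rw [List.mem_cons, not_or] at h
      rw [ih1 h.2, List.count_cons_of_ne h.1]
    · by_cases hij : i = j
      · subst hij
        rw [ih1 hj, List.count_cons_self, Function.iterate_succ_apply,
          foldr_partialDeriv_comm hψ]
      · rw [ih2 ((List.mem_cons.1 h).resolve_left hij), List.count_cons_of_ne hij]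

/-- Links the words used in the Taylor induction, which peels off one derivative at a time, to the
multi-indices of weak derivatives. -/
theorem wordDeriv_eq_multiDeriv (w : List (Fin d)) {ψ : EuclideanSpace ℝ (Fin d) → ℝ}
    (hψ : ContDiff ℝ ∞ ψ) : wordDeriv w ψ = multiDeriv (fun i => w.count i) ψ := by
  induction w generalizing ψ with
  | nil =>
    simp only [wordDeriv, multiDeriv, List.count_nil, Function.iterate_zero, id_eq]
    induction List.finRange d with
    | nil => rfl
    | cons j l ih => exact ih
  | cons i w ih =>
    rw [wordDeriv, ih (contDiff_partialDeriv hψ i), multiDeriv, multiDeriv,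
      (foldr_partialDeriv_cons hψ i w _ (List.nodup_finRange d)).2 (List.mem_finRange i)]

theorem sum_count_eq_length (w : List (Fin d)) : ∑ i, w.count i = w.length := by
  induction w with
  | nil => simp
  | cons i w ih => simp [List.count_cons, Finset.sum_add_distrib, ih]

theorem wordDeriv_neg (w : List (Fin d)) (ψ : EuclideanSpace ℝ (Fin d) → ℝ) :
    wordDeriv w (fun t => -ψ t) = fun t => -wordDeriv w ψ t := by
  induction w generalizing ψ with
  | nil => rfl
  | cons i w ih =>
    have : partialDeriv i (fun t => -ψ t) = fun t => -partialDeriv i ψ t := by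
      funext t
      simp [partialDeriv]
    rw [wordDeriv, this, ih, wordDeriv]

theorem wordDeriv_comp_sub (w : List (Fin d)) {ψ : EuclideanSpace ℝ (Fin d) → ℝ}
    (hψ : ContDiff ℝ ∞ ψ) (x t : EuclideanSpace ℝ (Fin d)) :
    wordDeriv w (fun t => ψ (x - t)) t = (-1) ^ w.length * wordDeriv w ψ (x - t) := by
  induction w generalizing ψ t with
  | nil => simp [wordDeriv]
  | cons i w ih =>
    have : partialDeriv i (fun t => ψ (x - t)) = fun t => -partialDeriv i ψ (x - t) := by
      funext t
      have h : HasFDerivAt (fun t => ψ (x - t)) _ t :=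
        (hψ.differentiable (by simp) (x - t)).hasFDerivAt.comp t ((hasFDerivAt_id t).const_sub x)
      simp [partialDeriv, h.fderiv]
    rw [wordDeriv, this, wordDeriv_neg]
    beta_reduce
    rw [ih (contDiff_partialDeriv hψ i), wordDeriv, List.length_cons, pow_succ]
    ring

theorem hasCompactSupport_partialDeriv {φ : EuclideanSpace ℝ (Fin d) → ℝ}
    (hφ : HasCompactSupport φ) (i : Fin d) : HasCompactSupport (partialDeriv i φ) :=
  hφ.fderiv_apply (𝕜 := ℝ) _

theorem wordDeriv_convolution (L : ℝ →L[ℝ] ℝ →L[ℝ] ℝ) {f : EuclideanSpace ℝ (Fin d) → ℝ}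
    (hf : LocallyIntegrable f) (w : List (Fin d)) {φ : EuclideanSpace ℝ (Fin d) → ℝ}
    (hφ : ContDiff ℝ ∞ φ) (hc : HasCompactSupport φ) :
    wordDeriv w (convolution f φ L volume) = convolution f (wordDeriv w φ) L volume := by
  induction w generalizing φ with
  | nil => rfl
  | cons i w ih =>
    have h1 : ContDiff ℝ 1 φ := hφ.of_le (by simp)
    have : partialDeriv i (convolution f φ L volume)
        = convolution f (partialDeriv i φ) L volume := by
      funext x
      have h := (hc.hasFDerivAt_convolution_right L hf h1 x).fderiv
      rw [partialDeriv, h]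
      exact convolution_precompR_apply L hf (hc.fderiv ℝ) (h1.continuous_fderiv one_ne_zero) x _
    rw [wordDeriv, this, ih (contDiff_partialDeriv hφ i) (hasCompactSupport_partialDeriv hc i),
      wordDeriv]

/-! ### Mollification of Sobolev functions -/

theorem isOpen_cube (d : ℕ) : IsOpen (cube d) := by
  have : cube d = ⋂ i : Fin d, (fun θ : EuclideanSpace ℝ (Fin d) => θ i) ⁻¹' Ioo 0 1 := by
    ext θ
    simp [cube]
  rw [this]
  exact isOpen_iInter_of_finite fun i => isOpen_Ioo.preimage (by fun_prop)

theorem measurableSet_cube (d : ℕ) : MeasurableSet (cube d) := (isOpen_cube d).measurableSet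

theorem volume_cube_lt_top (d : ℕ) : volume (cube d) < ⊤ := by
  have hK : IsCompact ((WithLp.toLp 2) '' (univ.pi fun _ : Fin d => Icc (0 : ℝ) 1)) :=
    (isCompact_univ_pi fun _ => isCompact_Icc).image (PiLp.continuous_toLp 2 _)
  refine lt_of_le_of_lt (measure_mono ?_) hK.measure_lt_top
  intro θ hθ
  exact ⟨fun i => θ i, fun i _ => ⟨(hθ i).1.le, (hθ i).2.le⟩, rfl⟩

instance (d : ℕ) : IsFiniteMeasure (cubeMeasure d) :=
  ⟨by rw [cubeMeasure, Measure.restrict_apply_univ]; exact volume_cube_lt_top d⟩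

theorem integrable_indicator_cube {f : EuclideanSpace ℝ (Fin d) → ℝ}
    (hf : MemLp f ∞ (cubeMeasure d)) : Integrable ((cube d).indicator f) :=
  (integrable_indicator_iff (measurableSet_cube d)).2 (hf.integrable le_top)

/-- The mollification of `f` (extended by zero). -/
noncomputable def mollify (φ : ContDiffBump (0 : EuclideanSpace ℝ (Fin d)))
    (f : EuclideanSpace ℝ (Fin d) → ℝ) : EuclideanSpace ℝ (Fin d) → ℝ :=
  convolution ((cube d).indicator f) (φ.normed volume) (ContinuousLinearMap.lsmul ℝ ℝ).flip volume

theorem contDiff_mollify (φ : ContDiffBump (0 : EuclideanSpace ℝ (Fin d)))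
    {f : EuclideanSpace ℝ (Fin d) → ℝ} (hf : MemLp f ∞ (cubeMeasure d)) :
    ContDiff ℝ ∞ (mollify φ f) :=
  φ.hasCompactSupport_normed.contDiff_convolution_right _
    (integrable_indicator_cube hf).locallyIntegrable φ.contDiff_normed

/-- The norm is an infimum over weak derivatives, so a strict margin B < B' yields one with the
bound, without appeal to uniqueness. -/
theorem exists_weakDeriv_bound {n : ℕ} {f : EuclideanSpace ℝ (Fin d) → ℝ} {B B' : ℝ}
    (hB : B < B') (hB' : 0 < B') (hnorm : sobolevNormTop n f ≤ ENNReal.ofReal B)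
    {α : Fin d → ℕ} (hα : ∑ i, α i ≤ n) :
    ∃ g, IsWeakDeriv α f g ∧ ∀ᵐ x ∂cubeMeasure d, |g x| ≤ B' := by
  have h1 : (⨅ (g : EuclideanSpace ℝ (Fin d) → ℝ) (_ : IsWeakDeriv α f g),
      eLpNorm g ∞ (cubeMeasure d)) < ENNReal.ofReal B' := by
    refine lt_of_le_of_lt (le_trans ?_ hnorm) ((ENNReal.ofReal_lt_ofReal_iff hB').2 hB)
    exact le_iSup₂_of_le α hα le_rfl
  simp only [iInf_lt_iff] at h1
  obtain ⟨g, hg, hlt⟩ := h1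
  refine ⟨g, hg, ?_⟩
  rw [eLpNorm_exponent_top] at hlt
  filter_upwards [ae_le_eLpNormEssSup (f := g) (μ := cubeMeasure d)] with x hx
  have h2 := hx.trans hlt.le
  rw [← ofReal_norm, ENNReal.ofReal_le_ofReal_iff hB'.le] at h2
  exact h2

/-- For x at distance at least η from the faces, t ↦ ρ(x - t) is a test function supported in the
cube. Derivatives of the mollification therefore move onto the weak derivative g, and averaging g
against a probability density preserves its bound. -/
theorem derivBound_mollify {n : ℕ} {f : EuclideanSpace ℝ (Fin d) → ℝ} {B B' η : ℝ}
    (hB : B < B') (hB' : 0 < B') (hf : MemLp f ∞ (cubeMeasure d))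
    (hnorm : sobolevNormTop n f ≤ ENNReal.ofReal B)
    (φ : ContDiffBump (0 : EuclideanSpace ℝ (Fin d))) (hφ : φ.rOut < η) :
    DerivBound n B' (innerCube d η) (mollify φ f) := by
  intro w hw x hx
  have hα : ∑ i, w.count i ≤ n := by rwa [sum_count_eq_length]
  obtain ⟨g, ⟨-, -, hg⟩, hgB⟩ := exists_weakDeriv_bound hB hB' hnorm hα
  set ρ : EuclideanSpace ℝ (Fin d) → ℝ := φ.normed volume with hρ
  have hρs : ContDiff ℝ ∞ ρ := φ.contDiff_normed
  have hψ : ContDiff ℝ ∞ fun t => ρ (x - t) := hρs.comp (contDiff_const.sub contDiff_id)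
  have hsupp : Function.support (fun t => ρ (x - t)) ⊆ Metric.closedBall x φ.rOut := by
    intro t ht
    have h1 : x - t ∈ Function.support (φ.normed volume) := ht
    rw [ContDiffBump.support_normed_eq, mem_ball_zero_iff] at h1
    rw [Metric.mem_closedBall, dist_comm, dist_eq_norm]
    exact h1.le
  have hball : Metric.closedBall x φ.rOut ⊆ cube d := by
    intro t ht i
    rw [Metric.mem_closedBall, dist_eq_norm] at ht
    have h1 : |t i - x i| ≤ φ.rOut := (PiLp.norm_apply_le (t - x) i).trans ht
    have h2 := abs_le.1 h1
    have h3 := hx i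
    exact ⟨by linarith [h3.1], by linarith [h3.2]⟩
  have hcs : HasCompactSupport fun t => ρ (x - t) :=
    HasCompactSupport.of_support_subset_isCompact (isCompact_closedBall _ _) hsupp
  have hts : tsupport (fun t => ρ (x - t)) ⊆ cube d :=
    (closure_minimal hsupp Metric.isClosed_closedBall).trans hball
  have hInt := hg _ hψ hcs hts
  rw [sum_count_eq_length, ← wordDeriv_eq_multiDeriv w hψ] at hInt
  have hval : wordDeriv w (mollify φ f) x = ∫ t in cube d, g t * ρ (x - t) := by
    rw [mollify, wordDeriv_convolution _ (integrable_indicator_cube hf).locallyIntegrable w hρs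
      φ.hasCompactSupport_normed, convolution_def]
    have h1 : ∀ t, ((ContinuousLinearMap.lsmul ℝ ℝ).flip ((cube d).indicator f t))
        (wordDeriv w ρ (x - t)) = (cube d).indicator (fun t => wordDeriv w ρ (x - t) * f t) t := by
      intro t
      by_cases ht : t ∈ cube d <;> simp [ht]
    simp only [h1]
    rw [integral_indicator (measurableSet_cube d)]
    -- The sign from reflecting t ↦ x - t cancels the sign from integration by parts.
    have h2 : ((-1 : ℝ) ^ w.length) * ((-1) ^ w.length) = 1 := by
      rw [← mul_pow]; norm_num
    calc ∫ t in cube d, wordDeriv w ρ (x - t) * f t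
        = ∫ t in cube d, (-1) ^ w.length * (f t * wordDeriv w (fun t => ρ (x - t)) t) := by
          congr 1
          funext t
          rw [wordDeriv_comp_sub w hρs]
          linear_combination (-(wordDeriv w ρ (x - t) * f t)) * h2
      _ = (-1) ^ w.length * ((-1) ^ w.length * ∫ t in cube d, g t * ρ (x - t)) := by
          rw [integral_const_mul, hInt]
      _ = ∫ t in cube d, g t * ρ (x - t) := by rw [← mul_assoc, h2, one_mul]
  rw [hval, ← Real.norm_eq_abs]
  have hρ0 : ∀ t, 0 ≤ ρ t := φ.nonneg_normed
  have hρi : Integrable fun t => ρ (x - t) :=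
    (hρs.continuous.integrable_of_hasCompactSupport φ.hasCompactSupport_normed).comp_sub_left x
  calc ‖∫ t in cube d, g t * ρ (x - t)‖ ≤ ∫ t in cube d, B' * ρ (x - t) := by
        refine norm_integral_le_of_norm_le (hρi.const_mul B').integrableOn ?_
        filter_upwards [hgB] with t ht
        rw [norm_mul, Real.norm_of_nonneg (hρ0 _)]
        exact mul_le_mul_of_nonneg_right ht (hρ0 _)
    _ ≤ ∫ t, B' * ρ (x - t) :=
        setIntegral_le_integral (hρi.const_mul B')
          (Filter.Eventually.of_forall fun t => mul_nonneg hB'.le (hρ0 _))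
    _ = B' := by
        rw [integral_const_mul, integral_sub_left_eq_self ρ volume x, hρ,
          φ.integral_normed, mul_one]

/-- A sequence of mollifiers with radii tending to zero. -/
noncomputable def mollifier (d k : ℕ) : ContDiffBump (0 : EuclideanSpace ℝ (Fin d)) where
  rIn := 1 / (2 * (k + 3))
  rOut := 1 / (k + 3)
  rIn_pos := by positivity
  rIn_lt_rOut := by
    apply one_div_lt_one_div_of_lt <;> nlinarith [(Nat.cast_nonneg k : (0 : ℝ) ≤ k)]

theorem exists_smooth_seq {n : ℕ} {f : EuclideanSpace ℝ (Fin d) → ℝ} {B B' : ℝ}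
    (hB : B < B') (hB' : 0 < B') (hf : MemLp f ∞ (cubeMeasure d))
    (hnorm : sobolevNormTop n f ≤ ENNReal.ofReal B) :
    ∃ g : ℕ → EuclideanSpace ℝ (Fin d) → ℝ, (∀ k, ContDiff ℝ ∞ (g k)) ∧
      (∀ k : ℕ, DerivBound n B' (innerCube d (1 / (k + 2))) (g k)) ∧
      ∀ᵐ x ∂cubeMeasure d, x ∈ cube d ∧
        Filter.Tendsto (fun k => g k x) Filter.atTop (nhds (f x)) := by
  refine ⟨fun k => mollify (mollifier d k) f, fun k => contDiff_mollify _ hf,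
    fun k => derivBound_mollify hB hB' hf hnorm _ ?_, ?_⟩
  · exact one_div_lt_one_div_of_lt (by positivity) (by linarith)
  · have h0 : Filter.Tendsto (fun k => (mollifier d k).rOut) Filter.atTop (nhds 0) := by
      have := (tendsto_one_div_add_atTop_nhds_zero_nat (𝕜 := ℝ)).comp
        (Filter.tendsto_add_atTop_nat 2)
      refine this.congr fun k => ?_
      simp only [Function.comp, mollifier]
      push_cast
      ring
    -- Almost everywhere convergence requires the ratio of outer to inner radius to stay bounded;
    -- here it is always 2.
    have h1 := ContDiffBump.ae_convolution_tendsto_right_of_locallyIntegrable (μ := volume)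
      (φ := mollifier d) (K := 2) h0 (Filter.Eventually.of_forall fun k => by
        simp only [mollifier]
        rw [one_div, one_div, mul_inv, ← mul_assoc]
        norm_num) (integrable_indicator_cube hf).locallyIntegrable
    have h2 : ∀ᵐ x ∂cubeMeasure d, x ∈ cube d := ae_restrict_mem (measurableSet_cube d)
    filter_upwards [ae_restrict_of_ae h1, h2] with x hx hxc
    refine ⟨hxc, ?_⟩
    rw [indicator_of_mem hxc] at hx
    refine hx.congr fun k => ?_
    rw [mollify, convolution_flip]

theorem eventually_mem_innerCube {x : EuclideanSpace ℝ (Fin d)} (hx : x ∈ cube d) :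
    ∀ᶠ k : ℕ in Filter.atTop, x ∈ innerCube d (1 / (k + 2)) := by
  have h0 : Filter.Tendsto (fun k : ℕ => 1 / ((k : ℝ) + 2)) Filter.atTop (nhds 0) := by
    have := (tendsto_one_div_add_atTop_nhds_zero_nat (𝕜 := ℝ)).comp
      (Filter.tendsto_add_atTop_nat 1)
    refine this.congr fun k => ?_
    simp only [Function.comp]
    push_cast
    ring
  have h1 : ∀ i, ∀ᶠ k : ℕ in Filter.atTop, x i ∈ Icc (1 / ((k : ℝ) + 2)) (1 - 1 / (k + 2)) := by
    intro i
    filter_upwards [h0.eventually_lt_const (hx i).1,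
      h0.eventually_lt_const (sub_pos.2 (hx i).2)] with k h2 h3
    exact ⟨h2.le, by linarith⟩
  exact Filter.eventually_all.2 h1

end FBNN

namespace FBNN

variable {d : ℕ}

/-! ### Almost everywhere estimates for Sobolev functions -/

theorem DerivBound.abs_sub_le {n : ℕ} {B : ℝ} (hB : 0 ≤ B) {Q : Set (EuclideanSpace ℝ (Fin d))}
    (hQ : Convex ℝ Q) {g : EuclideanSpace ℝ (Fin d) → ℝ} (hg : ContDiff ℝ ∞ g)
    (h : DerivBound (n + 1) B Q g) {x y : EuclideanSpace ℝ (Fin d)} (hx : x ∈ Q) (hy : y ∈ Q) :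
    |g x - g y| ≤ B * (d * ‖x - y‖) := by
  have h1 := abs_taylorRemainder_sub_le (n := 0) (z := y) (ρ := normOne (x - y)) hB hQ hg hy hx
    (fun i u hu => by simpa [taylorPoly] using (h.partialDeriv i).abs_le hu) fun τ hτ => by
      rw [add_sub_cancel_left, normOne_smul, abs_of_nonneg hτ.1]
      exact mul_le_of_le_one_left (normOne_nonneg _) hτ.2
  simp only [taylorPoly, zero_add, Finset.range_one, Finset.sum_singleton, taylorTerm,
    Nat.factorial_zero, Nat.cast_one, div_one, one_mul, pow_zero, mul_one, sub_self,
    sub_zero] at h1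
  refine h1.trans ?_
  rw [mul_comm]
  exact mul_le_mul_of_nonneg_left (normOne_le _) hB

/-- S is the set where the mollifications converge to f, so it is independent of N. For fixed N the
coefficients lie in a fixed ball of a finite-dimensional space; along a convergent subsequence all
estimates pass to the limit, as each point of the cube eventually lies in the inner cubes. -/
theorem exists_ae_local_approx {n : ℕ} (hd : 1 ≤ d) {f : EuclideanSpace ℝ (Fin d) → ℝ}
    {B B' : ℝ} (hB : B < B') (hB' : 0 < B') (hf : MemLp f ∞ (cubeMeasure d))
    (hnorm : sobolevNormTop (n + 1) f ≤ ENNReal.ofReal B) :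
    ∃ S : Set (EuclideanSpace ℝ (Fin d)), (∀ᵐ x ∂cubeMeasure d, x ∈ S) ∧ S ⊆ cube d ∧
      (∀ x ∈ S, |f x| ≤ B') ∧ (∀ x ∈ S, ∀ y ∈ S, |f x - f y| ≤ B' * (d * ‖x - y‖)) ∧
      ∀ N : ℕ, 1 ≤ N → ∃ c : (Fin d → Fin (N + 1)) × (Fin (n + 1) → Option (Fin d)) → ℝ,
        (∀ a, |c a| ≤ (n + 1 : ℕ) * d ^ (n + 1) * B') ∧
        (∀ x ∈ S, |f x - ∑ a, c a * localMonomial N a x| ≤ B' * (d / N) ^ (n + 1)) ∧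
        ∀ x ∈ S, ∀ y ∈ S, N * ‖x - y‖ ≤ 1 →
          |(f x - ∑ a, c a * localMonomial N a x) - (f y - ∑ a, c a * localMonomial N a y)|
            ≤ (5 ^ d * (2 * d) + 1) * B' * (2 * d / N) ^ n * normOne (x - y) := by
  obtain ⟨g, hg, hgB, hlim⟩ := exists_smooth_seq hB hB' hf hnorm
  have hη0 : ∀ k : ℕ, (0 : ℝ) ≤ 1 / (k + 2) := fun k => by positivity
  have hη : ∀ k : ℕ, 1 / ((k : ℝ) + 2) ≤ 1 / 2 := fun k =>
    one_div_le_one_div_of_le (by norm_num) (by linarith [(Nat.cast_nonneg k : (0 : ℝ) ≤ k)])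
  refine ⟨{x | x ∈ cube d ∧ Filter.Tendsto (fun k => g k x) Filter.atTop (nhds (f x))}, hlim,
    fun x hx => hx.1, ?_, ?_, fun N hN => ?_⟩
  · rintro x ⟨hx, hxl⟩
    refine le_of_tendsto hxl.abs ?_
    filter_upwards [eventually_mem_innerCube hx] with k hk
    exact (hgB k).abs_le hk
  · rintro x ⟨hx, hxl⟩ y ⟨hy, hyl⟩
    refine le_of_tendsto (hxl.sub hyl).abs ?_
    filter_upwards [eventually_mem_innerCube hx, eventually_mem_innerCube hy] with k hk hk'
    exact (hgB k).abs_sub_le hB'.le (convex_innerCube _) (hg k) hk hk'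
  · have hc := fun k => exists_coeff (N := N) hd (hη0 k) (hη k) hB'.le (hgB k)
    choose c hcA hc using hc
    have hA : (0 : ℝ) ≤ (n + 1 : ℕ) * d ^ (n + 1) * B' := by positivity
    obtain ⟨c', -, φ, hφ, hφl⟩ := tendsto_subseq_of_bounded
      (Metric.isBounded_closedBall (x := 0) (r := (n + 1 : ℕ) * d ^ (n + 1) * B')) (x := c)
      fun k => by
        rw [mem_closedBall_zero_iff, pi_norm_le_iff_of_nonneg hA]
        exact hcA k
    have hφl' : ∀ a, Filter.Tendsto (fun k => c (φ k) a) Filter.atTop (nhds (c' a)) :=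
      fun a => (tendsto_pi_nhds.1 hφl) a
    have hsum : ∀ x, Filter.Tendsto (fun k => g k x) Filter.atTop (nhds (f x)) →
        Filter.Tendsto (fun k => g (φ k) x - ∑ a, c (φ k) a * localMonomial N a x)
          Filter.atTop (nhds (f x - ∑ a, c' a * localMonomial N a x)) := fun x hx =>
      (hx.comp hφ.tendsto_atTop).sub
        (tendsto_finsetSum _ fun a _ => (hφl' a).mul_const _)
    have hev : ∀ x ∈ cube d, ∀ᶠ k in Filter.atTop, x ∈ innerCube d (1 / ((φ k : ℝ) + 2)) :=
      fun x hx => hφ.tendsto_atTop.eventually (eventually_mem_innerCube hx)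
    refine ⟨c', fun a => le_of_tendsto (hφl' a).abs (Filter.Eventually.of_forall fun k =>
      hcA _ _), ?_, ?_⟩
    · rintro x ⟨hx, hxl⟩
      refine le_of_tendsto (hsum x hxl).abs ?_
      filter_upwards [hev x hx] with k hk
      rw [hc _ x hk]
      exact abs_localError_le hN (hη0 _) (hη _) hB'.le (hg _) (hgB _) hk
    · rintro x ⟨hx, hxl⟩ y ⟨hy, hyl⟩ hxy
      refine le_of_tendsto ((hsum x hxl).sub (hsum y hyl)).abs ?_
      filter_upwards [hev x hx, hev y hy] with k hk hk'
      rw [hc _ x hk, hc _ y hk']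
      exact abs_localError_sub_le hN (hη0 _) (hη _) hB'.le (hg _) (hgB _) hk hk' hxy

/-! ### Bounded Hölder functions on a set -/

/-- `e` is bounded by `C` on `S`, and `s`-Hölder continuous there with constant `C`. -/
structure HolderOn (s C : ℝ) (S : Set (EuclideanSpace ℝ (Fin d)))
    (e : EuclideanSpace ℝ (Fin d) → ℝ) : Prop where
  bound : ∀ x ∈ S, |e x| ≤ C
  holder : ∀ x ∈ S, ∀ y ∈ S, |e x - e y| ≤ C * ‖x - y‖ ^ s

namespace HolderOn

variable {s C C' : ℝ} {S : Set (EuclideanSpace ℝ (Fin d))}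
  {e e' : EuclideanSpace ℝ (Fin d) → ℝ}

theorem mono (h : HolderOn s C S e) (hC : C ≤ C') : HolderOn s C' S e :=
  ⟨fun x hx => (h.bound x hx).trans hC, fun x hx y hy => (h.holder x hx y hy).trans
    (mul_le_mul_of_nonneg_right hC (by positivity))⟩

theorem mono_set {T : Set (EuclideanSpace ℝ (Fin d))} (h : HolderOn s C S e) (hT : T ⊆ S) :
    HolderOn s C T e :=
  ⟨fun x hx => h.bound x (hT hx), fun x hx y hy => h.holder x (hT hx) y (hT hy)⟩

theorem zero : HolderOn s 0 S (fun _ => 0) := ⟨by simp, by simp⟩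

theorem const (c : ℝ) : HolderOn s |c| S (fun _ => c) :=
  ⟨by simp, fun x _ y _ => by simp; positivity⟩

theorem add (h : HolderOn s C S e) (h' : HolderOn s C' S e') :
    HolderOn s (C + C') S (fun x => e x + e' x) := by
  refine ⟨fun x hx => (abs_add_le _ _).trans (add_le_add (h.bound x hx) (h'.bound x hx)),
    fun x hx y hy => ?_⟩
  rw [add_sub_add_comm, add_mul]
  exact (abs_add_le _ _).trans (add_le_add (h.holder x hx y hy) (h'.holder x hx y hy))

theorem const_mul (h : HolderOn s C S e) (t : ℝ) : HolderOn s (|t| * C) S (fun x => t * e x) := by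
  refine ⟨fun x hx => ?_, fun x hx y hy => ?_⟩
  · rw [abs_mul]
    exact mul_le_mul_of_nonneg_left (h.bound x hx) (abs_nonneg _)
  · rw [← mul_sub, abs_mul, mul_assoc]
    exact mul_le_mul_of_nonneg_left (h.holder x hx y hy) (abs_nonneg _)

theorem sub (h : HolderOn s C S e) (h' : HolderOn s C' S e') :
    HolderOn s (C + C') S (fun x => e x - e' x) := by
  have := h.add (h'.const_mul (-1))
  simpa [sub_eq_add_neg] using this

theorem sum {ι : Type*} (t : Finset ι) {C : ι → ℝ} {e : ι → EuclideanSpace ℝ (Fin d) → ℝ}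
    (h : ∀ i, HolderOn s (C i) S (e i)) :
    HolderOn s (∑ i ∈ t, C i) S (fun x => ∑ i ∈ t, e i x) := by
  classical
  induction t using Finset.induction_on with
  | empty => simpa using zero
  | insert j t hj ih =>
    simp only [Finset.sum_insert hj]
    exact (h j).add ih

theorem mul (hC : 0 ≤ C) (hC' : 0 ≤ C') (h : HolderOn s C S e) (h' : HolderOn s C' S e') :
    HolderOn s (2 * C * C') S (fun x => e x * e' x) := by
  refine ⟨fun x hx => ?_, fun x hx y hy => ?_⟩
  · rw [abs_mul]
    have := mul_le_mul (h.bound x hx) (h'.bound x hx) (abs_nonneg _) hC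
    nlinarith [mul_nonneg hC hC']
  · rw [show e x * e' x - e y * e' y = (e x - e y) * e' x + e y * (e' x - e' y) by ring]
    refine (abs_add_le _ _).trans ?_
    rw [abs_mul, abs_mul]
    have hp : 0 ≤ ‖x - y‖ ^ s := by positivity
    have h1 := mul_le_mul (h.holder x hx y hy) (h'.bound x hx) (abs_nonneg _) (by positivity)
    have h2 := mul_le_mul (h.bound y hy) (h'.holder x hx y hy) (abs_nonneg _) hC
    linarith

/-- Interpolation between a uniform bound and a Lipschitz bound. -/
theorem of_lipschitz (hs0 : 0 ≤ s) (hs1 : s < 1) {α β : ℝ} (hβ : 0 ≤ β)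
    (hα : ∀ x ∈ S, |e x| ≤ α) (hl : ∀ x ∈ S, ∀ y ∈ S, |e x - e y| ≤ β * ‖x - y‖)
    (h1 : α ≤ C) (h2 : (2 * α) ^ (1 - s) * β ^ s ≤ C) : HolderOn s C S e := by
  refine ⟨fun x hx => (hα x hx).trans h1, fun x hx y hy => ?_⟩
  have ht : |e x - e y| ≤ 2 * α := by
    refine (_root_.abs_sub _ _).trans ?_
    linarith [hα x hx, hα y hy]
  have ht' := hl x hx y hy
  have h0 := abs_nonneg (e x - e y)
  calc |e x - e y| = |e x - e y| ^ (1 - s) * |e x - e y| ^ s := by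
        rw [← Real.rpow_add' h0 (by norm_num), sub_add_cancel, Real.rpow_one]
    _ ≤ (2 * α) ^ (1 - s) * (β * ‖x - y‖) ^ s := by
        refine mul_le_mul (Real.rpow_le_rpow h0 ht (by linarith))
          (Real.rpow_le_rpow h0 ht' hs0) (by positivity) ?_
        exact Real.rpow_nonneg (h0.trans ht) _
    _ = (2 * α) ^ (1 - s) * β ^ s * ‖x - y‖ ^ s := by
        rw [Real.mul_rpow hβ (norm_nonneg _), mul_assoc]
    _ ≤ C * ‖x - y‖ ^ s := mul_le_mul_of_nonneg_right h2 (by positivity)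

end HolderOn

theorem rpow_one_sub_mul_rpow {a s : ℝ} (ha : 0 ≤ a) : a ^ (1 - s) * a ^ s = a := by
  rw [← Real.rpow_add' ha (by norm_num), sub_add_cancel, Real.rpow_one]

/-! ### The network basis functions -/

/-- The coordinate, slope and offset of the hat functions whose product is a localized monomial. -/
noncomputable def factorData {n : ℕ} (hd : 1 ≤ d) (N : ℕ)
    (a : (Fin d → Fin (N + 1)) × (Fin n → Option (Fin d))) : Fin (d + n) → Fin d × ℝ × ℝ :=
  Fin.append (fun i => (i, (N : ℝ), (a.1 i : ℝ))) fun j => match a.2 j with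
    | none => (⟨0, hd⟩, 0, 0)
    | some i => (i, 1, 1)

/-- The factors of a localized monomial. -/
noncomputable def factor {n : ℕ} (hd : 1 ≤ d) (N : ℕ)
    (a : (Fin d → Fin (N + 1)) × (Fin n → Option (Fin d))) (x : EuclideanSpace ℝ (Fin d))
    (l : Fin (d + n)) : ℝ :=
  hat ((factorData hd N a l).2.1 * x (factorData hd N a l).1 - (factorData hd N a l).2.2)

/-- The function computed by the network in place of a localized monomial. -/
noncomputable def netMonomial {n : ℕ} (hd : 1 ≤ d) (k N : ℕ)
    (a : (Fin d → Fin (N + 1)) × (Fin n → Option (Fin d))) (x : EuclideanSpace ℝ (Fin d)) : ℝ :=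
  prodApprox k (factor hd N a x) (List.finRange (d + n)) 1

/-- On the cube x_i = hat (x_i - 1), and 1 = hat 0, so polynomial factors are hats too and all d + n
factors lie in [0,1]. -/
theorem prod_factor {n : ℕ} (hd : 1 ≤ d) (N : ℕ)
    (a : (Fin d → Fin (N + 1)) × (Fin n → Option (Fin d))) {x : EuclideanSpace ℝ (Fin d)}
    (hx : x ∈ cube d) : ∏ l, factor hd N a x l = localMonomial N a x := by
  rw [Fin.prod_univ_add, localMonomial, bump]
  congr 1
  · refine Finset.prod_congr rfl fun i _ => ?_
    simp [factor, factorData]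
  · refine Finset.prod_congr rfl fun j _ => ?_
    simp only [factor, factorData, Fin.append_right]
    rcases a.2 j with _ | i
    · simp [hat, coordOrOne]
    · have := hx i
      simp only [hat, coordOrOne, one_mul]
      rw [abs_of_nonpos (by linarith [this.2]), max_eq_right (by linarith [this.1])]
      ring

theorem abs_netMonomial_sub_le {n : ℕ} (hd : 1 ≤ d) (k N : ℕ)
    (a : (Fin d → Fin (N + 1)) × (Fin n → Option (Fin d))) {x : EuclideanSpace ℝ (Fin d)}
    (hx : x ∈ cube d) :
    |localMonomial N a x - netMonomial hd k N a x| ≤ ((d + n : ℕ) : ℝ) * (1 / 4 ^ k) := by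
  have h := abs_prodApprox_sub_le k (factor hd N a x) (fun l => hat_mem _)
    (List.finRange (d + n)) (p := 1) (q := 1) ⟨zero_le_one, le_rfl⟩
  rw [← List.ofFn_eq_map, List.prod_ofFn, prod_factor hd N a hx] at h
  rw [abs_sub_comm]
  simpa [netMonomial] using h

theorem abs_factor_sub_le {n : ℕ} (hd : 1 ≤ d) {N : ℕ} (hN : 1 ≤ N)
    (a : (Fin d → Fin (N + 1)) × (Fin n → Option (Fin d))) (x y : EuclideanSpace ℝ (Fin d))
    (l : Fin (d + n)) : |factor hd N a x l - factor hd N a y l| ≤ N * ‖x - y‖ := by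
  have hN' : (1 : ℝ) ≤ N := by exact_mod_cast hN
  refine (abs_hat_sub_le _ _).trans ?_
  rw [sub_sub_sub_cancel_right, ← mul_sub, abs_mul]
  refine mul_le_mul ?_ (PiLp.norm_apply_le (x - y) _) (abs_nonneg _) (by positivity)
  refine Fin.addCases (fun i => ?_) (fun j => ?_) l
  · simp [factorData]
  · simp only [factorData, Fin.append_right]
    rcases a.2 j with _ | i
    · simp
    · simpa using hN

/-- No cancellation is used: both functions are Lipschitz with constant of order N, uniformly in k,
which suffices for the interpolation. -/
theorem abs_monomial_error_sub_le {n : ℕ} (hd : 1 ≤ d) (k : ℕ) {N : ℕ} (hN : 1 ≤ N)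
    (a : (Fin d → Fin (N + 1)) × (Fin n → Option (Fin d))) {x y : EuclideanSpace ℝ (Fin d)}
    (hx : x ∈ cube d) (hy : y ∈ cube d) :
    |(localMonomial N a x - netMonomial hd k N a x)
      - (localMonomial N a y - netMonomial hd k N a y)|
      ≤ ((d + n : ℕ) + 4 ^ (d + n)) * (N * ‖x - y‖) := by
  have h1 : |localMonomial N a x - localMonomial N a y| ≤ (d + n : ℕ) * (N * ‖x - y‖) := by
    rw [← prod_factor hd N a hx, ← prod_factor hd N a hy]
    refine (abs_prod_sub_prod_le _ _ _ (fun l => hat_mem _) fun l => hat_mem _).trans ?_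
    refine (Finset.sum_le_card_nsmul _ _ _ fun l _ => abs_factor_sub_le hd hN a x y l).trans ?_
    simp
  have h2 := abs_prodApprox_sub_prodApprox_le k (factor hd N a x) (factor hd N a y)
    (by positivity) (abs_factor_sub_le hd hN a x y) (List.finRange (d + n)) 1 1
  rw [List.length_finRange, sub_self, abs_zero, zero_add] at h2
  rw [sub_sub_sub_comm]
  refine (abs_sub _ _).trans ?_
  rw [add_mul]
  exact add_le_add h1 h2

end FBNN

namespace FBNN

variable {d : ℕ}

/-! ### Approximation of Sobolev functions by networks -/

/-- Beyond distance 1/N the sup bound already implies the Lipschitz bound, so the latter holds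
globally with constant of order N^(-n). Interpolation with the sup bound N^(-(n+1)) gives
N^(s-(n+1)). -/
theorem holderOn_of_local_approx {n N : ℕ} (hN : 1 ≤ N) {s B : ℝ} (hs0 : 0 ≤ s) (hs1 : s < 1)
    (hB : 0 ≤ B) {S : Set (EuclideanSpace ℝ (Fin d))} {e : EuclideanSpace ℝ (Fin d) → ℝ}
    (h1 : ∀ x ∈ S, |e x| ≤ B * (d / N) ^ (n + 1))
    (h2 : ∀ x ∈ S, ∀ y ∈ S, N * ‖x - y‖ ≤ 1 → |e x - e y|
      ≤ (5 ^ d * (2 * d) + 1) * B * (2 * d / N) ^ n * normOne (x - y)) :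
    HolderOn s (((5 ^ d * (2 * d) + 1) * (2 * d) ^ n * d + 2 * d ^ (n + 1)) * B
      * (N ^ s / N ^ (n + 1))) S e := by
  have hN' : (1 : ℝ) ≤ N := by exact_mod_cast hN
  have hN0 : (0 : ℝ) < N := by linarith
  set K : ℝ := (5 ^ d * (2 * d) + 1) * (2 * d) ^ n * d + 2 * d ^ (n + 1) with hK
  have hK0 : 0 ≤ K := by positivity
  have hKd : 2 * (d : ℝ) ^ (n + 1) ≤ K := le_add_of_nonneg_left (by positivity)
  have hα : 2 * (B * ((d : ℝ) / N) ^ (n + 1)) ≤ K * B / N ^ (n + 1) := by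
    rw [div_pow, ← mul_div_assoc, ← mul_div_assoc]
    refine div_le_div_of_nonneg_right ?_ (by positivity)
    nlinarith
  have hα0 : 0 ≤ B * ((d : ℝ) / N) ^ (n + 1) := by positivity
  have hNs : (1 : ℝ) ≤ (N : ℝ) ^ s := Real.one_le_rpow hN' hs0
  have hbase : K * B / N ^ (n + 1) ≤ K * B * (N ^ s / N ^ (n + 1)) := by
    rw [← mul_div_assoc]
    exact div_le_div_of_nonneg_right (le_mul_of_one_le_right (by positivity) hNs) (by positivity)
  refine HolderOn.of_lipschitz hs0 hs1 (β := K * B / N ^ (n + 1) * N) (by positivity) h1 ?_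
    (by linarith) ?_
  · intro x hx y hy
    rcases le_total (N * ‖x - y‖) 1 with hxy | hxy
    · refine (h2 x hx y hy hxy).trans ?_
      have h3 : (5 ^ d * (2 * d) + 1) * B * (2 * (d : ℝ) / N) ^ n * normOne (x - y)
          ≤ (5 ^ d * (2 * d) + 1) * B * (2 * (d : ℝ) / N) ^ n * (d * ‖x - y‖) :=
        mul_le_mul_of_nonneg_left (normOne_le _) (by positivity)
      refine h3.trans ?_
      have h4 : K * B / N ^ (n + 1) * N = K * B / N ^ n := by
        rw [pow_succ]
        field_simp
      rw [h4, div_pow]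
      have h5 : (5 ^ d * (2 * (d : ℝ)) + 1) * B * ((2 * d) ^ n / N ^ n) * (d * ‖x - y‖)
          = ((5 ^ d * (2 * d) + 1) * (2 * d) ^ n * d) * B / N ^ n * ‖x - y‖ := by ring
      rw [h5]
      gcongr
      exact le_add_of_nonneg_right (by positivity)
    · have h3 : |e x - e y| ≤ 2 * (B * ((d : ℝ) / N) ^ (n + 1)) := by
        refine (abs_sub _ _).trans ?_
        linarith [h1 x hx, h1 y hy]
      refine (h3.trans hα).trans ?_
      rw [mul_assoc]
      exact le_mul_of_one_le_right (by positivity) hxy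
  · calc (2 * (B * ((d : ℝ) / N) ^ (n + 1))) ^ (1 - s) * (K * B / N ^ (n + 1) * N) ^ s
        ≤ (K * B / N ^ (n + 1)) ^ (1 - s) * (K * B / N ^ (n + 1) * N) ^ s := by
          refine mul_le_mul_of_nonneg_right ?_ (by positivity)
          exact Real.rpow_le_rpow (by positivity) hα (by linarith)
      _ = K * B * (N ^ s / N ^ (n + 1)) := by
          rw [Real.mul_rpow (by positivity) hN0.le, ← mul_assoc,
            rpow_one_sub_mul_rpow (by positivity)]
          ring

/-- Interpolation yields N^(-q(1-s)) N^s ≤ N^(-(n+d+1)) N. The surplus N^(-d) pays for summing over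
the (N+1)^d grid points. -/
theorem holderOn_monomial_error {n k N q : ℕ} (hd : 1 ≤ d) (hN : 1 ≤ N) {s : ℝ} (hs0 : 0 ≤ s)
    (hs1 : s < 1) (hq : (n + d + 1 : ℕ) ≤ q * (1 - s)) (hk : N ^ q ≤ 4 ^ k)
    (a : (Fin d → Fin (N + 1)) × (Fin n → Option (Fin d))) :
    HolderOn s ((2 * (d + n : ℕ) + 4 ^ (d + n)) / N ^ (n + d)) (cube d)
      (fun x => localMonomial N a x - netMonomial hd k N a x) := by
  have hN' : (1 : ℝ) ≤ N := by exact_mod_cast hN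
  have hN0 : (0 : ℝ) < N := by linarith
  set H : ℝ := 2 * (d + n : ℕ) + 4 ^ (d + n) with hH
  have hH0 : 0 ≤ H := by positivity
  have hk' : (N : ℝ) ^ q ≤ 4 ^ k := by exact_mod_cast hk
  have h4 : (1 : ℝ) / 4 ^ k ≤ 1 / N ^ q := one_div_le_one_div_of_le (by positivity) hk'
  have hqn : n + d + 1 ≤ q := by
    have : ((n + d + 1 : ℕ) : ℝ) ≤ q := hq.trans (mul_le_of_le_one_right (by positivity)
      (by linarith))
    exact_mod_cast this
  refine HolderOn.of_lipschitz hs0 hs1 (α := (d + n : ℕ) * (1 / 4 ^ k))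
    (β := ((d + n : ℕ) + 4 ^ (d + n)) * N) (by positivity)
    (fun x hx => abs_netMonomial_sub_le hd k N a hx) (fun x hx y hy => ?_) ?_ ?_
  · rw [mul_assoc]
    exact abs_monomial_error_sub_le hd k hN a hx hy
  · rw [div_eq_mul_one_div H]
    refine mul_le_mul ?_ (h4.trans ?_) (by positivity) hH0
    · have : (0 : ℝ) ≤ 4 ^ (d + n) := by positivity
      have : (0 : ℝ) ≤ (d + n : ℕ) := by positivity
      linarith
    · exact one_div_le_one_div_of_le (by positivity) (pow_le_pow_right₀ hN' (by omega))
  · calc (2 * (((d + n : ℕ) : ℝ) * (1 / 4 ^ k))) ^ (1 - s) * (((d + n : ℕ) + 4 ^ (d + n)) * N) ^ s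
        ≤ (H * (1 / N ^ q)) ^ (1 - s) * (H * N) ^ s := by
          refine mul_le_mul (Real.rpow_le_rpow (by positivity) ?_ (by linarith))
            (Real.rpow_le_rpow (by positivity) ?_ hs0) (by positivity) (by positivity)
          · rw [← mul_assoc]
            refine mul_le_mul ?_ h4 (by positivity) hH0
            exact le_add_of_nonneg_right (by positivity)
          · refine mul_le_mul_of_nonneg_right ?_ hN0.le
            have : (0 : ℝ) ≤ (d + n : ℕ) := by positivity
            linarith
      _ = H * ((1 / N ^ q) ^ (1 - s) * N ^ s) := by
          rw [Real.mul_rpow hH0 (by positivity), Real.mul_rpow hH0 hN0.le, mul_mul_mul_comm,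
            rpow_one_sub_mul_rpow hH0]
      _ ≤ H * (1 / N ^ (n + d + 1) * N) := by
          refine mul_le_mul_of_nonneg_left ?_ hH0
          refine mul_le_mul ?_ ?_ (by positivity) (by positivity)
          · rw [Real.div_rpow zero_le_one (by positivity), Real.one_rpow]
            refine one_div_le_one_div_of_le (by positivity) ?_
            rw [← Real.rpow_natCast, ← Real.rpow_natCast, ← Real.rpow_mul hN0.le]
            exact Real.rpow_le_rpow_of_exponent_le hN' hq
          · conv_rhs => rw [← Real.rpow_one (N : ℝ)]
            exact Real.rpow_le_rpow_of_exponent_le hN' hs1.le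
      _ = H / N ^ (n + d) := by
          rw [pow_succ]
          field_simp

/-- The number of localized monomials. -/
theorem card_monomials (d n N : ℕ) :
    Fintype.card ((Fin d → Fin (N + 1)) × (Fin n → Option (Fin d)))
      = (N + 1) ^ d * (d + 1) ^ n := by
  simp

theorem realizable_netMonomials {n D : ℕ} (hd : 1 ≤ d) (k N : ℕ)
    (c : Fin D → (Fin d → Fin (N + 1)) × (Fin n → Option (Fin d)) → ℝ) :
    ∃ net : ReLUNet D d, (∀ x j, net.toMap x j = ∑ a, c j a * netMonomial hd k N a x) ∧
      net.depth = (d + n) * (2 * k + 3) + 3 ∧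
      net.numWeights + net.numUnits ≤
        (D * (((N + 1) ^ d * (d + 1) ^ n) * Fintype.card (Reg (d + n))) + D)
        + ((d + n) * (2 * k + 3) + 1) * (((N + 1) ^ d * (d + 1) ^ n) *
            Fintype.card (Reg (d + n)) * (Fintype.card (Reg (d + n)) + 2))
        + ((N + 1) ^ d * (d + 1) ^ n) * Fintype.card (Reg (d + n)) * (d + 2) := by
  obtain ⟨net, h1, h2, h3⟩ := realizable_sum_prodApprox k
    (fun a l => (factorData hd N a l).1) (fun a l => (factorData hd N a l).2.1)
    (fun a l => (factorData hd N a l).2.2) c d (Equiv.refl _)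
  rw [card_monomials] at h3
  refine ⟨net, fun x j => ?_, h2, h3⟩
  have := congrFun (h1 fun i => x i) j
  exact this

/-- Sobolev functions are approximated by networks in the Hölder norm. -/
theorem exists_net_holderOn (hd : 1 ≤ d) (n : ℕ) {s : ℝ} (hs0 : 0 ≤ s) (hs1 : s < 1) :
    ∃ A : ℝ, 0 < A ∧ ∀ (D : ℕ) (B : ℝ) (G : EuclideanSpace ℝ (Fin d) → Fin D → ℝ),
      (∀ j, MemLp (fun θ => G θ j) ⊤ (cubeMeasure d)) →
      (∀ j, sobolevNormTop (n + 1) (fun θ => G θ j) ≤ ENNReal.ofReal B) →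
      ∃ S : Set (EuclideanSpace ℝ (Fin d)), (∀ᵐ x ∂cubeMeasure d, x ∈ S) ∧
        (∀ j, HolderOn s (2 * d * (|B| + 1)) S (fun θ => G θ j)) ∧
        ∀ N k q : ℕ, 1 ≤ N → (n + 1 + d + 1 : ℕ) ≤ q * (1 - s) → N ^ q ≤ 4 ^ k →
          ∃ net : ReLUNet D d,
            (∀ j, HolderOn s (A * (|B| + 1) * (N ^ s / N ^ (n + 1))) S
              (fun θ => G θ j - net.toMap θ j)) ∧
            net.depth = (d + (n + 1)) * (2 * k + 3) + 3 ∧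
            net.numWeights + net.numUnits ≤
              (D * (((N + 1) ^ d * (d + 1) ^ (n + 1)) * Fintype.card (Reg (d + (n + 1)))) + D)
              + ((d + (n + 1)) * (2 * k + 3) + 1) * (((N + 1) ^ d * (d + 1) ^ (n + 1)) *
                  Fintype.card (Reg (d + (n + 1))) * (Fintype.card (Reg (d + (n + 1))) + 2))
              + ((N + 1) ^ d * (d + 1) ^ (n + 1)) * Fintype.card (Reg (d + (n + 1))) * (d + 2) := by
  set K : ℝ := (5 ^ d * (2 * d) + 1) * (2 * d) ^ n * d + 2 * d ^ (n + 1)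
  set H : ℝ := 2 * (d + (n + 1) : ℕ) + 4 ^ (d + (n + 1))
  set A' : ℝ := (n + 1 : ℕ) * d ^ (n + 1)
  have hd0 : (1 : ℝ) ≤ d := by exact_mod_cast hd
  -- K comes from the localized Taylor error; the rest is the number of monomials (up to N^d) times
  -- the coefficient bound A' times the error constant H of one monomial.
  refine ⟨K + (2 ^ d * (d + 1) ^ (n + 1)) * (A' * H), by positivity, ?_⟩
  intro D B G hG hnorm
  have hB : B < |B| + 1 := (le_abs_self B).trans_lt (lt_add_one _)
  have hB0 : 0 < |B| + 1 := by positivity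
  choose S hSae hScube hSb hSl hSN using fun j =>
    exists_ae_local_approx (n := n) hd hB hB0 (hG j) (hnorm j)
  refine ⟨{x | x ∈ cube d ∧ ∀ j, x ∈ S j}, ?_, fun j => ?_, fun N k q hN hq hk => ?_⟩
  · have h2 : ∀ᵐ x ∂cubeMeasure d, x ∈ cube d := ae_restrict_mem (measurableSet_cube d)
    filter_upwards [h2, ae_all_iff.2 hSae] with x h3 h4
    exact ⟨h3, h4⟩
  · refine HolderOn.of_lipschitz hs0 hs1 (α := |B| + 1) (β := (|B| + 1) * d) (by positivity)
      (fun x hx => hSb j x (hx.2 j)) (fun x hx y hy => ?_) (by nlinarith) ?_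
    · rw [mul_assoc]
      exact hSl j x (hx.2 j) y (hy.2 j)
    · calc (2 * (|B| + 1)) ^ (1 - s) * ((|B| + 1) * d) ^ s
          ≤ (2 * d * (|B| + 1)) ^ (1 - s) * (2 * d * (|B| + 1)) ^ s := by
            refine mul_le_mul (Real.rpow_le_rpow (by positivity) (by nlinarith) (by linarith))
              (Real.rpow_le_rpow (by positivity) (by nlinarith) hs0) (by positivity)
              (by positivity)
        _ = 2 * d * (|B| + 1) := rpow_one_sub_mul_rpow (by positivity)
  · choose c hcA hcb hcl using fun j => hSN j N hN
    obtain ⟨net, hmap, hdepth, hsize⟩ := realizable_netMonomials hd k N c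
    refine ⟨net, fun j => ?_, hdepth, hsize⟩
    have hN' : (1 : ℝ) ≤ N := by exact_mod_cast hN
    have hN0 : (0 : ℝ) < N := by linarith
    have h1 := (holderOn_of_local_approx hN hs0 hs1 hB0.le (hcb j) (hcl j)).mono_set
      (T := {x | x ∈ cube d ∧ ∀ j, x ∈ S j}) fun x hx => hx.2 j
    have h2 := (HolderOn.sum Finset.univ fun a =>
      (holderOn_monomial_error hd hN hs0 hs1 hq hk a).const_mul (c j a)).mono_set
      (T := {x | x ∈ cube d ∧ ∀ j, x ∈ S j}) fun x hx => hx.1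
    have h3 : (fun θ => G θ j - net.toMap θ j) = fun θ =>
        (G θ j - ∑ a, c j a * localMonomial N a θ)
          + ∑ a, c j a * (localMonomial N a θ - netMonomial hd k N a θ) := by
      funext θ
      rw [hmap]
      simp only [mul_sub, Finset.sum_sub_distrib]
      ring
    rw [h3]
    refine (h1.add h2).mono ?_
    change K * (|B| + 1) * (N ^ s / N ^ (n + 1)) + ∑ a, |c j a| * (H / N ^ (n + 1 + d)) ≤ _
    rw [add_mul K, add_mul (K * (|B| + 1))]
    refine add_le_add le_rfl ?_
    have hNs : (1 : ℝ) ≤ (N : ℝ) ^ s := Real.one_le_rpow hN' hs0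
    calc ∑ a, |c j a| * (H / N ^ (n + 1 + d))
        ≤ ∑ _a : (Fin d → Fin (N + 1)) × (Fin (n + 1) → Option (Fin d)),
            A' * (|B| + 1) * (H / N ^ (n + 1 + d)) :=
          Finset.sum_le_sum fun a _ => mul_le_mul_of_nonneg_right (hcA j a) (by positivity)
      _ = (N + 1) ^ d * (d + 1) ^ (n + 1) * (A' * (|B| + 1) * (H / N ^ (n + 1 + d))) := by
          rw [Finset.sum_const, Finset.card_univ, card_monomials, nsmul_eq_mul]
          push_cast
          ring
      _ ≤ (2 * N) ^ d * (d + 1) ^ (n + 1) * (A' * (|B| + 1) * (H / N ^ (n + 1 + d))) := by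
          gcongr
          linarith
      _ = 2 ^ d * (d + 1) ^ (n + 1) * (A' * H) * (|B| + 1) * (1 / N ^ (n + 1)) := by
          rw [mul_pow, pow_add _ (n + 1) d]
          field_simp
      _ ≤ 2 ^ d * (d + 1) ^ (n + 1) * (A' * H) * (|B| + 1) * (N ^ s / N ^ (n + 1)) := by
          gcongr

end FBNN

namespace FBNN

variable {d : ℕ}

/-! ### Network size in terms of the accuracy -/

/-- The logarithmic factor in the size bounds. -/
noncomputable def logSize (n : ℕ) (s ε : ℝ) : ℝ := Real.log (ε ^ (-((n : ℝ) / (n - s))))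

theorem logSize_eq {n : ℕ} {s ε : ℝ} (hε : 0 < ε) :
    logSize n s ε = (n : ℝ) / (n - s) * -Real.log ε := by
  rw [logSize, Real.log_rpow hε]
  ring

theorem neg_log_le_logSize {n : ℕ} (hn : 1 ≤ n) {s ε : ℝ} (hs0 : 0 ≤ s) (hs1 : s < 1)
    (hε : 0 < ε) (hε1 : ε < 1 / 2) : -Real.log ε ≤ logSize n s ε := by
  have hn' : (1 : ℝ) ≤ n := by exact_mod_cast hn
  rw [logSize_eq hε]
  refine le_mul_of_one_le_left ?_ ?_
  · linarith [Real.log_neg hε (by linarith)]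
  · rw [one_le_div (by linarith)]
    linarith

/-- Since ε < 1/2, the logarithm exceeds log 2 > 1/2; this is how additive constants are absorbed in
all size bounds. -/
theorem half_le_logSize {n : ℕ} (hn : 1 ≤ n) {s ε : ℝ} (hs0 : 0 ≤ s) (hs1 : s < 1)
    (hε : 0 < ε) (hε1 : ε < 1 / 2) : 1 / 2 ≤ logSize n s ε := by
  refine le_trans ?_ (neg_log_le_logSize hn hs0 hs1 hε hε1)
  have h1 := Real.log_lt_log hε hε1
  rw [one_div, Real.log_inv] at h1
  linarith [Real.log_two_gt_d9]

/-- Take N = ⌈T⌉ with T = ε^(-1/(n-s)) ≥ 1, the value at which T^(s-n) = ε. -/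
theorem exists_grid_size {n : ℕ} (hn : 1 ≤ n) (d : ℕ) {s ε : ℝ} (hs0 : 0 ≤ s) (hs1 : s < 1)
    (hε : 0 < ε) (hε1 : ε < 1 / 2) :
    ∃ N : ℕ, 1 ≤ N ∧ (N : ℝ) ^ s / N ^ n ≤ ε ∧
      ((N : ℝ) + 1) ^ d ≤ 4 ^ d * ε ^ (-((d : ℝ) / (n - s))) ∧
      (Nat.clog 2 N : ℝ) ≤ 8 * logSize n s ε := by
  have hn' : (1 : ℝ) ≤ n := by exact_mod_cast hn
  have hns : 0 < (n : ℝ) - s := by linarith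
  set T : ℝ := ε ^ (-(1 / ((n : ℝ) - s))) with hT
  have hT1 : 1 ≤ T := Real.one_le_rpow_of_pos_of_le_one_of_nonpos hε (by linarith)
    (by rw [neg_nonpos]; positivity)
  have hT0 : 0 < T := by linarith
  have hlogT : Real.log T = 1 / (n - s) * -Real.log ε := by
    rw [hT, Real.log_rpow hε]
    ring
  have hle : T ≤ ⌈T⌉₊ := Nat.le_ceil T
  have hlt : (⌈T⌉₊ : ℝ) < T + 1 := Nat.ceil_lt_add_one hT0.le
  have hN1 : 1 ≤ ⌈T⌉₊ := by
    have : (1 : ℝ) ≤ ⌈T⌉₊ := hT1.trans hle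
    exact_mod_cast this
  set N := ⌈T⌉₊
  have hN0 : (0 : ℝ) < N := by linarith
  have hhalf := half_le_logSize hn hs0 hs1 hε hε1
  refine ⟨N, hN1, ?_, ?_, ?_⟩
  · rw [← Real.rpow_natCast, ← Real.rpow_sub hN0]
    calc (N : ℝ) ^ (s - n) ≤ T ^ (s - n) :=
          Real.rpow_le_rpow_of_nonpos hT0 hle (by linarith)
      _ = ε := by
          rw [hT, ← Real.rpow_mul hε.le, show -(1 / ((n : ℝ) - s)) * (s - n) = 1 by
            field_simp; ring, Real.rpow_one]
  · have h1 : ε ^ (-((d : ℝ) / (n - s))) = T ^ d := by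
      rw [hT, ← Real.rpow_natCast, ← Real.rpow_mul hε.le]
      congr 1
      ring
    rw [h1, ← mul_pow]
    exact pow_le_pow_left₀ (by positivity) (by linarith) d
  · have hlogN : Real.log N ≤ Real.log 2 + logSize n s ε := by
      have h1 : Real.log N ≤ Real.log (2 * T) := Real.log_le_log hN0 (by linarith)
      rw [Real.log_mul (by norm_num) hT0.ne', hlogT] at h1
      refine h1.trans (add_le_add le_rfl ?_)
      rw [logSize_eq hε]
      refine mul_le_mul_of_nonneg_right ?_ (by linarith [Real.log_neg hε (by linarith)])
      exact div_le_div_of_nonneg_right hn' hns.le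
    rcases Nat.lt_or_ge 1 N with h2 | h2
    · have h3 := (Nat.pow_pred_clog_lt_self Nat.one_lt_two h2).le
      have h4 : (2 : ℝ) ^ (Nat.clog 2 N).pred ≤ N := by exact_mod_cast h3
      have h5 := Real.log_le_log (by positivity) h4
      rw [Real.log_pow] at h5
      have h6 : (Nat.clog 2 N : ℝ) ≤ (Nat.clog 2 N).pred + 1 := by
        have : Nat.clog 2 N ≤ (Nat.clog 2 N).pred + 1 := by
          rw [Nat.pred_eq_sub_one]; omega
        exact_mod_cast this
      have h7 := Real.log_two_gt_d9
      have h8 := Real.log_two_lt_d9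
      have h9 : ((Nat.clog 2 N).pred : ℝ) * (1 / 2) ≤ (Nat.clog 2 N).pred * Real.log 2 :=
        mul_le_mul_of_nonneg_left (by linarith) (by positivity)
      linarith
    · rw [Nat.clog_of_right_le_one h2]
      push_cast
      linarith

/-- In the size, D comes from the output layer and the single logarithm from the depth. Keeping D
additive with A and c independent of it leaves one logarithm to spare against the required log². -/
theorem exists_net_accuracy (hd : 1 ≤ d) {n : ℕ} (hn : 1 ≤ n) {s : ℝ} (hs0 : 0 ≤ s)
    (hs1 : s < 1) :
    ∃ A c : ℝ, 0 < A ∧ 0 < c ∧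
      ∀ (D : ℕ) (B : ℝ) (G : EuclideanSpace ℝ (Fin d) → Fin D → ℝ),
      (∀ j, MemLp (fun θ => G θ j) ⊤ (cubeMeasure d)) →
      (∀ j, sobolevNormTop n (fun θ => G θ j) ≤ ENNReal.ofReal B) →
      ∃ S : Set (EuclideanSpace ℝ (Fin d)), (∀ᵐ x ∂cubeMeasure d, x ∈ S) ∧
        (∀ j, HolderOn s (2 * d * (|B| + 1)) S (fun θ => G θ j)) ∧
        ∀ ε : ℝ, 0 < ε → ε < 1 / 2 → ∃ net : ReLUNet D d,
            (∀ j, HolderOn s (A * (|B| + 1) * ε) S (fun θ => G θ j - net.toMap θ j)) ∧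
            (net.depth : ℝ) ≤ c * logSize n s ε ∧
            ((net.numWeights + net.numUnits : ℕ) : ℝ)
              ≤ c * (D + logSize n s ε) * ε ^ (-((d : ℝ) / (n - s))) := by
  obtain ⟨n, rfl⟩ : ∃ n', n = n' + 1 := ⟨n - 1, by omega⟩
  obtain ⟨A, hA, hmain⟩ := exists_net_holderOn hd n hs0 hs1
  obtain ⟨q, hq⟩ := exists_nat_ge (((n + 1 + d + 1 : ℕ) : ℝ) / (1 - s))
  rw [div_le_iff₀ (by linarith)] at hq
  set R : ℝ := ((Fintype.card (Reg (d + (n + 1))) : ℕ) : ℝ)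
  set L : ℝ := ((d + (n + 1) : ℕ) : ℝ)
  set c₁ : ℝ := L * (16 * q + 6) + 6 with hc₁
  set c₂ : ℝ := 4 ^ d * (d + 1) ^ (n + 1) * R * (2 + c₁ * (R + 2) + 2 * (d + 2)) with hc₂
  have hR : 1 ≤ R := by
    have : 0 < Fintype.card (Reg (d + (n + 1))) := Fintype.card_pos_iff.2 ⟨Reg.prod⟩
    exact Nat.one_le_cast.2 this
  have hL : 0 ≤ L := by positivity
  have hc₁0 : 0 < c₁ := by positivity
  have hc₂0 : 0 < c₂ := by positivity
  refine ⟨A, c₁ + c₂, hA, by positivity, fun D B G hG hnorm => ?_⟩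
  obtain ⟨S, hS, hreg, happ⟩ := hmain D B G hG hnorm
  refine ⟨S, hS, hreg, fun ε hε hε1 => ?_⟩
  obtain ⟨N, hN, hNε, hNd, hclog⟩ := exists_grid_size hn d hs0 hs1 hε hε1
  have hhalf := half_le_logSize hn hs0 hs1 hε hε1
  set ℓ := logSize (n + 1) s ε
  -- The choice k = q * clog 2 N makes the multiplications accurate to N^(-q) at depth O(log N).
  have hk : N ^ q ≤ 4 ^ (q * Nat.clog 2 N) := by
    calc N ^ q ≤ (2 ^ Nat.clog 2 N) ^ q := Nat.pow_le_pow_left (Nat.le_pow_clog Nat.one_lt_two N) q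
      _ = 2 ^ (q * Nat.clog 2 N) := by rw [← pow_mul, mul_comm]
      _ ≤ 4 ^ (q * Nat.clog 2 N) := Nat.pow_le_pow_left (by norm_num) _
  obtain ⟨net, hnet, hdepth, hsize⟩ := happ N (q * Nat.clog 2 N) q hN hq hk
  have hdep : ((d + (n + 1) : ℕ) * (2 * (q * Nat.clog 2 N : ℕ) + 3) + 3 : ℝ) ≤ c₁ * ℓ := by
    push_cast
    have h1 : (q : ℝ) * Nat.clog 2 N ≤ q * (8 * ℓ) :=
      mul_le_mul_of_nonneg_left hclog (by positivity)
    have h2 : 2 * ((q : ℝ) * Nat.clog 2 N) + 3 ≤ (16 * q + 6) * ℓ := by linarith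
    have h3 := mul_le_mul_of_nonneg_left h2 hL
    simp only [L] at h3 hc₁
    push_cast at h3 hc₁
    rw [hc₁]
    linarith
  refine ⟨net, fun j => (hnet j).mono ?_, ?_, ?_⟩
  · exact mul_le_mul_of_nonneg_left hNε (by positivity)
  · rw [hdepth]
    have h1 : 0 ≤ c₂ * ℓ := by positivity
    push_cast at hdep ⊢
    linarith
  · set E : ℝ := ε ^ (-((d : ℝ) / ((n + 1 : ℕ) - s)))
    set X : ℝ := ((N : ℝ) + 1) ^ d * (d + 1) ^ (n + 1)
    have hE : 0 < E := Real.rpow_pos_of_pos hε _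
    have hX1 : 1 ≤ X := by
      refine one_le_mul_of_one_le_of_one_le (one_le_pow₀ ?_) (one_le_pow₀ ?_) <;>
        exact le_add_of_nonneg_left (by positivity)
    have hX : X ≤ 4 ^ d * (d + 1) ^ (n + 1) * E := by
      have := mul_le_mul_of_nonneg_right hNd (show (0 : ℝ) ≤ (d + 1) ^ (n + 1) by positivity)
      calc X ≤ 4 ^ d * E * (d + 1) ^ (n + 1) := this
        _ = _ := by ring
    have hsize' : ((net.numWeights + net.numUnits : ℕ) : ℝ) ≤
        (D * (X * R) + D) + (L * (2 * (q * Nat.clog 2 N : ℕ) + 3) + 1) * (X * R * (R + 2))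
          + X * R * (d + 2) := by
      have := (Nat.cast_le (α := ℝ)).2 hsize
      simp only [X, R, L]
      push_cast at this ⊢
      exact this
    refine hsize'.trans ?_
    have hXR : 1 ≤ X * R := one_le_mul_of_one_le_of_one_le hX1 hR
    have hD : (D : ℝ) ≤ D * (X * R) := le_mul_of_one_le_right (by positivity) hXR
    have hDl : (0 : ℝ) ≤ D := by positivity
    calc (D * (X * R) + D) + (L * (2 * (q * Nat.clog 2 N : ℕ) + 3) + 1) * (X * R * (R + 2))
          + X * R * (d + 2)
        ≤ (D * (X * R) + D * (X * R)) + (c₁ * ℓ) * (X * R * (R + 2))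
          + X * R * ((d + 2) * (2 * ℓ)) := by
          refine add_le_add (add_le_add (by linarith) ?_) ?_
          · exact mul_le_mul_of_nonneg_right (by simp only [L]; linarith) (by positivity)
          · refine mul_le_mul_of_nonneg_left ?_ (by positivity)
            exact le_mul_of_one_le_right (by positivity) (by linarith)
      _ = X * R * (2 * D + c₁ * (R + 2) * ℓ + 2 * (d + 2) * ℓ) := by ring
      _ ≤ X * R * ((2 + c₁ * (R + 2) + 2 * (d + 2)) * (D + ℓ)) := by
          refine mul_le_mul_of_nonneg_left ?_ (by positivity)
          have h1 : 0 ≤ (c₁ * (R + 2) + 2 * (d + 2)) * D := by positivity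
          linarith
      _ ≤ (4 ^ d * (d + 1) ^ (n + 1) * E) * R * ((2 + c₁ * (R + 2) + 2 * (d + 2)) * (D + ℓ)) := by
          refine mul_le_mul_of_nonneg_right (mul_le_mul_of_nonneg_right hX (by positivity)) ?_
          positivity
      _ = c₂ * (D + ℓ) * E := by rw [hc₂]; ring
      _ ≤ (c₁ + c₂) * (D + ℓ) * E := by
          refine mul_le_mul_of_nonneg_right (mul_le_mul_of_nonneg_right ?_ ?_) hE.le
          · linarith
          · positivity

end FBNN

namespace FBNN

variable {d D : ℕ}

/-! ### The potential -/

/-- Expanding about G, with Γ⁻¹ symmetric, leaves the emulator only inside the error G - G', so no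
separate bound on G' is needed. -/
theorem potential_sub_eq {Γ : Matrix (Fin D) (Fin D) ℝ} (hΓ : Γ.PosDef)
    (G G' : EuclideanSpace ℝ (Fin d) → Fin D → ℝ) (y : Fin D → ℝ)
    (θ : EuclideanSpace ℝ (Fin d)) :
    potential Γ G y θ - potential Γ G' y θ
      = ∑ i, ∑ j, (-(1 / 2) * Γ⁻¹ i j) * ((G θ i - G' θ i) *
          (2 * y j - 2 * G θ j + (G θ j - G' θ j))) := by
  have hsymm : ∀ i j, Γ⁻¹ i j = Γ⁻¹ j i := fun i j => by
    have := hΓ.inv.isHermitian.apply i j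
    simpa using this.symm
  have hquad : ∀ v : Fin D → ℝ, v ⬝ᵥ (Γ⁻¹ *ᵥ v) = ∑ i, ∑ j, Γ⁻¹ i j * (v i * v j) := by
    intro v
    simp only [dotProduct, Matrix.mulVec, Finset.mul_sum]
    refine Finset.sum_congr rfl fun i _ => Finset.sum_congr rfl fun j _ => by ring
  set u : Fin D → ℝ := fun i => G θ i - G' θ i
  set v : Fin D → ℝ := fun i => y i - G θ i
  have hcross : ∑ i, ∑ j, Γ⁻¹ i j * (v i * u j) = ∑ i, ∑ j, Γ⁻¹ i j * (u i * v j) := by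
    rw [Finset.sum_comm]
    refine Finset.sum_congr rfl fun i _ => Finset.sum_congr rfl fun j _ => ?_
    rw [hsymm j i]
    ring
  have h2 : ∑ i, ∑ j, Γ⁻¹ i j * ((v i + u i) * (v j + u j))
      = ∑ i, ∑ j, Γ⁻¹ i j * (v i * v j) + ∑ i, ∑ j, Γ⁻¹ i j * (v i * u j)
        + ∑ i, ∑ j, Γ⁻¹ i j * (u i * v j) + ∑ i, ∑ j, Γ⁻¹ i j * (u i * u j) := by
    simp only [← Finset.sum_add_distrib]
    refine Finset.sum_congr rfl fun i _ => Finset.sum_congr rfl fun j _ => by ring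
  have h3 : ∑ i, ∑ j, (-(1 / 2) * Γ⁻¹ i j) * (u i * (2 * y j - 2 * G θ j + u j))
      = -(∑ i, ∑ j, Γ⁻¹ i j * (u i * v j)) - 1 / 2 * ∑ i, ∑ j, Γ⁻¹ i j * (u i * u j) := by
    simp only [Finset.mul_sum, ← Finset.sum_neg_distrib, ← Finset.sum_sub_distrib]
    refine Finset.sum_congr rfl fun i _ => Finset.sum_congr rfl fun j _ => ?_
    simp only [v]
    ring
  rw [potential, potential, hquad, hquad]
  rw [h3]
  have h4 : ∀ i, (y - G' θ) i = v i + u i := fun i => by simp [v, u]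
  have h5 : ∀ i, (y - G θ) i = v i := fun i => by simp [v]
  simp only [h4, h5]
  rw [h2, hcross]
  ring

theorem holderOn_potential_sub {Γ : Matrix (Fin D) (Fin D) ℝ} (hΓ : Γ.PosDef)
    {G G' : EuclideanSpace ℝ (Fin d) → Fin D → ℝ} {s b e M : ℝ} (hb : 0 ≤ b) (he : 0 ≤ e)
    {S : Set (EuclideanSpace ℝ (Fin d))} (hG : ∀ j, HolderOn s b S (fun θ => G θ j))
    (hE : ∀ j, HolderOn s e S (fun θ => G θ j - G' θ j)) {y : Fin D → ℝ} (hy : ‖y‖ ≤ M) :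
    HolderOn s ((∑ i, ∑ j, |Γ⁻¹ i j|) * (2 * M + 2 * b + e) * e) S
      (fun θ => potential Γ G y θ - potential Γ G' y θ) := by
  have hM : 0 ≤ M := (norm_nonneg y).trans hy
  simp only [potential_sub_eq hΓ]
  have h := HolderOn.sum Finset.univ fun i => HolderOn.sum Finset.univ fun j =>
    (((hE i).mul he (C' := 2 * M + 2 * b + e) (by positivity)
      ((((HolderOn.const (s := s) (S := S) (2 * y j)).sub ((hG j).const_mul 2)).add (hE j)).mono
        (by
          have : |y j| ≤ M := (norm_le_pi_norm y j).trans hy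
          rw [abs_mul]
          norm_num
          linarith))).const_mul (-(1 / 2) * Γ⁻¹ i j))
  refine h.mono (le_of_eq ?_)
  simp only [Finset.sum_mul]
  refine Finset.sum_congr rfl fun i _ => Finset.sum_congr rfl fun j _ => ?_
  rw [abs_mul]
  norm_num
  ring

theorem slobodeckijNormTop_le {s C : ℝ} {S : Set (EuclideanSpace ℝ (Fin d))}
    (hS : ∀ᵐ x ∂cubeMeasure d, x ∈ S) {e : EuclideanSpace ℝ (Fin d) → ℝ}
    (he : HolderOn s C S e) : slobodeckijNormTop s e ≤ ENNReal.ofReal C := by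
  have h1 : eLpNorm e ⊤ (cubeMeasure d) ≤ ENNReal.ofReal C := by
    rw [eLpNorm_exponent_top]
    refine eLpNormEssSup_le_of_ae_bound ?_
    filter_upwards [hS] with x hx
    exact he.bound x hx
  unfold slobodeckijNormTop
  split_ifs
  · exact h1
  · refine max_le h1 ?_
    rw [eLpNorm_exponent_top]
    refine eLpNormEssSup_le_of_ae_bound ?_
    have h2 : ∀ᵐ z ∂(cubeMeasure d).prod (cubeMeasure d), z.1 ∈ S :=
      Measure.quasiMeasurePreserving_fst.ae hS
    have h3 : ∀ᵐ z ∂(cubeMeasure d).prod (cubeMeasure d), z.2 ∈ S :=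
      Measure.quasiMeasurePreserving_snd.ae hS
    filter_upwards [h2, h3] with z hz1 hz2
    have hp : 0 ≤ ‖z.1 - z.2‖ ^ s := by positivity
    rw [Real.norm_eq_abs, abs_div, abs_of_nonneg hp]
    -- This form also covers the diagonal, where the denominator vanishes and the quotient is 0.
    refine div_le_of_le_mul₀ hp ?_ (he.holder _ hz1 _ hz2)
    exact (abs_nonneg _).trans (he.bound _ hz1)

/-! ### The Hellinger distance of Gaussian likelihoods -/

/-- The quadratic form of the inverse covariance. -/
noncomputable def quadForm (Γ : Matrix (Fin D) (Fin D) ℝ) (v : Fin D → ℝ) : ℝ :=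
  v ⬝ᵥ (Γ⁻¹ *ᵥ v)

theorem continuous_quadForm (Γ : Matrix (Fin D) (Fin D) ℝ) : Continuous (quadForm Γ) := by
  unfold quadForm
  fun_prop

theorem quadForm_nonneg {Γ : Matrix (Fin D) (Fin D) ℝ} (hΓ : Γ.PosDef) (v : Fin D → ℝ) :
    0 ≤ quadForm Γ v := by
  have := hΓ.inv.posSemidef.dotProduct_mulVec_nonneg v
  simpa [quadForm] using this

theorem quadForm_smul (Γ : Matrix (Fin D) (Fin D) ℝ) (t : ℝ) (v : Fin D → ℝ) :
    quadForm Γ (t • v) = t ^ 2 * quadForm Γ v := by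
  simp only [quadForm, Matrix.mulVec_smul, smul_dotProduct, dotProduct_smul, smul_eq_mul]
  ring

theorem quadForm_le (Γ : Matrix (Fin D) (Fin D) ℝ) {v : Fin D → ℝ} {e : ℝ} (he : 0 ≤ e)
    (hv : ∀ i, |v i| ≤ e) : quadForm Γ v ≤ (∑ i, ∑ j, |Γ⁻¹ i j|) * e ^ 2 := by
  simp only [quadForm, dotProduct, Matrix.mulVec, Finset.mul_sum, Finset.sum_mul]
  refine Finset.sum_le_sum fun i _ => Finset.sum_le_sum fun j _ => ?_
  refine (le_abs_self _).trans ?_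
  rw [abs_mul, abs_mul]
  have := mul_le_mul (hv i) (hv j) (abs_nonneg _) he
  nlinarith [abs_nonneg (Γ⁻¹ i j)]

/-- The parallelogram identity. -/
theorem quadForm_midpoint (Γ : Matrix (Fin D) (Fin D) ℝ) (y a b : Fin D → ℝ) :
    (quadForm Γ (y - a) + quadForm Γ (y - b)) / 2
      = quadForm Γ (y - (1 / 2 : ℝ) • (a + b)) + quadForm Γ (a - b) / 4 := by
  simp only [quadForm, dotProduct, Matrix.mulVec, Finset.mul_sum, Finset.sum_div,
    ← Finset.sum_add_distrib]
  refine Finset.sum_congr rfl fun i _ => Finset.sum_congr rfl fun j _ => ?_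
  simp
  ring

/-- Coercivity by minimizing over the compact unit sphere and scaling; D = 0 is separate since that
sphere is then empty. It gives a product Gaussian as integrable majorant. -/
theorem exists_le_quadForm {Γ : Matrix (Fin D) (Fin D) ℝ} (hΓ : Γ.PosDef) :
    ∃ κ : ℝ, 0 < κ ∧ ∀ v, κ * ∑ i, v i ^ 2 ≤ quadForm Γ v := by
  rcases Nat.eq_zero_or_pos D with rfl | hD
  · exact ⟨1, one_pos, fun v => by simp [quadForm]⟩
  have hcont := continuous_quadForm Γ
  have hne : (Metric.sphere (0 : Fin D → ℝ) 1).Nonempty := by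
    have : Nonempty (Fin D) := ⟨⟨0, hD⟩⟩
    exact NormedSpace.sphere_nonempty.2 zero_le_one
  obtain ⟨w, hw, hmin⟩ := (isCompact_sphere (0 : Fin D → ℝ) 1).exists_isMinOn hne
    hcont.continuousOn
  have hw0 : w ≠ 0 := by
    rintro rfl
    simp at hw
  have hpos : 0 < quadForm Γ w := by
    have := hΓ.inv.dotProduct_mulVec_pos hw0
    simpa [quadForm] using this
  have hD' : (0 : ℝ) < D := by exact_mod_cast hD
  refine ⟨quadForm Γ w / D, by positivity, fun v => ?_⟩
  by_cases hv : v = 0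
  · simp [hv, quadForm]
  have hnv : 0 < ‖v‖ := norm_pos_iff.2 hv
  have h1 : quadForm Γ w ≤ quadForm Γ (‖v‖⁻¹ • v) := hmin (by
    rw [mem_sphere_zero_iff_norm, norm_smul, norm_inv, norm_norm, inv_mul_cancel₀ hnv.ne'])
  rw [quadForm_smul, inv_pow, ← div_eq_inv_mul, le_div_iff₀ (by positivity)] at h1
  have h2 : ∑ i, v i ^ 2 ≤ D * ‖v‖ ^ 2 := by
    refine (Finset.sum_le_card_nsmul _ _ (‖v‖ ^ 2) fun i _ => ?_).trans (by simp)
    rw [← sq_abs]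
    exact pow_le_pow_left₀ (abs_nonneg _) (norm_le_pi_norm v i) 2
  calc quadForm Γ w / D * ∑ i, v i ^ 2 ≤ quadForm Γ w / D * (D * ‖v‖ ^ 2) :=
        mul_le_mul_of_nonneg_left h2 (by positivity)
    _ = quadForm Γ w * ‖v‖ ^ 2 := by field_simp
    _ ≤ quadForm Γ v := h1

theorem integrable_exp_neg_quadForm {Γ : Matrix (Fin D) (Fin D) ℝ} (hΓ : Γ.PosDef) :
    Integrable fun v : Fin D → ℝ => Real.exp (-(1 / 2 * quadForm Γ v)) := by
  obtain ⟨κ, hκ, hle⟩ := exists_le_quadForm hΓ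
  have h1 : Integrable fun v : Fin D → ℝ => ∏ i, Real.exp (-(κ / 2) * v i ^ 2) :=
    Integrable.fintype_prod fun _ => integrable_exp_neg_mul_sq (by positivity)
  refine h1.mono' ?_ (Filter.Eventually.of_forall fun v => ?_)
  · have := continuous_quadForm Γ
    exact (by fun_prop : Continuous fun v : Fin D → ℝ =>
      Real.exp (-(1 / 2 * quadForm Γ v))).aestronglyMeasurable
  · rw [Real.norm_of_nonneg (Real.exp_pos _).le, ← Real.exp_sum]
    refine Real.exp_le_exp.2 ?_
    rw [← Finset.mul_sum]
    linarith [hle v]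

/-- Both likelihoods are translates of one Gaussian, with the same normalizer. By the parallelogram
identity the geometric mean of their densities is exp (-Q/8) times the translate centred at the
midpoint, so the squared distance is 1 - exp (-Q/8) ≤ Q/8. -/
theorem hellingerDist_likelihood_le {Γ : Matrix (Fin D) (Fin D) ℝ} (hΓ : Γ.PosDef)
    (G G' : EuclideanSpace ℝ (Fin d) → Fin D → ℝ) (θ : EuclideanSpace ℝ (Fin d)) {e : ℝ}
    (he : 0 ≤ e) (hE : ∀ j, |G θ j - G' θ j| ≤ e) :
    hellingerDist volume (likelihood Γ G θ) (likelihood Γ G' θ)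
      ≤ ENNReal.ofReal ((1 + ∑ i, ∑ j, |Γ⁻¹ i j|) * e) := by
  set h : (Fin D → ℝ) → ℝ := fun v => Real.exp (-(1 / 2 * quadForm Γ v)) with hh
  have hInt : Integrable h := integrable_exp_neg_quadForm hΓ
  set Z : ℝ := ∫ v, h v with hZ
  have hZpos : 0 < Z := by
    refine (integral_pos_iff_support_of_nonneg (fun v => (Real.exp_pos _).le) hInt).2 ?_
    have : Function.support h = univ := by
      ext v
      simp [h, (Real.exp_pos _).ne']
    rw [this]
    exact Measure.measure_univ_pos.2 (NeZero.ne _)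
  set a := G θ
  set b := G' θ
  have hlik : ∀ (F : EuclideanSpace ℝ (Fin d) → Fin D → ℝ) (y : Fin D → ℝ),
      likelihood Γ F θ y = h (y - F θ) / Z := by
    intro F y
    have h1 : ∀ z, Real.exp (-potential Γ F z θ) = h (z - F θ) := fun z => rfl
    simp only [likelihood, h1]
    rw [integral_sub_right_eq_self h]
  set μ : Fin D → ℝ := (1 / 2 : ℝ) • (a + b)
  set Q : ℝ := quadForm Γ (a - b) with hQ
  have hsqrt : ∀ y, (√(likelihood Γ G θ y) - √(likelihood Γ G' θ y)) ^ 2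
      = (h (y - a) + h (y - b) - 2 * Real.exp (-(Q / 8)) * h (y - μ)) / Z := by
    intro y
    have hp : 0 ≤ h (y - a) / Z := by positivity
    have hq : 0 ≤ h (y - b) / Z := by positivity
    have hpq : √(h (y - a) / Z) * √(h (y - b) / Z) = Real.exp (-(Q / 8)) * h (y - μ) / Z := by
      rw [← Real.sqrt_mul hp]
      have hprod : h (y - a) / Z * (h (y - b) / Z)
          = (Real.exp (-(Q / 8)) * h (y - μ) / Z) ^ 2 := by
        have hexp : h (y - a) * h (y - b) = (Real.exp (-(Q / 8)) * h (y - μ)) ^ 2 := by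
          simp only [h]
          rw [← Real.exp_add, ← Real.exp_add, ← Real.exp_nat_mul]
          congr 1
          push_cast
          have := quadForm_midpoint Γ y a b
          simp only [μ, Q]
          linarith
        rw [div_pow, ← hexp]
        ring
      rw [hprod, Real.sqrt_sq (by positivity)]
    rw [hlik, hlik, sub_sq, Real.sq_sqrt hp, Real.sq_sqrt hq, mul_assoc, hpq]
    ring
  have hia : Integrable fun y => h (y - a) := hInt.comp_sub_right a
  have hib : Integrable fun y => h (y - b) := hInt.comp_sub_right b
  have hab : Integrable fun y => h (y - a) + h (y - b) := hia.add hib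
  have him : Integrable fun y => 2 * Real.exp (-(Q / 8)) * h (y - μ) :=
    (hInt.comp_sub_right μ).const_mul _
  have hI : ∫ y, (√(likelihood Γ G θ y) - √(likelihood Γ G' θ y)) ^ 2
      = 2 * (1 - Real.exp (-(Q / 8))) := by
    simp only [hsqrt]
    rw [integral_div, integral_sub hab him, integral_add hia hib, integral_const_mul,
      integral_sub_right_eq_self h, integral_sub_right_eq_self h, integral_sub_right_eq_self h,
      ← hZ]
    field_simp
    ring
  have hIint : Integrable fun y => (√(likelihood Γ G θ y) - √(likelihood Γ G' θ y)) ^ 2 := by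
    simp only [hsqrt]
    exact (hab.sub him).div_const Z
  have hQ0 : 0 ≤ Q := quadForm_nonneg hΓ _
  set g : ℝ := ∑ i, ∑ j, |Γ⁻¹ i j| with hg
  have hg0 : 0 ≤ g := Finset.sum_nonneg fun i _ => Finset.sum_nonneg fun j _ => abs_nonneg _
  have hQle : Q ≤ g * e ^ 2 := quadForm_le Γ he hE
  have hexp : 1 - Real.exp (-(Q / 8)) ≤ ((1 + g) * e) ^ 2 := by
    have h1 := Real.add_one_le_exp (-(Q / 8))
    have h2 : g * e ^ 2 ≤ ((1 + g) * e) ^ 2 := by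
      rw [mul_pow]
      refine mul_le_mul_of_nonneg_right ?_ (by positivity)
      nlinarith
    linarith
  unfold hellingerDist
  rw [← ofReal_integral_eq_lintegral_ofReal hIint
    (Filter.Eventually.of_forall fun y => sq_nonneg _), hI,
    ENNReal.ofReal_mul (by norm_num), ENNReal.ofReal_ofNat, ← mul_assoc,
    ENNReal.inv_mul_cancel (by norm_num) (by norm_num), one_mul]
  calc ENNReal.ofReal (1 - Real.exp (-(Q / 8))) ^ (1 / 2 : ℝ)
      ≤ ENNReal.ofReal (((1 + g) * e) ^ 2) ^ (1 / 2 : ℝ) :=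
        ENNReal.rpow_le_rpow (ENNReal.ofReal_le_ofReal hexp) (by norm_num)
    _ = ENNReal.ofReal ((1 + g) * e) := by
        rw [ENNReal.ofReal_rpow_of_nonneg (by positivity) (by norm_num), ← Real.sqrt_eq_rpow,
          Real.sqrt_sq (by positivity)]

end FBNN

namespace FBNN

variable {d D : ℕ}

/-! ### Conclusion -/

theorem exists_zero_net (D d : ℕ) : ∃ net : ReLUNet D d, (∀ θ j, net.toMap θ j = 0) ∧
    net.depth = 1 ∧ net.numWeights + net.numUnits = 0 := by
  refine ⟨.output 0 0, fun θ j => ?_, rfl, ?_⟩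
  · simp [ReLUNet.toMap, ReLUNet.eval]
  · simp [ReLUNet.numWeights, ReLUNet.numUnits, ReLUNet.layerWeights]

/-- The constant by which errors of the forward map enter potentials and likelihoods. -/
noncomputable def errorConst (Γ : Matrix (Fin D) (Fin D) ℝ) (M b A : ℝ) : ℝ :=
  (∑ i, ∑ j, |Γ⁻¹ i j|) * (2 * |M| + 2 * b + A) * A + (1 + ∑ i, ∑ j, |Γ⁻¹ i j|) * A + 1

/-- The summand 1 in `errorConst` guarantees ε / C ≤ ε, so that ε / C is again an admissible
accuracy. -/
theorem one_le_errorConst (Γ : Matrix (Fin D) (Fin D) ℝ) (M : ℝ) {b A : ℝ} (hb : 0 ≤ b)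
    (hA : 0 ≤ A) : 1 ≤ errorConst Γ M b A :=
  le_add_of_nonneg_left (by positivity)

theorem error_estimates {Γ : Matrix (Fin D) (Fin D) ℝ} (hΓ : Γ.PosDef)
    {G G' : EuclideanSpace ℝ (Fin d) → Fin D → ℝ} {s b A ε : ℝ} (M : ℝ) (hb : 0 ≤ b)
    (hA : 0 ≤ A) (hε : 0 ≤ ε) (hε1 : ε ≤ 1) {S : Set (EuclideanSpace ℝ (Fin d))}
    (hS : ∀ᵐ x ∂cubeMeasure d, x ∈ S) (hG : ∀ j, HolderOn s b S (fun θ => G θ j))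
    (hE : ∀ j, HolderOn s (A * ε) S (fun θ => G θ j - G' θ j)) :
    (∀ y : Fin D → ℝ, ‖y‖ ≤ M →
      slobodeckijNormTop s (fun θ => potential Γ G y θ - potential Γ G' y θ)
        ≤ ENNReal.ofReal (errorConst Γ M b A * ε)) ∧
    ∀ᵐ θ ∂cubeMeasure d, hellingerDist volume (likelihood Γ G θ) (likelihood Γ G' θ)
      ≤ ENNReal.ofReal (errorConst Γ M b A * ε) := by
  have he : 0 ≤ A * ε := by positivity
  have heA : A * ε ≤ A := mul_le_of_le_one_right hA hε1
  set g : ℝ := ∑ i, ∑ j, |Γ⁻¹ i j| with hg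
  have hg0 : 0 ≤ g := Finset.sum_nonneg fun i _ => Finset.sum_nonneg fun j _ => abs_nonneg _
  have hC : errorConst Γ M b A * ε
      = g * (2 * |M| + 2 * b + A) * (A * ε) + (1 + g) * (A * ε) + ε := by
    rw [errorConst, ← hg]
    ring
  refine ⟨fun y hy => ?_, ?_⟩
  · refine slobodeckijNormTop_le hS
      ((holderOn_potential_sub hΓ hb he hG hE (hy.trans (le_abs_self M))).mono ?_)
    have h1 : g * (2 * |M| + 2 * b + A * ε) * (A * ε) ≤ g * (2 * |M| + 2 * b + A) * (A * ε) := by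
      gcongr
    have h2 : 0 ≤ (1 + g) * (A * ε) := by positivity
    rw [hC]
    linarith
  · filter_upwards [hS] with θ hθ
    refine (hellingerDist_likelihood_le hΓ G G' θ he fun j => (hE j).bound θ hθ).trans ?_
    refine ENNReal.ofReal_le_ofReal ?_
    have h2 : 0 ≤ g * (2 * |M| + 2 * b + A) * (A * ε) := by positivity
    rw [hC]
    linarith

theorem exp_neg_le_of_logSize_lt {n : ℕ} (hn : 1 ≤ n) {s ε t : ℝ} (hs0 : 0 ≤ s) (hs1 : s < 1)
    (hε : 0 < ε) (hε1 : ε < 1 / 2) (ht : logSize n s ε < t) : 1 ≤ Real.exp t * ε := by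
  have h1 := neg_log_le_logSize hn hs0 hs1 hε hε1
  have h2 : Real.exp (-t) ≤ ε := by
    rw [← Real.le_log_iff_exp_le hε]
    linarith
  calc (1 : ℝ) = Real.exp t * Real.exp (-t) := by rw [← Real.exp_add]; simp
    _ ≤ Real.exp t * ε := mul_le_mul_of_nonneg_left h2 (Real.exp_pos _).le

theorem logSize_div_le {n : ℕ} (hn : 1 ≤ n) {s ε C : ℝ} (hs0 : 0 ≤ s) (hs1 : s < 1)
    (hε : 0 < ε) (hε1 : ε < 1 / 2) (hC : 1 ≤ C) :
    logSize n s (ε / C) ≤ (1 + 2 * ((n : ℝ) / (n - s) * Real.log C)) * logSize n s ε := by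
  have hn' : (1 : ℝ) ≤ n := by exact_mod_cast hn
  have hns : 0 < (n : ℝ) - s := by linarith
  have h1 : logSize n s (ε / C) = logSize n s ε + (n : ℝ) / (n - s) * Real.log C := by
    rw [logSize_eq (by positivity), logSize_eq hε, Real.log_div hε.ne' (by positivity)]
    ring
  have h2 : 0 ≤ (n : ℝ) / (n - s) * Real.log C := mul_nonneg (by positivity) (Real.log_nonneg hC)
  have h3 := half_le_logSize hn hs0 hs1 hε hε1
  rw [h1]
  nlinarith

end FBNN

theorem theorem2 (d n : ℕ) (hd : 1 ≤ d) (hn : 1 ≤ n) (s : ℝ) (hs0 : 0 ≤ s) (hs1 : s < 1) :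
    ∃ c : ℝ, 0 < c ∧
      ∀ (D : ℕ) (Γ : Matrix (Fin D) (Fin D) ℝ), Γ.PosDef → ∀ (M B : ℝ),
        ∃ C c' : ℝ, 0 < C ∧ 0 < c' ∧
          ∀ (G : EuclideanSpace ℝ (Fin d) → Fin D → ℝ),
            (∀ j, FBNN.MemSobolev n ∞ (fun θ => G θ j)) →
            (∀ j, FBNN.sobolevNormTop n (fun θ => G θ j) ≤ ENNReal.ofReal B) →
            ∀ ε : ℝ, 0 < ε → ε < 1 / 2 →
              (∃ Ge : FBNN.ReLUNet D d, Ge.SizeBound n s c ε ∧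
                (∀ y : Fin D → ℝ, ‖y‖ ≤ M →
                  FBNN.slobodeckijNormTop s (fun θ => FBNN.potential Γ G y θ
                    - FBNN.potential Γ Ge.toMap y θ) ≤ ENNReal.ofReal (C * ε)) ∧
                ∀ᵐ θ ∂FBNN.cubeMeasure d, FBNN.hellingerDist volume
                  (FBNN.likelihood Γ G θ) (FBNN.likelihood Γ Ge.toMap θ)
                    ≤ ENNReal.ofReal (C * ε)) ∧
              (∃ Ge : FBNN.ReLUNet D d, Ge.SizeBound n s c' ε ∧
                (∀ y : Fin D → ℝ, ‖y‖ ≤ M →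
                  FBNN.slobodeckijNormTop s (fun θ => FBNN.potential Γ G y θ
                    - FBNN.potential Γ Ge.toMap y θ) ≤ ENNReal.ofReal ε) ∧
                ∀ᵐ θ ∂FBNN.cubeMeasure d, FBNN.hellingerDist volume
                  (FBNN.likelihood Γ G θ) (FBNN.likelihood Γ Ge.toMap θ)
                    ≤ ENNReal.ofReal (C * ε)) := by
  obtain ⟨A, c₀, hA, hc₀, hmain⟩ := FBNN.exists_net_accuracy hd hn hs0 hs1
  have hn' : (1 : ℝ) ≤ n := by exact_mod_cast hn
  have hns : 0 < (n : ℝ) - s := by linarith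
  -- For D ≤ ℓ one has D + ℓ ≤ 4ℓ² because ℓ ≥ 1/2. The summand 2 gives the zero network its depth:
  -- 1 ≤ 2ℓ.
  refine ⟨4 * c₀ + 2, by positivity, fun D Γ hΓ M B => ?_⟩
  set b : ℝ := 2 * d * (|B| + 1)
  have hb : 0 ≤ b := by positivity
  -- The first term bounds the error of the constructed network; the second is for the zero network,
  -- whose error b is at most b * exp D * ε when ℓ < D.
  set A₁ : ℝ := A * (|B| + 1) + b * Real.exp D
  have hA₁ : 0 ≤ A₁ := by positivity
  set C : ℝ := FBNN.errorConst Γ M b A₁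
  have hC : 1 ≤ C := FBNN.one_le_errorConst Γ M hb hA₁
  have hC0 : 0 < C := by linarith
  set P : ℝ := 1 + 2 * ((n : ℝ) / (n - s) * Real.log C)
  have hP : 0 < P := by
    have : 0 ≤ (n : ℝ) / (n - s) * Real.log C := mul_nonneg (by positivity) (Real.log_nonneg hC)
    linarith
  set q : ℝ := C ^ ((d : ℝ) / (n - s))
  have hq : 0 < q := Real.rpow_pos_of_pos hC0 _
  -- Passing from ε to ε / C multiplies the logarithm by at most P and the power of ε by q. Here D
  -- may enter the constant, so no case distinction is needed.
  refine ⟨C, c₀ * P + 2 * (c₀ * (2 * D + P) * q), hC0, by positivity, ?_⟩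
  intro G hG hnorm ε hε hε1
  obtain ⟨S, hS, hreg, happ⟩ := hmain D B G (fun j => (hG j).1) hnorm
  have hhalf := FBNN.half_le_logSize hn hs0 hs1 hε hε1
  have hD0 : (0 : ℝ) ≤ D := by positivity
  refine ⟨?_, ?_⟩
  · rcases le_or_gt (D : ℝ) (FBNN.logSize n s ε) with hD | hD
    · obtain ⟨net, hnet, hdepth, hsize⟩ := happ ε hε hε1
      refine ⟨net, ⟨?_, ?_⟩, FBNN.error_estimates hΓ M hb hA₁ hε.le (by linarith) hS hreg
        fun j => (hnet j).mono (mul_le_mul_of_nonneg_right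
          (le_add_of_nonneg_right (by positivity)) hε.le)⟩
      · change _ ≤ _ * FBNN.logSize n s ε
        nlinarith
      · change _ ≤ _ * _ * FBNN.logSize n s ε ^ 2
        refine hsize.trans ?_
        set ℓ := FBNN.logSize n s ε
        set E : ℝ := ε ^ (-((d : ℝ) / (n - s)))
        have hE : 0 < E := Real.rpow_pos_of_pos hε _
        have h1 : c₀ * (D + ℓ) ≤ (4 * c₀ + 2) * ℓ ^ 2 := by
          have h2 : ℓ ≤ 2 * ℓ ^ 2 := by nlinarith
          have h3 : c₀ * (D + ℓ) ≤ c₀ * (4 * ℓ ^ 2) :=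
            mul_le_mul_of_nonneg_left (by linarith) hc₀.le
          nlinarith
        calc c₀ * (D + ℓ) * E ≤ (4 * c₀ + 2) * ℓ ^ 2 * E := mul_le_mul_of_nonneg_right h1 hE.le
          _ = (4 * c₀ + 2) * E * ℓ ^ 2 := by ring
    · obtain ⟨net, hmap, hdepth, hsize⟩ := FBNN.exists_zero_net D d
      refine ⟨net, ⟨?_, ?_⟩, FBNN.error_estimates hΓ M hb hA₁ hε.le (by linarith) hS hreg
        fun j => ?_⟩
      · change _ ≤ _ * FBNN.logSize n s ε
        rw [hdepth]
        push_cast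
        nlinarith
      · rw [hsize]
        have : 0 ≤ ε ^ (-((d : ℝ) / (n - s))) := by positivity
        push_cast
        positivity
      · simp only [hmap, sub_zero]
        refine (hreg j).mono ?_
        have h1 := FBNN.exp_neg_le_of_logSize_lt hn hs0 hs1 hε hε1 hD
        calc b ≤ b * (Real.exp D * ε) := le_mul_of_one_le_right hb h1
          _ = b * Real.exp D * ε := by ring
          _ ≤ A₁ * ε := mul_le_mul_of_nonneg_right
              (le_add_of_nonneg_left (by positivity)) hε.le
  · have hε' : 0 < ε / C := by positivity
    have hεC : ε / C ≤ ε := div_le_self hε.le hC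
    obtain ⟨net, hnet, hdepth, hsize⟩ := happ (ε / C) hε' (by linarith)
    have hlog := FBNN.logSize_div_le hn hs0 hs1 hε hε1 hC
    obtain ⟨hpot, hhel⟩ := FBNN.error_estimates hΓ M hb hA₁ hε'.le (by linarith) hS hreg
      fun j => (hnet j).mono (mul_le_mul_of_nonneg_right
        (le_add_of_nonneg_right (by positivity)) hε'.le)
    have hCε : FBNN.errorConst Γ M b A₁ * (ε / C) = ε := mul_div_cancel₀ ε hC0.ne'
    rw [hCε] at hpot hhel
    refine ⟨net, ⟨?_, ?_⟩, hpot, ?_⟩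
    · change _ ≤ _ * FBNN.logSize n s ε
      have h1 : c₀ * FBNN.logSize n s (ε / C) ≤ c₀ * (P * FBNN.logSize n s ε) :=
        mul_le_mul_of_nonneg_left hlog hc₀.le
      have h2 : 0 ≤ 2 * (c₀ * (2 * D + P) * q) * FBNN.logSize n s ε := by positivity
      linarith
    · change _ ≤ _ * _ * FBNN.logSize n s ε ^ 2
      refine hsize.trans ?_
      have hpow : (ε / C) ^ (-((d : ℝ) / (n - s))) = q * ε ^ (-((d : ℝ) / (n - s))) := by
        rw [Real.div_rpow hε.le hC0.le, Real.rpow_neg hC0.le, div_inv_eq_mul, mul_comm]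
      rw [hpow]
      set ℓ := FBNN.logSize n s ε
      set E : ℝ := ε ^ (-((d : ℝ) / (n - s)))
      have hE : 0 < E := Real.rpow_pos_of_pos hε _
      have h2 : ℓ ≤ 2 * ℓ ^ 2 := by nlinarith
      have h3 : D + FBNN.logSize n s (ε / C) ≤ (2 * D + P) * ℓ := by
        have : (D : ℝ) ≤ 2 * D * ℓ := by nlinarith
        linarith
      calc c₀ * (D + FBNN.logSize n s (ε / C)) * (q * E)
          ≤ c₀ * ((2 * D + P) * (2 * ℓ ^ 2)) * (q * E) := by
            refine mul_le_mul_of_nonneg_right (mul_le_mul_of_nonneg_left ?_ hc₀.le)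
              (by positivity)
            exact h3.trans (mul_le_mul_of_nonneg_left h2 (by positivity))
        _ = 2 * (c₀ * (2 * D + P) * q) * E * ℓ ^ 2 := by ring
        _ ≤ (c₀ * P + 2 * (c₀ * (2 * D + P) * q)) * E * ℓ ^ 2 := by
            refine mul_le_mul_of_nonneg_right (mul_le_mul_of_nonneg_right ?_ hE.le)
              (by positivity)
            exact le_add_of_nonneg_left (by positivity)
    · filter_upwards [hhel] with θ hθ
      exact hθ.trans (ENNReal.ofReal_le_ofReal (le_mul_of_one_le_left hε.le hC))
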